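/- **Setting.** Let $d\ge 0$ be an integer and $(\Omega,\mathscr B,\mathbf P)$ a probability space. For $n\ge 0$, a *tempered generalized stochastic process* (GSP) on $\mathbb R^{n}$ is a continuous conjugate-linear map $u:\mathscr S(\mathbb R^n)\to L^2(\Omega)$, $\varphi\mapsto(u,\varphi)$. Tempered distributions act conjugate-linearly, $(f,\varphi)=\int f\overline{\varphi}$ for functions $f$; tensor products of tempered distributions and compositions with invertible linear maps are the usual extensions of these operations on functions. The covariance operator $\mathscr K_u:\mathscr S(\mathbb R^n)\to\mathscr S'(\mathbb R^n)$ of $u$ is given by $(\mathscr K_u\psi,\varphi)=\mathbf E\big((u,\varphi)\overline{(u,\psi)}\big)$. For $f,g\in\mathscr S(\mathbb R^n)$ let $$W(g,f)(x,\xi)=(2\pi)^{-n/2}\int_{\mathbb R^n} g(x+y/2)\,\overline{f(x-y/2)}\,e^{-i\langle y,\xi\rangle}\,dy .$$ The Weyl symbol of an operator $\mathscr K:\mathscr S(\mathbb R^n)\to\mathscr S'(\mathbb R^n)$ is the $\sigma\in\mathscr S'(\mathbb R^{2n})$ with $(\mathscr Kf,g)=(2\pi)^{-n/2}(\sigma,W(g,f))$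 for all $f,g\in\mathscr S(\mathbb R^n)$. A tempered GSP $u$ is *Gaussian* if for all $\varphi_1,\dots,\varphi_m$ the real and imaginary parts of $(u,\varphi_1),\dots,(u,\varphi_m)$ are jointly Gaussian (possibly degenerate), and *symmetric* if $\lambda u$ and $u$ have the same finite-dimensional distributions for every $\lambda\in\mathbb C$ with $|\lambda|=1$ (so that $u$ has zero mean). **Theorem.** Let $u$ be a symmetric Gaussian tempered GSP on $\mathbb R^d$. Then its covariance operator has a unique Weyl symbol $\sigma_u\in\mathscr S'(\mathbb R^{2d})$, and there is a unique tempered GSP $U=u\otimes\overline u$ on $\mathbb R^{2d}$ with $$(U,\varphi\otimes\overline\psi)=(u,\varphi)\,\overline{(u,\psi)},\qquad \varphi,\psi\in\mathscr S(\mathbb R^d).$$ Put $U_0=U-\mathbf E U$, and let the zero mean Wigner distribution $W_0(u)$, a tempered GSP on $\mathbb R^{2d}$, be defined by $$(W_0(u),\Phi)=\big(U_0,(\mathscr F_2^{-1}\Phi)\circ\kappa^{-1}\big),\qquad \Phi\in\mathscr S(\mathbb R^{2d}),$$ where $\mathscr F_2\Phi(x,\xi)=(2\pi)^{-d/2}\int_{\mathbb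 R^d}\Phi(x,y)e^{-i\langle y,\xi\rangle}dy$ and $\kappa(x,y)=(x+\tfrac y2,\,x-\tfrac y2)$. Then $W_0(u)$ has zero mean, its covariance operator has a unique Weyl symbol $\sigma_W\in\mathscr S'(\mathbb R^{4d})$, and $$\sigma_W=(\sigma_u\otimes\sigma_u)\circ\kappa_2\circ\big(I\otimes(-\mathcal J)\big),$$ where, for $X,Y\in\mathbb R^{2d}$ and $x,\xi\in\mathbb R^d$, $\kappa_2(X,Y)=(X+\tfrac Y2,\,X-\tfrac Y2)$, $\mathcal J(x,\xi)=(\xi,-x)$ and $(I\otimes(-\mathcal J))(X,Y)=(X,-\mathcal JY)$. In coordinates $x_1,x_2,\xi_1,\xi_2\in\mathbb R^d$, $$\sigma_W(x_1,x_2,\xi_1,\xi_2)=\sigma_u\big(x_1-\tfrac12\xi_2,\;x_2+\tfrac12\xi_1\big)\,\sigma_u\big(x_1+\tfrac12\xi_2,\;x_2-\tfrac12\xi_1\big).$$ -/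

import Mathlib

open MeasureTheory ProbabilityTheory SchwartzMap
open scoped ComplexConjugate FourierTransform Real

set_option linter.unusedSectionVars false

/-! Throughout, `V` stands for `ℝᵈ`, and `Phase V` for `ℝ²ᵈ` with its Euclidean structure, so that
`Phase (Phase V)` stands for `ℝ⁴ᵈ`. -/

namespace WignerGSP

/-! ### The partial Fourier transform on Schwartz functions -/

/-- `L ↦ L ∘ q`, as a complex-linear map. -/
noncomputable def precompC {P F : Type} [NormedAddCommGroup P] [NormedSpace ℝ P]
    [NormedAddCommGroup F] [NormedSpace ℂ F] (q : P →L[ℝ] P) :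
    (P →L[ℝ] F) →L[ℂ] (P →L[ℝ] F) :=
  LinearMap.mkContinuous
    { toFun := fun L => L ∘L q
      map_add' := fun _ _ => by ext; simp
      map_smul' := fun _ _ => by ext; simp }
    ‖q‖
    (fun L => (ContinuousLinearMap.opNorm_comp_le L q).trans_eq (mul_comm _ _))

lemma precompC_apply {P F : Type} [NormedAddCommGroup P] [NormedSpace ℝ P]
    [NormedAddCommGroup F] [NormedSpace ℂ F] (q : P →L[ℝ] P) (L : P →L[ℝ] F) (w : P) :
    precompC q L w = L (q w) := rfl

/-- The phase space `V × V` with the Euclidean (`ℓ²`) norm. -/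
abbrev Phase (V : Type) : Type := WithLp 2 (V × V)

section
variable {V : Type} [NormedAddCommGroup V] [InnerProductSpace ℝ V]
  {F : Type} [NormedAddCommGroup F] [NormedSpace ℂ F]

lemma norm_pow_le (z : Phase V) (k : ℕ) : ‖z‖ ^ k ≤ 2 ^ k * (‖z.fst‖ ^ k + ‖z.snd‖ ^ k) := by
  have h1 : ‖z‖ ≤ ‖z.fst‖ + ‖z.snd‖ := by
    have h := WithLp.prod_norm_sq_eq_of_L2 z
    nlinarith [norm_nonneg z, norm_nonneg z.fst, norm_nonneg z.snd]
  have h2 : ‖z‖ ≤ 2 * max ‖z.fst‖ ‖z.snd‖ := by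
    have := le_max_left ‖z.fst‖ ‖z.snd‖
    have := le_max_right ‖z.fst‖ ‖z.snd‖
    linarith
  calc ‖z‖ ^ k ≤ (2 * max ‖z.fst‖ ‖z.snd‖) ^ k := by gcongr
    _ = 2 ^ k * (max ‖z.fst‖ ‖z.snd‖) ^ k := mul_pow _ _ _
    _ ≤ _ := by
      gcongr
      rcases max_choice ‖z.fst‖ ‖z.snd‖ with h | h <;> rw [h]
      · exact le_add_of_nonneg_right (by positivity)
      · exact le_add_of_nonneg_left (by positivity)

lemma norm_toLp_snd_le (x y : V) : ‖y‖ ≤ ‖(WithLp.toLp 2 (x, y) : Phase V)‖ :=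
  WithLp.norm_snd_le (p := 2) V (WithLp.toLp 2 (x, y) : Phase V)

lemma norm_toLp_fst_le (x y : V) : ‖x‖ ≤ ‖(WithLp.toLp 2 (x, y) : Phase V)‖ :=
  WithLp.norm_fst_le (p := 2) V (WithLp.toLp 2 (x, y) : Phase V)

/-- `y ↦ (0, y)`. -/
noncomputable def inrP : V →L[ℝ] Phase V :=
  (WithLp.prodContinuousLinearEquiv 2 ℝ V V).symm.toContinuousLinearMap ∘L
    ContinuousLinearMap.inr ℝ V V

lemma norm_inrP_le : ‖(inrP : V →L[ℝ] Phase V)‖ ≤ 1 := by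
  refine ContinuousLinearMap.opNorm_le_bound _ zero_le_one fun y => ?_
  have : inrP y = (WithLp.toLp 2 ((0 : V), y) : Phase V) := rfl
  rw [this, WithLp.norm_toLp_snd, one_mul]

lemma toLp_eq (x y : V) :
    (WithLp.toLp 2 (x, y) : Phase V) = inrP y + WithLp.toLp 2 (x, (0 : V)) := by
  have : inrP y = (WithLp.toLp 2 ((0 : V), y) : Phase V) := rfl
  rw [this, ← WithLp.toLp_add]
  simp

lemma norm_iteratedFDeriv_slice (Φ : 𝓢(Phase V, F)) (x y : V) (n : ℕ) :
    ‖iteratedFDeriv ℝ n (fun y => Φ (WithLp.toLp 2 (x, y))) y‖ ≤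
      ‖iteratedFDeriv ℝ n Φ (WithLp.toLp 2 (x, y))‖ := by
  have h1 : (fun y => Φ (WithLp.toLp 2 (x, y))) =
      (fun z => Φ (z + WithLp.toLp 2 (x, (0 : V)))) ∘ (inrP : V →L[ℝ] Phase V) := by
    ext y; simp [toLp_eq x y]
  have h2 : ContDiff ℝ n (fun z : Phase V => Φ (z + WithLp.toLp 2 (x, (0 : V)))) :=
    (Φ.smooth n).comp (by fun_prop)
  rw [h1, ContinuousLinearMap.iteratedFDeriv_comp_right _ h2 _ le_rfl]
  refine (ContinuousMultilinearMap.norm_compContinuousLinearMap_le _ _).trans ?_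
  rw [iteratedFDeriv_comp_add_right, ← toLp_eq]
  refine mul_le_of_le_one_right (norm_nonneg _) ?_
  exact Finset.prod_le_one (fun _ _ => norm_nonneg _) (fun _ _ => norm_inrP_le)

/-- The Schwartz function `y ↦ Φ (x, y)`. -/
noncomputable def slice (Φ : 𝓢(Phase V, F)) (x : V) : 𝓢(V, F) where
  toFun y := Φ (WithLp.toLp 2 (x, y))
  smooth' := by
    have h : ContDiff ℝ _ (fun y : V => Φ (inrP y + WithLp.toLp 2 (x, (0 : V)))) :=
      (Φ.smooth ⊤).comp (by fun_prop)
    simpa only [← toLp_eq] using h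
  decay' k n := by
    obtain ⟨C, hC⟩ := Φ.decay' k n
    refine ⟨C, fun y => le_trans ?_ (hC (WithLp.toLp 2 (x, y)))⟩
    gcongr
    · exact norm_toLp_snd_le x y
    · exact norm_iteratedFDeriv_slice Φ x y n

lemma seminorm_slice (Φ : 𝓢(Phase V, F)) (x : V) (j k n : ℕ) :
    ‖x‖ ^ j * SchwartzMap.seminorm ℂ k n (slice Φ x) ≤ SchwartzMap.seminorm ℂ (j + k) n Φ := by
  rw [← Real.norm_of_nonneg (show 0 ≤ ‖x‖ ^ j by positivity)]
  have h : ‖(‖x‖ ^ j : ℝ)‖ = ‖((‖x‖ ^ j : ℝ) : ℂ)‖ := by simp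
  rw [h, ← map_smul_eq_mul]
  refine SchwartzMap.seminorm_le_bound ℂ k n _ (by positivity) fun y => ?_
  have e : ⇑(((‖x‖ ^ j : ℝ) : ℂ) • slice Φ x) =
    ((‖x‖ ^ j : ℝ) : ℂ) • ⇑(slice Φ x) := rfl
  rw [e, iteratedFDeriv_const_smul_apply (((slice Φ x).smooth n).contDiffAt), norm_smul]
  refine le_trans ?_ (SchwartzMap.le_seminorm ℂ (j + k) n Φ (WithLp.toLp 2 (x, y)))
  have : ‖iteratedFDeriv ℝ n (slice Φ x) y‖ ≤ _ := norm_iteratedFDeriv_slice Φ x y n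
  have h1 := norm_toLp_snd_le x y
  have h2 := norm_toLp_fst_le x y
  rw [← h, Real.norm_of_nonneg (by positivity), pow_add]
  calc _ = (‖x‖ ^ j * ‖y‖ ^ k) *
        ‖iteratedFDeriv ℝ n (slice Φ x) y‖ := by ring
    _ ≤ _ := by gcongr

end

section
variable {V : Type} [NormedAddCommGroup V] [InnerProductSpace ℝ V] [FiniteDimensional ℝ V]
  [MeasurableSpace V] [BorelSpace V]
  {F : Type} [NormedAddCommGroup F] [NormedSpace ℂ F]

/-- `∫ e^{-i s ⟨y, ξ⟩} Φ(x, y) dy`, at `z = (x, ξ)`. -/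
noncomputable def oscInt (s : ℝ) (Φ : 𝓢(Phase V, F)) (z : Phase V) : F :=
  ∫ y : V, Complex.exp (-((s * inner ℝ y z.snd : ℝ) : ℂ) * Complex.I) •
    Φ (WithLp.toLp 2 (z.fst, y))

lemma oscInt_eq_fourier (s : ℝ) (Φ : 𝓢(Phase V, F)) (z : Phase V) :
    oscInt s Φ z = 𝓕 (slice Φ z.fst) ((s / (2 * π)) • z.snd) := by
  rw [SchwartzMap.fourier_coe, Real.fourier_eq']
  unfold oscInt
  congr 1
  ext y
  congr 2
  rw [inner_smul_right]
  have : (π : ℂ) ≠ 0 := by exact_mod_cast Real.pi_ne_zero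
  push_cast
  field_simp

lemma oscInt_bound_zero (s : ℝ) (hs : s ≠ 0) (k : ℕ) : ∃ (t : Finset (ℕ × ℕ)) (C : ℝ), 0 ≤ C ∧
    ∀ (Φ : 𝓢(Phase V, F)) (z : Phase V),
      ‖z‖ ^ k * ‖oscInt s Φ z‖ ≤ C * t.sup (schwartzSeminormFamily ℂ (Phase V) F) Φ := by
  have key (m : ℕ) : ∃ (t : Finset (ℕ × ℕ)) (C : ℝ), 0 ≤ C ∧ ∀ (f : 𝓢(V, F)) (η : V),
      ‖η‖ ^ m * ‖𝓕 f η‖ ≤ C * t.sup (schwartzSeminormFamily ℂ V F) f := by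
    obtain ⟨t, C, -, hC⟩ := Seminorm.bound_of_continuous (schwartz_withSeminorms ℂ V F)
      ((schwartzSeminormFamily ℂ V F (m, 0)).comp
        (fourierTransformCLM ℂ (V := V) (E := F)).toLinearMap)
      (((schwartz_withSeminorms ℂ V F).continuous_seminorm (m, 0)).comp
        (fourierTransformCLM ℂ (V := V) (E := F)).continuous)
    refine ⟨t, C, C.2, fun f η => ?_⟩
    refine le_trans ?_ (hC f)
    exact SchwartzMap.norm_pow_mul_le_seminorm ℂ (𝓕 f) m η
  have sup_le (t : Finset (ℕ × ℕ)) (j : ℕ) (Φ : 𝓢(Phase V, F)) (x : V) :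
      ‖x‖ ^ j * t.sup (schwartzSeminormFamily ℂ V F) (slice Φ x) ≤
      (t.image (fun p => (j + p.1, p.2))).sup (schwartzSeminormFamily ℂ (Phase V) F) Φ := by
    have e : ‖x‖ ^ j = ‖((‖x‖ ^ j : ℝ) : ℂ)‖ := by simp
    rw [e, ← map_smul_eq_mul]
    refine Seminorm.finset_sup_apply_le (apply_nonneg _ _) fun p hp => ?_
    rw [map_smul_eq_mul, ← e]
    refine (seminorm_slice Φ x j p.1 p.2).trans ?_
    exact Seminorm.le_def.mp (Finset.le_sup (f := schwartzSeminormFamily ℂ (Phase V) F)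
      (Finset.mem_image_of_mem (fun p : ℕ × ℕ => (j + p.1, p.2)) hp)) Φ
  obtain ⟨t₀, C₀, hC₀, h₀⟩ := key 0
  obtain ⟨t₁, C₁, hC₁, h₁⟩ := key k
  set c := s / (2 * π) with hc
  have hc0 : 0 < |c| ^ k := by
    have : c ≠ 0 := div_ne_zero hs (by positivity)
    positivity
  set T := (t₀.image (fun p => (k + p.1, p.2))) ∪ (t₁.image (fun p => (0 + p.1, p.2)))
  refine ⟨T, 2 ^ k * (C₀ + (|c| ^ k)⁻¹ * C₁), by positivity, fun Φ z => ?_⟩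
  have hT₀ := Seminorm.le_def.mp (Finset.sup_mono
    (f := schwartzSeminormFamily ℂ (Phase V) F) (Finset.subset_union_left :
      t₀.image (fun p => (k + p.1, p.2)) ⊆ T)) Φ
  have hT₁ := Seminorm.le_def.mp (Finset.sup_mono
    (f := schwartzSeminormFamily ℂ (Phase V) F) (Finset.subset_union_right :
      t₁.image (fun p => (0 + p.1, p.2)) ⊆ T)) Φ
  rw [oscInt_eq_fourier, ← hc]
  set S := T.sup (schwartzSeminormFamily ℂ (Phase V) F) Φ
  have b₀ : ‖z.fst‖ ^ k * ‖𝓕 (slice Φ z.fst) (c • z.snd)‖ ≤ C₀ * S := by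
    have h := h₀ (slice Φ z.fst) (c • z.snd)
    rw [pow_zero, one_mul] at h
    calc _ ≤ ‖z.fst‖ ^ k * (C₀ * _) := by gcongr
      _ = C₀ * (‖z.fst‖ ^ k * t₀.sup (schwartzSeminormFamily ℂ V F) (slice Φ z.fst)) := by ring
      _ ≤ C₀ * S := by gcongr; exact (sup_le t₀ k Φ z.fst).trans hT₀
  have b₁ : ‖z.snd‖ ^ k * ‖𝓕 (slice Φ z.fst) (c • z.snd)‖ ≤ (|c| ^ k)⁻¹ * (C₁ * S) := by
    have h := h₁ (slice Φ z.fst) (c • z.snd)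
    have h' := sup_le t₁ 0 Φ z.fst
    rw [pow_zero, one_mul] at h'
    rw [norm_smul, mul_pow, Real.norm_eq_abs] at h
    rw [le_inv_mul_iff₀ hc0, ← mul_assoc]
    exact h.trans (by gcongr; exact h'.trans hT₁)
  calc _ ≤ (2 ^ k * (‖z.fst‖ ^ k + ‖z.snd‖ ^ k)) * ‖𝓕 (slice Φ z.fst) (c • z.snd)‖ := by
        gcongr; exact norm_pow_le z k
    _ = 2 ^ k * (‖z.fst‖ ^ k * ‖𝓕 (slice Φ z.fst) (c • z.snd)‖ +
          ‖z.snd‖ ^ k * ‖𝓕 (slice Φ z.fst) (c • z.snd)‖) := by ring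
    _ ≤ 2 ^ k * (C₀ * S + (|c| ^ k)⁻¹ * (C₁ * S)) := by gcongr
    _ = _ := by ring

/-- The projection `(x, ξ) ↦ (x, 0)`. -/
noncomputable def projFst : Phase V →L[ℝ] Phase V :=
  (WithLp.prodContinuousLinearEquiv 2 ℝ V V).symm.toContinuousLinearMap ∘L
    (ContinuousLinearMap.inl ℝ V V) ∘L (WithLp.fstL 2 ℝ V V)

/-- The bilinear form `((x, y), (a, b)) ↦ ⟨y, b⟩`. -/
noncomputable def pairSnd : Phase V →L[ℝ] Phase V →L[ℝ] ℝ :=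
  (innerSL ℝ).bilinearComp (WithLp.sndL 2 ℝ V V) (WithLp.sndL 2 ℝ V V)

/-- The amplitude of the derivative of `oscInt`. -/
noncomputable def oscDeriv (s : ℝ) : 𝓢(Phase V, F) →L[ℂ] 𝓢(Phase V, Phase V →L[ℝ] F) :=
  (postcompCLM (precompC projFst)) ∘L (fderivCLM ℂ (Phase V) F) +
    (-((s : ℂ) * Complex.I)) • smulRightCLM ℂ F (pairSnd : Phase V →L[ℝ] Phase V →L[ℝ] ℝ)

lemma hasFDerivAt_integrand (s : ℝ) (Φ : 𝓢(Phase V, F)) (z : Phase V) (y : V) :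
    HasFDerivAt (fun z : Phase V => Complex.exp (-((s * inner ℝ y z.snd : ℝ) : ℂ) * Complex.I) •
        Φ (WithLp.toLp 2 (z.fst, y)))
      (Complex.exp (-((s * inner ℝ y z.snd : ℝ) : ℂ) * Complex.I) •
        oscDeriv s Φ (WithLp.toLp 2 (z.fst, y))) z := by
  have h1 : HasFDerivAt (fun z : Phase V => inner ℝ y z.snd)
      ((innerSL ℝ y) ∘L (WithLp.sndL 2 ℝ V V)) z :=
    ((innerSL ℝ y) ∘L (WithLp.sndL 2 ℝ V V)).hasFDerivAt
  have h2 := (((Complex.ofRealCLM.hasFDerivAt.comp z (h1.const_mul s)).neg).mul_const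
    Complex.I).cexp
  have e (z : Phase V) : (WithLp.toLp 2 (z.fst, y) : Phase V) = projFst z + inrP y := by
    have h1 : inrP y = (WithLp.toLp 2 ((0 : V), y) : Phase V) := rfl
    have h2 : projFst z = (WithLp.toLp 2 (z.fst, (0 : V)) : Phase V) := rfl
    rw [h1, h2, ← WithLp.toLp_add]
    simp
  have h3 : HasFDerivAt (fun z : Phase V => (WithLp.toLp 2 (z.fst, y) : Phase V)) projFst z := by
    simp only [e]
    exact (projFst.hasFDerivAt).add_const _
  have h4 := (Φ.hasFDerivAt (WithLp.toLp 2 (z.fst, y))).comp z h3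
  refine (h2.smul h4).congr_fderiv ?_
  ext w
  simp [oscDeriv, precompC_apply, pairSnd, smul_smul]
  ring_nf
  rw [mul_smul _ (_ : ℂ) (Φ _), Complex.coe_smul]

lemma integrand_bound (s : ℝ) (Φ : 𝓢(Phase V, F)) : ∃ C : ℝ, ∀ (z : Phase V) (y : V),
    ‖Complex.exp (-((s * inner ℝ y z.snd : ℝ) : ℂ) * Complex.I) •
      Φ (WithLp.toLp 2 (z.fst, y))‖ ≤
        C * (1 + ‖y‖) ^ (-((volume : Measure V).integrablePower : ℝ)) := by
  set N := (volume : Measure V).integrablePower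
  refine ⟨2 ^ N * ((Finset.Iic (N, 0)).sup fun m => SchwartzMap.seminorm ℂ m.1 m.2) Φ,
    fun z y => ?_⟩
  have h := SchwartzMap.one_add_le_sup_seminorm_apply (𝕜 := ℂ) (m := (N, 0)) (k := N) (n := 0)
    le_rfl le_rfl Φ (WithLp.toLp 2 (z.fst, y))
  rw [norm_iteratedFDeriv_zero] at h
  have e : ‖Complex.exp (-((s * inner ℝ y z.snd : ℝ) : ℂ) * Complex.I)‖ = 1 := by
    rw [← Complex.ofReal_neg, Complex.norm_exp_ofReal_mul_I]
  rw [norm_smul, e, one_mul, Real.rpow_neg (by positivity), Real.rpow_natCast,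
    ← div_eq_mul_inv, le_div_iff₀ (by positivity), mul_comm]
  refine le_trans ?_ h
  gcongr
  exact norm_toLp_snd_le _ _

lemma integrand_integrable (s : ℝ) (Φ : 𝓢(Phase V, F)) (z : Phase V) :
    Integrable (fun y : V => Complex.exp (-((s * inner ℝ y z.snd : ℝ) : ℂ) * Complex.I) •
      Φ (WithLp.toLp 2 (z.fst, y))) := by
  obtain ⟨C, hC⟩ := integrand_bound s Φ
  refine Integrable.mono'
    ((Measure.integrable_pow_neg_integrablePower (volume : Measure V)).const_mul C) ?_
    (Filter.Eventually.of_forall fun y => hC z y)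
  refine Continuous.aestronglyMeasurable ?_
  exact Continuous.smul (by fun_prop) (slice Φ z.fst).continuous

lemma hasFDerivAt_oscInt (s : ℝ) (Φ : 𝓢(Phase V, F)) (z : Phase V) :
    HasFDerivAt (oscInt s Φ) (oscInt (F := Phase V →L[ℝ] F) s (oscDeriv s Φ) z) z := by
  obtain ⟨C, hC⟩ := integrand_bound (F := Phase V →L[ℝ] F) s (oscDeriv s Φ)
  exact hasFDerivAt_integral_of_dominated_of_fderiv_le (s := Set.univ) Filter.univ_mem
    (Filter.Eventually.of_forall fun z => (integrand_integrable s Φ z).aestronglyMeasurable)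
    (integrand_integrable s Φ z)
    (integrand_integrable (F := Phase V →L[ℝ] F) s (oscDeriv s Φ) z).aestronglyMeasurable
    (Filter.Eventually.of_forall fun y z _ => hC z y)
    ((Measure.integrable_pow_neg_integrablePower (volume : Measure V)).const_mul C)
    (Filter.Eventually.of_forall fun y z _ => hasFDerivAt_integrand s Φ z y)

lemma fderiv_oscInt (s : ℝ) (Φ : 𝓢(Phase V, F)) :
    fderiv ℝ (oscInt s Φ) = oscInt (F := Phase V →L[ℝ] F) s (oscDeriv s Φ) :=
  funext fun z => (hasFDerivAt_oscInt s Φ z).fderiv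

end

section
variable {V : Type} [NormedAddCommGroup V] [InnerProductSpace ℝ V] [FiniteDimensional ℝ V]
  [MeasurableSpace V] [BorelSpace V]

lemma contDiff_oscInt_nat (s : ℝ) (n : ℕ) : ∀ (F : Type) [NormedAddCommGroup F] [NormedSpace ℂ F]
    (Φ : 𝓢(Phase V, F)), ContDiff ℝ n (oscInt s Φ) := by
  induction n with
  | zero =>
    intro F _ _ Φ
    exact contDiff_zero.2 (continuous_iff_continuousAt.2
      fun z => (hasFDerivAt_oscInt s Φ z).continuousAt)
  | succ n ih =>
    intro F _ _ Φ
    refine (contDiff_succ_iff_hasFDerivAt (n := n)).2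
      ⟨oscInt (F := Phase V →L[ℝ] F) s (oscDeriv s Φ), ih _ _, hasFDerivAt_oscInt s Φ⟩

lemma oscInt_bound (s : ℝ) (hs : s ≠ 0) (k n : ℕ) :
    ∀ (F : Type) [NormedAddCommGroup F] [NormedSpace ℂ F],
    ∃ (t : Finset (ℕ × ℕ)) (C : ℝ), 0 ≤ C ∧ ∀ (Φ : 𝓢(Phase V, F)) (z : Phase V),
      ‖z‖ ^ k * ‖iteratedFDeriv ℝ n (oscInt s Φ) z‖ ≤
        C * t.sup (schwartzSeminormFamily ℂ (Phase V) F) Φ := by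
  induction n with
  | zero =>
    intro F _ _
    simpa only [norm_iteratedFDeriv_zero] using oscInt_bound_zero (F := F) s hs k
  | succ n ih =>
    intro F _ _
    obtain ⟨t, C, hC, h⟩ := ih (Phase V →L[ℝ] F)
    obtain ⟨t', C', -, h'⟩ := Seminorm.bound_of_continuous
      (schwartz_withSeminorms ℂ (Phase V) F)
      ((t.sup (schwartzSeminormFamily ℂ (Phase V) (Phase V →L[ℝ] F))).comp
        (oscDeriv (V := V) (F := F) s).toLinearMap)
      ((Seminorm.continuous_finsetSup
        fun p _ => (schwartz_withSeminorms ℂ (Phase V) _).continuous_seminorm p).comp (oscDeriv (V := V) (F := F) s).continuous)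
    refine ⟨t', C * C', by positivity, fun Φ z => ?_⟩
    rw [← norm_iteratedFDeriv_fderiv, fderiv_oscInt, mul_assoc]
    exact (h _ z).trans (by gcongr; exact h' Φ)

/-- `Φ ↦ ((x, ξ) ↦ ∫ e^{-i s ⟨y, ξ⟩} Φ(x, y) dy)` on Schwartz functions. -/
noncomputable def partialOsc (s : ℝ) (hs : s ≠ 0) : 𝓢(Phase V, ℂ) →L[ℂ] 𝓢(Phase V, ℂ) :=
  SchwartzMap.mkCLM (oscInt s)
    (fun Φ Ψ z => by
      simp only [oscInt, _root_.add_apply, smul_add]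
      exact integral_add (integrand_integrable s Φ z) (integrand_integrable s Ψ z))
    (fun a Φ z => by
      simp only [oscInt, _root_.smul_apply, RingHom.id_apply]
      rw [← integral_smul]
      congr 1; ext y; exact smul_comm _ _ _)
    (fun Φ => contDiff_infty.2 fun n => contDiff_oscInt_nat s n ℂ Φ)
    (fun n => oscInt_bound s hs n.1 n.2 ℂ)

variable (V) in
/-- The normalizing constant `(2π)^{-d/2}`, where `d = dim V`. -/
noncomputable def normConst : ℂ :=
  (((2 * π) ^ (-(Module.finrank ℝ V : ℝ) / 2) : ℝ) : ℂ)

/-- The partial Fourier transform `𝓕₂` in the second variable. -/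
noncomputable def fourier₂ : 𝓢(Phase V, ℂ) →L[ℂ] 𝓢(Phase V, ℂ) :=
  normConst V • partialOsc 1 one_ne_zero

/-- The inverse partial Fourier transform `𝓕₂⁻¹` in the second variable. -/
noncomputable def fourierInv₂ : 𝓢(Phase V, ℂ) →L[ℂ] 𝓢(Phase V, ℂ) :=
  normConst V • partialOsc (-1) (neg_ne_zero.2 one_ne_zero)

theorem fourier₂_apply (Φ : 𝓢(Phase V, ℂ)) (x ξ : V) :
    fourier₂ Φ (WithLp.toLp 2 (x, ξ)) = normConst V *
      ∫ y : V, Complex.exp (-(inner ℝ y ξ : ℝ) * Complex.I) * Φ (WithLp.toLp 2 (x, y)) := by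
  change normConst V • oscInt 1 Φ (WithLp.toLp 2 (x, ξ)) = _
  simp [oscInt]

theorem fourierInv₂_apply (Φ : 𝓢(Phase V, ℂ)) (x y : V) :
    fourierInv₂ Φ (WithLp.toLp 2 (x, y)) = normConst V *
      ∫ ξ : V, Complex.exp ((inner ℝ ξ y : ℝ) * Complex.I) * Φ (WithLp.toLp 2 (x, ξ)) := by
  change normConst V • oscInt (-1) Φ (WithLp.toLp 2 (x, y)) = _
  simp [oscInt]

end

/-! ### Operations on Schwartz functions and tempered distributions -/

section
variable {V : Type} [NormedAddCommGroup V] [InnerProductSpace ℝ V]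

/-- Complex conjugation of Schwartz functions. -/
noncomputable def conjS : 𝓢(V, ℂ) →L⋆[ℂ] 𝓢(V, ℂ) :=
  SchwartzMap.mkCLM (fun f x => conj (f x))
    (fun f g x => by simp)
    (fun a f x => by simp)
    (fun f => Complex.conjCLE.contDiff.comp (f.smooth ⊤))
    (fun n => ⟨{n}, 1, zero_le_one, fun f x => by
      have h : ‖iteratedFDeriv ℝ n.2 (fun x => conj (f x)) x‖ = ‖iteratedFDeriv ℝ n.2 f x‖ :=
        Complex.conjLIE.norm_iteratedFDeriv_comp_left f x n.2
      rw [h, one_mul, Finset.sup_singleton]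
      exact SchwartzMap.le_seminorm ℂ n.1 n.2 f x⟩)

@[simp] theorem conjS_apply (f : 𝓢(V, ℂ)) (x : V) : conjS f x = conj (f x) := rfl

lemma norm_fstL_le : ‖WithLp.fstL 2 ℝ V V‖ ≤ 1 :=
  ContinuousLinearMap.opNorm_le_bound _ zero_le_one fun z => by
    rw [one_mul]; exact WithLp.norm_fst_le V z

lemma norm_sndL_le : ‖WithLp.sndL 2 ℝ V V‖ ≤ 1 :=
  ContinuousLinearMap.opNorm_le_bound _ zero_le_one fun z => by
    rw [one_mul]; exact WithLp.norm_snd_le V z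

lemma norm_iteratedFDeriv_comp_le (f : 𝓢(V, ℂ)) (L : Phase V →L[ℝ] V) (hL : ‖L‖ ≤ 1) (z : Phase V)
    (n : ℕ) : ‖iteratedFDeriv ℝ n (f ∘ L) z‖ ≤ ‖iteratedFDeriv ℝ n f (L z)‖ := by
  rw [ContinuousLinearMap.iteratedFDeriv_comp_right L (f.smooth n) z le_rfl]
  refine (ContinuousMultilinearMap.norm_compContinuousLinearMap_le _ _).trans ?_
  refine mul_le_of_le_one_right (norm_nonneg _) ?_
  exact Finset.prod_le_one (fun _ _ => norm_nonneg _) (fun _ _ => hL)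

lemma tensor_decay (f g : 𝓢(V, ℂ)) (k n : ℕ) : ∃ C : ℝ, ∀ z : Phase V,
    ‖z‖ ^ k * ‖iteratedFDeriv ℝ n (fun z : Phase V => f z.fst * g z.snd) z‖ ≤ C := by
  set p := SchwartzMap.seminorm ℂ (E := V) (F := ℂ)
  refine ⟨∑ i ∈ Finset.range (n + 1), (n.choose i : ℝ) *
    (2 ^ k * (p k i f * p 0 (n - i) g + p 0 i f * p k (n - i) g)), fun z => ?_⟩
  have h := norm_iteratedFDeriv_mul_le (N := n)
    ((f.smooth n).comp (WithLp.fstL 2 ℝ V V).contDiff)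
    ((g.smooth n).comp (WithLp.sndL 2 ℝ V V).contDiff) z le_rfl
  refine (mul_le_mul_of_nonneg_left h (by positivity)).trans ?_
  rw [Finset.mul_sum]
  refine Finset.sum_le_sum fun i _ => ?_
  have ha := norm_iteratedFDeriv_comp_le f _ norm_fstL_le z i
  have hb := norm_iteratedFDeriv_comp_le g _ norm_sndL_le z (n - i)
  have a1 := SchwartzMap.le_seminorm ℂ k i f z.fst
  have a0 := SchwartzMap.le_seminorm ℂ 0 i f z.fst
  have b1 := SchwartzMap.le_seminorm ℂ k (n - i) g z.snd
  have b0 := SchwartzMap.le_seminorm ℂ 0 (n - i) g z.snd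
  rw [pow_zero, one_mul] at a0 b0
  change _ ≤ ‖iteratedFDeriv ℝ i f z.fst‖ at ha
  change _ ≤ ‖iteratedFDeriv ℝ (n - i) g z.snd‖ at hb
  set A := ‖iteratedFDeriv ℝ i f z.fst‖
  set B := ‖iteratedFDeriv ℝ (n - i) g z.snd‖
  calc _ ≤ (2 ^ k * (‖z.fst‖ ^ k + ‖z.snd‖ ^ k)) * ((n.choose i : ℝ) * A * B) := by
        gcongr
        exact norm_pow_le z k
    _ = (n.choose i : ℝ) * (2 ^ k * ((‖z.fst‖ ^ k * A) * B + A * (‖z.snd‖ ^ k * B))) := by ring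
    _ ≤ _ := by gcongr

/-- The tensor product `(f ⊗ g)(x, y) = f(x) g(y)` of two Schwartz functions. -/
noncomputable def tensorS (f g : 𝓢(V, ℂ)) : 𝓢(Phase V, ℂ) where
  toFun z := f z.fst * g z.snd
  smooth' := ((f.smooth ⊤).comp (WithLp.fstL 2 ℝ V V).contDiff).mul
    ((g.smooth ⊤).comp (WithLp.sndL 2 ℝ V V).contDiff)
  decay' k n := tensor_decay f g k n

@[simp] theorem tensorS_apply (f g : 𝓢(V, ℂ)) (z : Phase V) :
    tensorS f g z = f z.fst * g z.snd := rfl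

/-- The antilinear action `(T, φ)` of a tempered distribution on a test function. It is normalized
so that `(T, φ) = ∫ T φ̄` when `T` is a function. -/
noncomputable def pair (T : 𝓢'(V, ℂ)) (φ : 𝓢(V, ℂ)) : ℂ := T (conjS φ)

/-- The composition `T ∘ A` of a tempered distribution with a linear bijection. -/
noncomputable def compLinear (T : 𝓢'(V, ℂ)) (A : V ≃L[ℝ] V) : 𝓢'(V, ℂ) :=
  ((|LinearMap.det (A : V →ₗ[ℝ] V)|⁻¹ : ℝ) : ℂ) •
    PointwiseConvergenceCLM.precomp ℂ (compCLMOfContinuousLinearEquiv ℂ A.symm) T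

/-- `τ` is the tensor product `S ⊗ T` of the tempered distributions `S` and `T`. -/
def IsTensorDistribution (S T : 𝓢'(V, ℂ)) (τ : 𝓢'(Phase V, ℂ)) : Prop :=
  ∀ φ ψ : 𝓢(V, ℂ), τ (tensorS φ ψ) = S φ * T ψ

lemma ext_phase {z w : Phase V} (h₁ : z.fst = w.fst) (h₂ : z.snd = w.snd) : z = w :=
  (WithLp.ofLp_injective 2) (Prod.ext h₁ h₂)

lemma continuous_toPhase {f g : Phase V → V} (hf : Continuous f) (hg : Continuous g) :
    Continuous fun z => (WithLp.toLp 2 (f z, g z) : Phase V) :=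
  (WithLp.prodContinuousLinearEquiv 2 ℝ V V).symm.continuous.comp (hf.prodMk hg)

/-- The linear map `κ (x, y) = (x + y/2, x - y/2)`, with inverse `(x, y) ↦ ((x + y)/2, x - y)`. -/
noncomputable def kappa : Phase V ≃L[ℝ] Phase V where
  toFun z := WithLp.toLp 2 (z.fst + (1 / 2 : ℝ) • z.snd, z.fst - (1 / 2 : ℝ) • z.snd)
  invFun z := WithLp.toLp 2 ((1 / 2 : ℝ) • z.fst + (1 / 2 : ℝ) • z.snd, z.fst - z.snd)
  map_add' z w := by refine ext_phase ?_ ?_ <;> simp <;> module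
  map_smul' c z := by refine ext_phase ?_ ?_ <;> simp <;> module
  left_inv z := by refine ext_phase ?_ ?_ <;> simp <;> module
  right_inv z := by refine ext_phase ?_ ?_ <;> simp <;> module
  continuous_toFun := continuous_toPhase (by fun_prop) (by fun_prop)
  continuous_invFun := continuous_toPhase (by fun_prop) (by fun_prop)

/-- The symplectic map `J (x, ξ) = (ξ, -x)`. -/
noncomputable def symplJ : Phase V ≃L[ℝ] Phase V where
  toFun z := WithLp.toLp 2 (z.snd, -z.fst)
  invFun z := WithLp.toLp 2 (-z.snd, z.fst)
  map_add' z w := by refine ext_phase (by simp) ?_; simp; abel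
  map_smul' c z := by refine ext_phase ?_ ?_ <;> simp
  left_inv z := by refine ext_phase ?_ ?_ <;> simp
  right_inv z := by refine ext_phase ?_ ?_ <;> simp
  continuous_toFun := continuous_toPhase (by fun_prop) (by fun_prop)
  continuous_invFun := continuous_toPhase (by fun_prop) (by fun_prop)

/-- The block diagonal map `I ⊗ B : (X, Ξ) ↦ (X, B Ξ)`. -/
noncomputable def idBlock (B : V ≃L[ℝ] V) : Phase V ≃L[ℝ] Phase V where
  toFun z := WithLp.toLp 2 (z.fst, B z.snd)
  invFun z := WithLp.toLp 2 (z.fst, B.symm z.snd)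
  map_add' z w := by refine ext_phase ?_ ?_ <;> simp
  map_smul' c z := by refine ext_phase ?_ ?_ <;> simp
  left_inv z := by refine ext_phase ?_ ?_ <;> simp
  right_inv z := by refine ext_phase ?_ ?_ <;> simp
  continuous_toFun := continuous_toPhase (by fun_prop) (by fun_prop)
  continuous_invFun := continuous_toPhase (by fun_prop) (by fun_prop)

/-- The map `-B`. -/
noncomputable def negEquiv (B : V ≃L[ℝ] V) : V ≃L[ℝ] V :=
  B.trans (ContinuousLinearEquiv.neg ℝ)

end

/-! ### The Wigner distribution and the Weyl symbol -/

section
variable {V : Type} [NormedAddCommGroup V] [InnerProductSpace ℝ V] [FiniteDimensional ℝ V]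
  [MeasurableSpace V] [BorelSpace V]

/-- The cross-Wigner distribution `W(g, f) = 𝓕₂ ((g ⊗ f̄) ∘ κ)` of Schwartz functions. -/
noncomputable def crossWigner (g f : 𝓢(V, ℂ)) : 𝓢(Phase V, ℂ) :=
  fourier₂ (compCLMOfContinuousLinearEquiv ℂ kappa (tensorS g (conjS f)))

/-- `W(g, f)(x, ξ) = (2π)^{-d/2} ∫ g(x + y/2) conj(f(x - y/2)) e^{-i⟨y, ξ⟩} dy`. -/
theorem crossWigner_apply (g f : 𝓢(V, ℂ)) (x ξ : V) :
    crossWigner g f (WithLp.toLp 2 (x, ξ)) = normConst V *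
      ∫ y : V, Complex.exp (-(inner ℝ y ξ : ℝ) * Complex.I) *
        (g (x + (1 / 2 : ℝ) • y) * conj (f (x - (1 / 2 : ℝ) • y))) :=
  fourier₂_apply _ x ξ

/-- `σ` is the Weyl symbol of the operator `K`, that is, `K = σʷ(x, D)`, where the Weyl
quantization is given by `(σʷ(x, D) f, g) = (2π)^{-d/2} (σ, W(g, f))`. -/
def IsWeylSymbol (K : 𝓢(V, ℂ) → 𝓢'(V, ℂ)) (σ : 𝓢'(Phase V, ℂ)) : Prop :=
  ∀ f g : 𝓢(V, ℂ), pair (K f) g = normConst V * pair σ (crossWigner g f)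

end

/-! ### Tempered generalized stochastic processes -/

section
variable {V : Type} [NormedAddCommGroup V] [InnerProductSpace ℝ V]
  {Ω : Type*} [MeasurableSpace Ω]

variable (V) in
/-- Tempered generalized stochastic processes: continuous antilinear maps `𝓢(V) → L²(Ω)`. -/
abbrev TemperedGSP (P : Measure Ω) : Type _ := 𝓢(V, ℂ) →L⋆[ℂ] Lp ℂ 2 P

variable {P : Measure Ω}

/-- `u` is Gaussian: for all `φ₁, …, φₙ` the random vector `((u, φ₁), …, (u, φₙ))`, regarded as a
real random vector, is Gaussian (possibly degenerate). -/
def IsGaussianGSP (u : TemperedGSP V P) : Prop :=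
  IsGaussianProcess (fun (φ : 𝓢(V, ℂ)) (ω : Ω) => u φ ω) P

/-- `u` is symmetric: `c u` and `u` have the same law (the same finite dimensional distributions)
for every complex number `c` of modulus one. -/
def IsSymmetricGSP (u : TemperedGSP V P) : Prop :=
  ∀ c : ℂ, ‖c‖ = 1 → ∀ I : Finset 𝓢(V, ℂ),
    IdentDistrib (fun ω (φ : I) => c * u φ ω) (fun ω (φ : I) => u φ ω) P P

/-- `u` takes values in the zero mean random variables. -/
def IsZeroMean (u : TemperedGSP V P) : Prop :=
  ∀ φ : 𝓢(V, ℂ), ∫ ω, u φ ω ∂P = 0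

/-- The covariance operator, `(𝒦ᵤ ψ, φ) = E((u, φ) conj (u, ψ))`. -/
noncomputable def covOp (u : TemperedGSP V P) (ψ : 𝓢(V, ℂ)) : 𝓢'(V, ℂ) :=
  ContinuousLinearMap.toPointwiseConvergenceCLM _ _ _ _
    ((innerSL ℂ (u ψ)) ∘SL (u ∘SL (conjS : 𝓢(V, ℂ) →L⋆[ℂ] 𝓢(V, ℂ))))

theorem pair_covOp (u : TemperedGSP V P) (ψ φ : 𝓢(V, ℂ)) :
    pair (covOp u ψ) φ = ∫ ω, u φ ω * conj (u ψ ω) ∂P := by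
  have h : conjS (conjS φ) = φ := by ext x; simp
  change inner ℂ (u ψ) (u (conjS (conjS φ))) = _
  rw [h, L2.inner_def]
  rfl

/-- `U` is the form `u ⊗ ū`, `(U, φ ⊗ ψ̄) = (u, φ) conj (u, ψ)`, extended to a tempered
generalized stochastic process on `V × V`. -/
def IsTensorSquare (u : TemperedGSP V P) (U : TemperedGSP (Phase V) P) : Prop :=
  ∀ φ ψ : 𝓢(V, ℂ), U (tensorS φ (conjS ψ)) =ᵐ[P] fun ω => u φ ω * conj (u ψ ω)

variable [IsProbabilityMeasure P]

lemma integral_eq_inner_const (X : Lp ℂ 2 P) :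
    ∫ ω, X ω ∂P = inner ℂ (Lp.const 2 P (1 : ℂ)) X := by
  rw [L2.inner_def]
  refine integral_congr_ae ?_
  filter_upwards [Lp.coeFn_const (p := 2) (μ := P) (c := (1 : ℂ))] with ω hω
  rw [hω]
  simp

variable (P) in
/-- The expectation on `L²(Ω)`. -/
noncomputable def expectation : Lp ℂ 2 P →L[ℂ] ℂ :=
  LinearMap.mkContinuous
    { toFun := fun X => ∫ ω, X ω ∂P
      map_add' := fun X Y => by simp only [integral_eq_inner_const, inner_add_right]
      map_smul' := fun c X => by
        simp only [integral_eq_inner_const, inner_smul_right, RingHom.id_apply, smul_eq_mul] }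
    ‖Lp.const 2 P (1 : ℂ)‖ fun X => by
      simpa only [LinearMap.coe_mk, AddHom.coe_mk, integral_eq_inner_const] using
        norm_inner_le_norm (Lp.const 2 P (1 : ℂ)) X

@[simp] theorem expectation_apply (X : Lp ℂ 2 P) : expectation P X = ∫ ω, X ω ∂P := rfl

/-- The centered process `U - E U`. -/
noncomputable def center (U : TemperedGSP V P) : TemperedGSP V P :=
  U - (Lp.constL 2 P ℂ ∘SL expectation P) ∘SL U

theorem center_apply (U : TemperedGSP V P) (φ : 𝓢(V, ℂ)) :
    center U φ =ᵐ[P] fun ω => U φ ω - ∫ ω', U φ ω' ∂P := by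
  have h : center U φ = U φ - Lp.const 2 P (∫ ω, U φ ω ∂P) := rfl
  rw [h]
  filter_upwards [Lp.coeFn_sub (U φ) (Lp.const 2 P (∫ ω, U φ ω ∂P)),
    Lp.coeFn_const (p := 2) (μ := P) (c := ∫ ω, U φ ω ∂P)] with ω h₁ h₂
  rw [h₁, Pi.sub_apply, h₂]
  rfl

end

section
variable {V : Type} [NormedAddCommGroup V] [InnerProductSpace ℝ V] [FiniteDimensional ℝ V]
  [MeasurableSpace V] [BorelSpace V]
  {Ω : Type*} [MeasurableSpace Ω] {P : Measure Ω} [IsProbabilityMeasure P]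

/-- The zero mean Wigner distribution `W₀(u)` in terms of `U = u ⊗ ū`: with `U₀ = U - E U`,
`(W₀(u), Φ) = (U₀, (𝓕₂⁻¹ Φ) ∘ κ⁻¹)`. -/
noncomputable def zeroMeanWigner (U : TemperedGSP (Phase V) P) : TemperedGSP (Phase V) P :=
  center U ∘SL
    ((compCLMOfContinuousLinearEquiv ℂ kappa.symm : 𝓢(Phase V, ℂ) →L[ℂ] 𝓢(Phase V, ℂ)) ∘SL
      fourierInv₂)

end
end WignerGSP

open WignerGSP

/-! The symbol formula combines a probabilistic identity with a purely analytic one. Write K(a, b) =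
E (u, a) conj (u, b).

Probability: for a symmetric Gaussian process Wick's formula (`quarticForm_eq`) has only two terms,
since the pairings E (u, a)(u, c) vanish by rotation invariance. The map defining W₀(u) inverts Φ ↦
𝓕₂(Φ ∘ κ), so W₀(u) tested on W(φ, ψ) is the centred product (u, φ) conj (u, ψ). Centring removes
one Wick term, and the covariance of W₀(u) between W(φ₁, ψ₁) and W(φ₂, ψ₂) is K(φ₁, φ₂) K(ψ₂, ψ₁)
(`pair_covOp_zeroMeanWigner`). By the definition of σ_u this equals, up to normalization, σ_u on
W(φ₁, φ₂) times σ_u on W(ψ₂, ψ₁), that is, σ_u ⊗ σ_u on the tensor product of the two.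

Analysis: the Wigner distribution of two Wigner distributions is again a tensor product of Wigner
distributions, after a linear change of variables (`crossWigner_crossWigner`): W(W(φ₁, ψ₁), W(φ₂,
ψ₂))((X + Y)/2, J(X - Y)) = W(φ₁, φ₂)(X) W(ψ₂, ψ₁)(Y). The change of variables is the inverse of κ₂
∘ (I ⊗ (-J)) and has determinant of modulus one. Hence both sides of the formula for σ_W agree on
all W(W(φ₁, ψ₁), W(φ₂, ψ₂)), and these test functions determine a tempered distribution
(`ext_crossWigner_crossWigner`).

All existence and uniqueness claims rest on the kernel theorem for bilinear maps from Schwartz space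
to a Banach space (`exists_kernel`, `ext_tensor`). It is obtained from the short time Fourier
transform: with a window g such that ∫ g² = 1, each Schwartz function f is a superposition of
time-frequency shifts of g, weighted by a Schwartz function on phase space. Continuous linear maps
pass through this superposition, so the extension of a bilinear B can be defined by integrating its
values on pairs of shifts of g, which grow only polynomially. -/

namespace WignerGSP

/-! ### Weak integrals of Schwartz function valued maps -/

section WeakIntegral

open LineDeriv

/-- A closed subspace is itself complete, so the integral can be formed inside it. Continuity on a
second countable space supplies strong measurability of the corestricted map. -/
lemma integral_mem_of_continuous {Z Y : Type*} [TopologicalSpace Z] [SecondCountableTopology Z]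
    [MeasurableSpace Z] [OpensMeasurableSpace Z] {μ : Measure Z}
    [NormedAddCommGroup Y] [NormedSpace ℝ Y] [CompleteSpace Y]
    (S : Submodule ℝ Y) (hS : IsClosed (S : Set Y)) {f : Z → Y} (hf : Continuous f)
    (hi : Integrable f μ) (hmem : ∀ z, f z ∈ S) : ∫ z, f z ∂μ ∈ S := by
  have : CompleteSpace S := hS.completeSpace_coe
  have hc : Continuous fun z => (⟨f z, hmem z⟩ : S) := hf.subtype_mk _
  have hi' : Integrable (fun z => (⟨f z, hmem z⟩ : S)) μ :=
    hi.norm.mono' hc.aestronglyMeasurable (Filter.Eventually.of_forall fun z => le_rfl)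
  have h := S.subtypeL.integral_comp_comm hi'
  change ∫ z, f z ∂μ = _ at h
  rw [h]
  exact Subtype.property _

variable {V : Type*} [NormedAddCommGroup V] [NormedSpace ℝ V]
  {F : Type*} [NormedAddCommGroup F] [NormedSpace ℂ F]

/-- Bounded continuous functions with values in a normed space. -/
abbrev BddCont (X E : Type*) [TopologicalSpace X] [NormedAddCommGroup E] : Type _ :=
  BoundedContinuousFunction X E

/-- The bounded continuous function `x ↦ ‖x‖ ^ k • Dⁿ f (x)`. -/
noncomputable def weightedDeriv (k n : ℕ) (f : 𝓢(V, F)) :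
    BddCont V (V [×n]→L[ℝ] F) :=
  BoundedContinuousFunction.ofNormedAddCommGroup (fun x => ‖x‖ ^ k • iteratedFDeriv ℝ n f x)
    ((continuous_norm.pow k).smul ((f.smooth n).continuous_iteratedFDeriv le_rfl))
    (SchwartzMap.seminorm ℂ k n f) fun x => by
      rw [norm_smul, norm_pow, norm_norm]
      exact SchwartzMap.le_seminorm ℂ k n f x

lemma weightedDeriv_apply (k n : ℕ) (f : 𝓢(V, F)) (x : V) :
    weightedDeriv k n f x = ‖x‖ ^ k • iteratedFDeriv ℝ n f x := rfl

lemma norm_weightedDeriv (k n : ℕ) (f : 𝓢(V, F)) :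
    ‖weightedDeriv k n f‖ = SchwartzMap.seminorm ℂ k n f := by
  refine le_antisymm (BoundedContinuousFunction.norm_ofNormedAddCommGroup_le _
    (apply_nonneg _ _) _) ?_
  refine SchwartzMap.seminorm_le_bound ℂ k n f (norm_nonneg _) fun x => ?_
  have h := (weightedDeriv k n f).norm_coe_le_norm x
  rwa [weightedDeriv_apply, norm_smul, norm_pow, norm_norm] at h

/-- `weightedDeriv` as a linear map. -/
noncomputable def weightedDerivₗ (k n : ℕ) :
    𝓢(V, F) →ₗ[ℝ] BddCont V (V [×n]→L[ℝ] F) where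
  toFun := weightedDeriv k n
  map_add' f g := by
    ext1 x
    have e : ⇑(f + g) = ⇑f + ⇑g := rfl
    rw [BoundedContinuousFunction.add_apply, weightedDeriv_apply, weightedDeriv_apply,
      weightedDeriv_apply, e, iteratedFDeriv_add_apply (f.smooth n).contDiffAt
        (g.smooth n).contDiffAt, smul_add]
  map_smul' c f := by
    ext1 x
    have e : ⇑(c • f) = c • ⇑f := rfl
    rw [BoundedContinuousFunction.smul_apply, weightedDeriv_apply, weightedDeriv_apply, e,
      iteratedFDeriv_const_smul_apply (f.smooth n).contDiffAt, smul_comm, RingHom.id_apply]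

variable [CompleteSpace F] {Z : Type*} [TopologicalSpace Z] [SecondCountableTopology Z]
    [MeasurableSpace Z] [OpensMeasurableSpace Z] {μ : Measure Z}

/-- A continuous map into Schwartz space all of whose continuous seminorms are integrable. -/
structure SchwartzIntegrable (μ : Measure Z) (G : Z → 𝓢(V, F)) : Prop where
  continuous : Continuous G
  integrable_seminorm : ∀ q : Seminorm ℂ 𝓢(V, F), Continuous q → Integrable (fun z => q (G z)) μ

lemma continuous_seminorm_schwartz (k n : ℕ) :
    Continuous (SchwartzMap.seminorm ℂ k n : Seminorm ℂ 𝓢(V, F)) :=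
  (schwartz_withSeminorms ℂ V F).continuous_seminorm (k, n)

lemma SchwartzIntegrable.comp {G : Z → 𝓢(V, F)} (hG : SchwartzIntegrable μ G)
    (A : 𝓢(V, F) →L[ℂ] 𝓢(V, F)) : SchwartzIntegrable μ (fun z => A (G z)) where
  continuous := A.continuous.comp hG.continuous
  integrable_seminorm q hq := hG.integrable_seminorm (q.comp A.toLinearMap) (hq.comp A.continuous)

lemma SchwartzIntegrable.integrable_map {H : Type*} [NormedAddCommGroup H] [NormedSpace ℂ H]
    {G : Z → 𝓢(V, F)} (hG : SchwartzIntegrable μ G) (L : 𝓢(V, F) →L[ℂ] H) :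
    Integrable (fun z => L (G z)) μ :=
  (hG.integrable_seminorm ((normSeminorm ℂ H).comp L.toLinearMap)
    (continuous_norm.comp L.continuous)).mono'
    (L.continuous.comp hG.continuous).aestronglyMeasurable
    (Filter.Eventually.of_forall fun _ => le_rfl)

/-- Differentiation under the integral sign: the seminorm of order (0, 1) of `G z` dominates the
derivative uniformly in `y`, and it is integrable in `z` by assumption. -/
lemma lineDeriv_eq_integral {G : Z → 𝓢(V, F)} (hG : SchwartzIntegrable μ G) {f : 𝓢(V, F)}
    (hf : ∀ y, f y = ∫ z, G z y ∂μ) (v y : V) : ∂_{v} f y = ∫ z, ∂_{v} (G z) y ∂μ := by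
  have hev (y : V) : Continuous fun z => G z y := by
    have h : Continuous fun g : 𝓢(V, F) => g y :=
      (BoundedContinuousFunction.evalCLM ℝ y).continuous.comp
        (toBoundedContinuousFunctionCLM ℝ V F).continuous
    exact h.comp hG.continuous
  have hfd (y : V) : Continuous fun z => fderiv ℝ (G z) y := by
    have h1 : Continuous fun g : 𝓢(V, V →L[ℝ] F) => g y :=
      (BoundedContinuousFunction.evalCLM ℝ y).continuous.comp
        (toBoundedContinuousFunctionCLM ℝ V (V →L[ℝ] F)).continuous
    exact h1.comp ((fderivCLM ℝ V F).continuous.comp hG.continuous)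
  have hb (z : Z) (y : V) : ‖fderiv ℝ (G z) y‖ ≤ SchwartzMap.seminorm ℂ 0 1 (G z) := by
    rw [← norm_iteratedFDeriv_one]
    exact norm_iteratedFDeriv_le_seminorm ℂ (G z) 1 y
  have hi1 := hG.integrable_seminorm _ (continuous_seminorm_schwartz 0 1)
  have key := hasFDerivAt_integral_of_dominated_of_fderiv_le (𝕜 := ℝ) (s := Set.univ)
    (μ := μ) (F := fun y z => G z y) (F' := fun y z => fderiv ℝ (G z) y) (x₀ := y)
    (bound := fun z => SchwartzMap.seminorm ℂ 0 1 (G z))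
    Filter.univ_mem (Filter.Eventually.of_forall fun y => (hev y).aestronglyMeasurable)
    ((hG.integrable_seminorm _ (continuous_seminorm_schwartz 0 0)).mono'
      (hev y).aestronglyMeasurable
      (Filter.Eventually.of_forall fun z => norm_le_seminorm ℂ (G z) y))
    (hfd y).aestronglyMeasurable
    (Filter.Eventually.of_forall fun z y _ => hb z y) hi1
    (Filter.Eventually.of_forall fun z y _ => (G z).hasFDerivAt y)
  have e : (f : V → F) = fun y => ∫ z, G z y ∂μ := funext hf
  rw [lineDerivOp_apply_eq_fderiv, e, key.fderiv, ContinuousLinearMap.integral_apply]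
  · rfl
  · exact hi1.mono' (hfd y).aestronglyMeasurable (Filter.Eventually.of_forall fun z => hb z y)

lemma iteratedLineDeriv_eq_integral {n : ℕ} (m : Fin n → V) :
    ∀ {G : Z → 𝓢(V, F)} (_ : SchwartzIntegrable μ G) {f : 𝓢(V, F)}
    (_ : ∀ y, f y = ∫ z, G z y ∂μ) (y : V), ∂^{m} f y = ∫ z, ∂^{m} (G z) y ∂μ := by
  induction n with
  | zero => intro G _ f hf y; simpa using hf y
  | succ n ih =>
    intro G hG f hf y
    simp only [iteratedLineDerivOp_succ_right]
    exact ih (Fin.init m) (hG.comp (lineDerivOpCLM ℂ 𝓢(V, F) (m (Fin.last n))))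
      (fun y => lineDeriv_eq_integral hG hf (m (Fin.last n)) y) y

/-- Continuous linear maps on Schwartz space commute with pointwise integrals. -/
theorem map_eq_integral_of_forall_eq_integral {H : Type*} [NormedAddCommGroup H] [NormedSpace ℂ H]
    [CompleteSpace H] {G : Z → 𝓢(V, F)} (hG : SchwartzIntegrable μ G) {f : 𝓢(V, F)}
    (hf : ∀ y, f y = ∫ z, G z y ∂μ) (L : 𝓢(V, F) →L[ℂ] H) :
    L f = ∫ z, L (G z) ∂μ := by
  let _ : NormedSpace ℝ H := NormedSpace.restrictScalars ℝ ℂ H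
  have hLi : Integrable (fun z => L (G z)) μ := hG.integrable_map L
  -- Schwartz space is not normed, so no Bochner integral of `G` is formed there. Only finitely many
  -- seminorms control `L`, and these are norms of weighted derivatives in a finite product of
  -- Banach spaces, where integration is possible.
  obtain ⟨s, C, -, hC⟩ := Seminorm.bound_of_continuous (schwartz_withSeminorms ℂ V F)
    ((normSeminorm ℂ H).comp L.toLinearMap) (continuous_norm.comp L.continuous)
  let ι : 𝓢(V, F) →ₗ[ℝ] ((p : s) → BddCont V (V [×p.1.2]→L[ℝ] F)) :=
    LinearMap.pi fun p => weightedDerivₗ p.1.1 p.1.2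
  have hι (g : 𝓢(V, F)) (p : s) : ι g p = weightedDeriv p.1.1 p.1.2 g := rfl
  have hbound (g : 𝓢(V, F)) : ‖L g‖ ≤ C * ‖ι g‖ := by
    refine (hC g).trans ?_
    rw [_root_.smul_apply, NNReal.smul_def, smul_eq_mul]
    gcongr
    refine Seminorm.finset_sup_apply_le (norm_nonneg _) fun p hp => ?_
    have := norm_le_pi_norm (ι g) ⟨p, hp⟩
    rwa [hι, norm_weightedDeriv] at this
  have hιc : Continuous ι := by
    refine continuous_pi fun p => ?_
    refine continuous_of_continuousAt_zero (weightedDerivₗ p.1.1 p.1.2) ?_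
    rw [ContinuousAt, map_zero, tendsto_zero_iff_norm_tendsto_zero]
    have h := (continuous_seminorm_schwartz (V := V) (F := F) p.1.1 p.1.2).tendsto 0
    rw [map_zero] at h
    exact h.congr fun g => (norm_weightedDeriv _ _ g).symm
  -- The integral of `Λ (G z)` lies in the closure of the range of `Λ`. Its components turn out to
  -- be `ι f` and the integral of `L (G z)`, and since `ι` controls `L` the second must be `L f`.
  let Λ : 𝓢(V, F) →ₗ[ℝ] ((p : s) → BddCont V (V [×p.1.2]→L[ℝ] F)) × H :=
    ι.prod (L.toLinearMap.restrictScalars ℝ)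
  have hΛc : Continuous Λ := hιc.prodMk L.continuous
  have hιi : Integrable (fun z => ι (G z)) μ := by
    refine Integrable.of_eval fun p => ?_
    refine Integrable.mono' (hG.integrable_seminorm _ (continuous_seminorm_schwartz p.1.1 p.1.2))
      ((continuous_apply p).comp (hιc.comp hG.continuous)).aestronglyMeasurable
      (Filter.Eventually.of_forall fun z => ?_)
    rw [hι, norm_weightedDeriv]
  have hΛi : Integrable (fun z => Λ (G z)) μ := hιi.prodMk hLi
  have hmem := integral_mem_of_continuous (LinearMap.range Λ).topologicalClosure
    (Submodule.isClosed_topologicalClosure _) (hΛc.comp hG.continuous) hΛi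
    (fun z => Submodule.le_topologicalClosure _ ⟨G z, rfl⟩)
  have hfst : (∫ z, Λ (G z) ∂μ).1 = ι f := by
    have h1 := (ContinuousLinearMap.fst ℝ ((p : s) → BddCont V (V [×p.1.2]→L[ℝ] F)) H).integral_comp_comm hΛi
    refine h1.symm.trans ?_
    change ∫ z, ι (G z) ∂μ = ι f
    funext p
    have h2 := (ContinuousLinearMap.proj (R := ℝ) (φ := fun p : s =>
      BddCont V (V [×p.1.2]→L[ℝ] F)) p).integral_comp_comm hιi
    refine h2.symm.trans ?_
    change ∫ z, weightedDeriv p.1.1 p.1.2 (G z) ∂μ = weightedDeriv p.1.1 p.1.2 f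
    have hi3 : Integrable (fun z => weightedDeriv p.1.1 p.1.2 (G z)) μ := Integrable.eval hιi p
    ext x m
    -- Evaluation at a point and at a tuple of directions is continuous, hence commutes with the
    -- Bochner integral. The claim becomes the pointwise formula for iterated directional
    -- derivatives.
    let ev : BddCont V (V [×p.1.2]→L[ℝ] F) →L[ℝ] F :=
      (ContinuousMultilinearMap.apply ℝ (fun _ : Fin p.1.2 => V) F m) ∘L
        (BoundedContinuousFunction.evalCLM ℝ x)
    have h3 := ev.integral_comp_comm hi3
    refine h3.symm.trans ?_
    change ∫ z, (‖x‖ ^ p.1.1 • iteratedFDeriv ℝ p.1.2 (G z) x) m ∂μ =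
      (‖x‖ ^ p.1.1 • iteratedFDeriv ℝ p.1.2 f x) m
    simp only [_root_.smul_apply]
    rw [integral_smul]
    congr 1
    simp only [← iteratedLineDerivOp_eq_iteratedFDeriv]
    exact (iteratedLineDeriv_eq_integral m hG hf x).symm
  have hsnd : (∫ z, Λ (G z) ∂μ).2 = ∫ z, L (G z) ∂μ :=
    ((ContinuousLinearMap.snd ℝ ((p : s) → BddCont V (V [×p.1.2]→L[ℝ] F)) H).integral_comp_comm hΛi).symm
  obtain ⟨w, hw, hwl⟩ := mem_closure_iff_seq_limit.1 hmem
  have hw' : ∀ n, ∃ g, Λ g = w n := fun n => hw n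
  choose g hg using hw'
  have l1 : Filter.Tendsto (fun n => ι (g n)) Filter.atTop (nhds (ι f)) := by
    rw [← hfst]
    exact ((continuous_fst.tendsto _).comp hwl).congr fun n => by
      rw [Function.comp_apply, ← hg]; rfl
  have l2 : Filter.Tendsto (fun n => L (g n)) Filter.atTop (nhds (∫ z, L (G z) ∂μ)) := by
    rw [← hsnd]
    exact ((continuous_snd.tendsto _).comp hwl).congr fun n => by
      rw [Function.comp_apply, ← hg]; rfl
  refine tendsto_nhds_unique ?_ l2
  rw [tendsto_iff_norm_sub_tendsto_zero] at l1 ⊢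
  refine squeeze_zero (fun n => norm_nonneg _) (fun n => ?_) (by simpa using l1.const_mul (C : ℝ))
  rw [← map_sub, ← map_sub]
  exact hbound _

end WeakIntegral

/-! ### Time-frequency shifts -/

section Translation

variable {V : Type*} [NormedAddCommGroup V] [NormedSpace ℝ V]

/-- The translation `f ↦ f (· - a)` on Schwartz functions. -/
noncomputable abbrev translate (a : V) : 𝓢(V, ℂ) →L[ℂ] 𝓢(V, ℂ) := compSubConstCLM ℂ a

lemma add_pow_le_two_pow {a b : ℝ} (ha : 0 ≤ a) (hb : 0 ≤ b) (k : ℕ) :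
    (a + b) ^ k ≤ 2 ^ k * (a ^ k + b ^ k) := by
  have h : a + b ≤ 2 * max a b := by linarith [le_max_left a b, le_max_right a b]
  calc (a + b) ^ k ≤ (2 * max a b) ^ k := by gcongr
    _ = 2 ^ k * (max a b) ^ k := mul_pow _ _ _
    _ ≤ _ := by
      gcongr
      rcases max_choice a b with h | h <;> rw [h]
      · exact le_add_of_nonneg_right (by positivity)
      · exact le_add_of_nonneg_left (by positivity)

lemma norm_pow_mul_iteratedFDeriv_le (f : 𝓢(V, ℂ)) (k n : ℕ) {a r : ℝ} (hr : 0 ≤ r) (y : V)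
    (ha0 : 0 ≤ a) (ha : a ≤ r + ‖y‖) :
    a ^ k * ‖iteratedFDeriv ℝ n f y‖ ≤
      2 ^ k * (r ^ k * SchwartzMap.seminorm ℂ 0 n f + SchwartzMap.seminorm ℂ k n f) := by
  have h0 := SchwartzMap.le_seminorm ℂ 0 n f y
  have hk := SchwartzMap.le_seminorm ℂ k n f y
  rw [pow_zero, one_mul] at h0
  calc a ^ k * ‖iteratedFDeriv ℝ n f y‖
      ≤ (2 ^ k * (r ^ k + ‖y‖ ^ k)) * ‖iteratedFDeriv ℝ n f y‖ := by
        gcongr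
        exact (pow_le_pow_left₀ ha0 ha k).trans (add_pow_le_two_pow hr (norm_nonneg y) k)
    _ = 2 ^ k * (r ^ k * ‖iteratedFDeriv ℝ n f y‖ + ‖y‖ ^ k * ‖iteratedFDeriv ℝ n f y‖) := by ring
    _ ≤ _ := by gcongr

lemma coe_translate (a : V) (f : 𝓢(V, ℂ)) : ⇑(translate a f) = fun x => f (x - a) := by
  ext x; simp

lemma seminorm_translate_le (k n : ℕ) (a : V) (f : 𝓢(V, ℂ)) :
    SchwartzMap.seminorm ℂ k n (translate a f) ≤
      2 ^ k * (‖a‖ ^ k * SchwartzMap.seminorm ℂ 0 n f + SchwartzMap.seminorm ℂ k n f) := by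
  refine SchwartzMap.seminorm_le_bound ℂ k n _ (by positivity) fun x => ?_
  rw [coe_translate, iteratedFDeriv_comp_sub]
  refine norm_pow_mul_iteratedFDeriv_le f k n (norm_nonneg a) (x - a) (norm_nonneg x) ?_
  simpa using norm_add_le a (x - a)

/-- The mean value inequality on the segment from `x` to `x - h`, at the cost of one derivative.
Points `y` of the segment satisfy ‖x‖ ≤ ‖h‖ + ‖y‖, which moves the weight from `x` to `y`. -/
lemma seminorm_translate_sub_le (k n : ℕ) (h : V) (f : 𝓢(V, ℂ)) :
    SchwartzMap.seminorm ℂ k n (translate h f - f) ≤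
      ‖h‖ * (2 ^ k * (‖h‖ ^ k * SchwartzMap.seminorm ℂ 0 (n + 1) f +
        SchwartzMap.seminorm ℂ k (n + 1) f)) := by
  set K := 2 ^ k * (‖h‖ ^ k * SchwartzMap.seminorm ℂ 0 (n + 1) f +
        SchwartzMap.seminorm ℂ k (n + 1) f)
  have hK : 0 ≤ K := by positivity
  refine SchwartzMap.seminorm_le_bound ℂ k n _ (by positivity) fun x => ?_
  have e : ⇑(translate h f - f) = ⇑(translate h f) - ⇑f := rfl
  rw [e, iteratedFDeriv_sub_apply ((translate h f).smooth n).contDiffAt (f.smooth n).contDiffAt,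
    coe_translate, iteratedFDeriv_comp_sub]
  -- The derivative bound is obtained by dividing by the weight, so the case of vanishing weight,
  -- where the claim is trivial, is set apart.
  rcases (show 0 ≤ ‖x‖ ^ k by positivity).eq_or_lt with h0 | h0
  · rw [← h0, zero_mul]
    positivity
  have hd : ∀ y ∈ segment ℝ x (x - h), DifferentiableAt ℝ (iteratedFDeriv ℝ n f) y := fun y _ =>
    ((f.smooth (n + 1)).differentiable_iteratedFDeriv
      (by exact_mod_cast Nat.lt_succ_self n)).differentiableAt
  have hb : ∀ y ∈ segment ℝ x (x - h), ‖fderiv ℝ (iteratedFDeriv ℝ n f) y‖ ≤ K / ‖x‖ ^ k := by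
    intro y hy
    rw [norm_fderiv_iteratedFDeriv, le_div_iff₀ h0, mul_comm]
    refine norm_pow_mul_iteratedFDeriv_le f k (n + 1) (norm_nonneg h) y (norm_nonneg x) ?_
    have h1 : ‖y - x‖ ≤ ‖h‖ := by
      rw [segment_eq_image'] at hy
      obtain ⟨t, ht, rfl⟩ := hy
      simp only [sub_sub_cancel_left, smul_neg, add_sub_cancel_left, norm_neg, norm_smul,
        Real.norm_of_nonneg ht.1]
      exact mul_le_of_le_one_left (norm_nonneg h) ht.2
    have h2 := norm_sub_le y (y - x)
    rw [sub_sub_cancel] at h2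
    linarith
  have h3 := (convex_segment x (x - h)).norm_image_sub_le_of_norm_fderiv_le hd hb
    (left_mem_segment ℝ x (x - h)) (right_mem_segment ℝ x (x - h))
  rw [sub_sub_cancel_left, norm_neg, div_mul_eq_mul_div, le_div_iff₀ h0] at h3
  rw [mul_comm, mul_comm ‖h‖]
  exact h3

lemma tendsto_translate_zero (f : 𝓢(V, ℂ)) :
    Filter.Tendsto (fun h : V => translate h f) (nhds 0) (nhds f) := by
  rw [(schwartz_withSeminorms ℂ V ℂ).tendsto_nhds]
  rintro ⟨k, n⟩ ε hε
  have hc : Continuous fun h : V => ‖h‖ * (2 ^ k * (‖h‖ ^ k * SchwartzMap.seminorm ℂ 0 (n + 1) f +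
        SchwartzMap.seminorm ℂ k (n + 1) f)) := by fun_prop
  have ht := hc.tendsto 0
  rw [norm_zero, zero_mul] at ht
  filter_upwards [ht.eventually (gt_mem_nhds hε)] with h hh
  exact (seminorm_translate_sub_le k n h f).trans_lt hh

/-- Joint continuity follows by splitting off a translate of `p.2 - f`, small because the seminorm
bounds are locally uniform in the shift, from a translate of the fixed `f`, where only the shift
moves. -/
lemma continuous_translate : Continuous fun p : V × 𝓢(V, ℂ) => translate p.1 p.2 := by
  rw [continuous_iff_continuousAt]
  rintro ⟨a, f⟩
  have h1 : Filter.Tendsto (fun p : V × 𝓢(V, ℂ) => translate p.1 f) (nhds (a, f))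
      (nhds (translate a f)) := by
    have h2 : Filter.Tendsto (fun p : V × 𝓢(V, ℂ) => p.1 - a) (nhds (a, f)) (nhds 0) := by
      have h3 : Continuous fun p : V × 𝓢(V, ℂ) => p.1 - a := by fun_prop
      simpa using h3.tendsto (a, f)
    refine (((translate a).continuous.tendsto _).comp
      ((tendsto_translate_zero f).comp h2)).congr fun p => ?_
    ext x
    simp
  have h4 : Filter.Tendsto (fun p : V × 𝓢(V, ℂ) => translate p.1 (p.2 - f)) (nhds (a, f))
      (nhds 0) := by
    rw [(schwartz_withSeminorms ℂ V ℂ).tendsto_nhds]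
    rintro ⟨k, n⟩ ε hε
    have hp (k n : ℕ) := continuous_seminorm_schwartz (V := V) (F := ℂ) k n
    have hc : Continuous fun p : V × 𝓢(V, ℂ) => 2 ^ k * (‖p.1‖ ^ k *
        SchwartzMap.seminorm ℂ 0 n (p.2 - f) + SchwartzMap.seminorm ℂ k n (p.2 - f)) := by
      have := (hp 0 n).comp (continuous_snd.sub continuous_const :
        Continuous fun p : V × 𝓢(V, ℂ) => p.2 - f)
      have := (hp k n).comp (continuous_snd.sub continuous_const :
        Continuous fun p : V × 𝓢(V, ℂ) => p.2 - f)
      fun_prop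
    have ht := hc.tendsto (a, f)
    simp only [sub_self, map_zero, mul_zero, add_zero] at ht
    filter_upwards [ht.eventually (gt_mem_nhds hε)] with p hh
    rw [sub_zero]
    exact (seminorm_translate_le k n p.1 (p.2 - f)).trans_lt hh
  have h5 := h4.add h1
  rw [zero_add] at h5
  refine h5.congr fun p => ?_
  rw [← map_add, sub_add_cancel]

/-- Polynomial growth in the shift is what lets the rapid decay of the short time Fourier transform
make the later integrals converge. -/
lemma exists_seminorm_translate_le (q : Seminorm ℂ 𝓢(V, ℂ)) (hq : Continuous q) :
    ∃ (N : ℕ) (q' : Seminorm ℂ 𝓢(V, ℂ)), Continuous q' ∧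
      ∀ a f, q (translate a f) ≤ (1 + ‖a‖) ^ N * q' f := by
  obtain ⟨s, C, -, hC⟩ := Seminorm.bound_of_continuous (schwartz_withSeminorms ℂ V ℂ) q hq
  let r (p : ℕ × ℕ) : Seminorm ℂ 𝓢(V, ℂ) :=
    (2 ^ p.1 : NNReal) • (SchwartzMap.seminorm ℂ 0 p.2 + SchwartzMap.seminorm ℂ p.1 p.2)
  have hr (p : ℕ × ℕ) (f : 𝓢(V, ℂ)) : r p f = 2 ^ p.1 * (SchwartzMap.seminorm ℂ 0 p.2 f +
      SchwartzMap.seminorm ℂ p.1 p.2 f) := by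
    simp [r, NNReal.smul_def, mul_add]
  have hrc (p : ℕ × ℕ) : Continuous (r p) := by
    have h1 := continuous_seminorm_schwartz (V := V) (F := ℂ) 0 p.2
    have h2 := continuous_seminorm_schwartz (V := V) (F := ℂ) p.1 p.2
    have : (r p : 𝓢(V, ℂ) → ℝ) = fun f => _ := funext (hr p)
    rw [this]
    fun_prop
  refine ⟨s.sup Prod.fst, C • s.sup r, ?_, fun a f => ?_⟩
  · exact (Seminorm.continuous_finsetSup fun p _ => hrc p).const_smul C
  · refine (hC _).trans ?_
    rw [_root_.smul_apply, _root_.smul_apply, NNReal.smul_def, NNReal.smul_def, smul_eq_mul,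
      smul_eq_mul, mul_left_comm]
    gcongr
    refine Seminorm.finset_sup_apply_le (by positivity) fun p hp => ?_
    refine (seminorm_translate_le p.1 p.2 a f).trans ?_
    have h1 : r p f ≤ (s.sup r) f := Seminorm.le_def.mp (Finset.le_sup hp) f
    have h2 : (1 + ‖a‖) ^ p.1 ≤ (1 + ‖a‖) ^ (s.sup Prod.fst) :=
      pow_le_pow_right₀ (by linarith [norm_nonneg a]) (Finset.le_sup (f := Prod.fst) hp)
    have h3 : ‖a‖ ^ p.1 ≤ (1 + ‖a‖) ^ p.1 := by gcongr; linarith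
    have h4 : 1 ≤ (1 + ‖a‖) ^ p.1 := one_le_pow₀ (by linarith [norm_nonneg a])
    have h0 : 0 ≤ SchwartzMap.seminorm ℂ 0 p.2 f := apply_nonneg _ _
    have h0' : 0 ≤ SchwartzMap.seminorm ℂ p.1 p.2 f := apply_nonneg _ _
    calc _ ≤ 2 ^ p.1 * ((1 + ‖a‖) ^ p.1 * SchwartzMap.seminorm ℂ 0 p.2 f +
          (1 + ‖a‖) ^ p.1 * SchwartzMap.seminorm ℂ p.1 p.2 f) := by
          gcongr
          exact le_mul_of_one_le_left h0' h4
      _ = (1 + ‖a‖) ^ p.1 * r p f := by rw [hr]; ring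
      _ ≤ _ := by gcongr

end Translation

/-! ### Modulations and their combination with translations -/

section Shift

variable {V : Type*} [NormedAddCommGroup V] [InnerProductSpace ℝ V] [FiniteDimensional ℝ V]
  [MeasurableSpace V] [BorelSpace V]

/-- The modulation `f ↦ exp (2 π i ⟨·, ξ⟩) f` on Schwartz functions. -/
noncomputable def modulate (ξ : V) (f : 𝓢(V, ℂ)) : 𝓢(V, ℂ) := 𝓕⁻ (translate ξ (𝓕 f))

/-- Modulation is defined as translation conjugated by the Fourier transform, so that it inherits
continuity and growth bounds from translation. Shifting the variable in the inversion formula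
recovers the explicit expression. -/
lemma modulate_apply (ξ : V) (f : 𝓢(V, ℂ)) (y : V) :
    modulate ξ f y = Complex.exp (((2 * π * inner ℝ ξ y : ℝ) : ℂ) * Complex.I) * f y := by
  have h1 : modulate ξ f y = ∫ η, Complex.exp (((2 * π * inner ℝ η y : ℝ) : ℂ) * Complex.I) •
      (𝓕 f) (η - ξ) := by
    rw [modulate, fourierInv_coe, Real.fourierInv_eq']
    simp
  rw [h1, ← integral_add_right_eq_self _ ξ]
  have h2 : f y = 𝓕⁻ (𝓕 f) y := by rw [FourierTransform.fourierInv_fourier_eq]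
  rw [h2, fourierInv_coe, Real.fourierInv_eq', ← integral_const_mul]
  congr 1
  ext η
  rw [add_sub_cancel_right, inner_add_left, smul_eq_mul, smul_eq_mul, ← mul_assoc,
    ← Complex.exp_add]
  congr 2
  push_cast
  ring

/-- The time-frequency shift `y ↦ exp (2 π i ⟨ξ, y⟩) g (y - x)`, where `z = (x, ξ)`. -/
noncomputable def tfShift (g : 𝓢(V, ℂ)) (z : V × V) : 𝓢(V, ℂ) := modulate z.2 (translate z.1 g)

lemma tfShift_apply (g : 𝓢(V, ℂ)) (z : V × V) (y : V) :
    tfShift g z y =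
      Complex.exp (((2 * π * inner ℝ z.2 y : ℝ) : ℂ) * Complex.I) * g (y - z.1) := by
  rw [tfShift, modulate_apply, coe_translate]

lemma continuous_tfShift (g : 𝓢(V, ℂ)) : Continuous (tfShift g) := by
  have h1 : Continuous fun z : V × V => translate z.1 g :=
    continuous_translate.comp (continuous_fst.prodMk continuous_const)
  have h2 : Continuous fun z : V × V => 𝓕 (translate z.1 g) :=
    (fourierTransformCLM ℂ (V := V) (E := ℂ)).continuous.comp h1
  have h3 : Continuous fun z : V × V => translate z.2 (𝓕 (translate z.1 g)) :=
    continuous_translate.comp (continuous_snd.prodMk h2)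
  exact (FourierTransform.fourierInvCLM ℂ 𝓢(V, ℂ)).continuous.comp h3

lemma exists_seminorm_tfShift_le (g : 𝓢(V, ℂ)) (q : Seminorm ℂ 𝓢(V, ℂ)) (hq : Continuous q) :
    ∃ (N : ℕ) (C : ℝ), 0 ≤ C ∧ ∀ z, q (tfShift g z) ≤ C * (1 + ‖z‖) ^ N := by
  let Fi := FourierTransform.fourierInvCLM ℂ 𝓢(V, ℂ)
  let Fo := fourierTransformCLM ℂ (V := V) (E := ℂ)
  obtain ⟨N₁, q₁, hq₁, h₁⟩ := exists_seminorm_translate_le (q.comp Fi.toLinearMap)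
    (hq.comp Fi.continuous)
  obtain ⟨N₂, q₂, hq₂, h₂⟩ := exists_seminorm_translate_le (q₁.comp Fo.toLinearMap)
    (hq₁.comp Fo.continuous)
  refine ⟨N₁ + N₂, q₂ g, apply_nonneg _ _, fun z => ?_⟩
  have hz1 := norm_fst_le z
  have hz2 := norm_snd_le z
  calc q (tfShift g z) ≤ (1 + ‖z.2‖) ^ N₁ * q₁ (𝓕 (translate z.1 g)) :=
        h₁ z.2 (𝓕 (translate z.1 g))
    _ ≤ (1 + ‖z‖) ^ N₁ * ((1 + ‖z‖) ^ N₂ * q₂ g) := by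
        gcongr
        exact (h₂ z.1 g).trans (by gcongr)
    _ = _ := by ring

end Shift

/-! ### The short time Fourier transform -/

section
variable {V : Type} [NormedAddCommGroup V] [InnerProductSpace ℝ V]

/-- Leibniz' rule, arranged so that `g` enters only through one finite supremum of seminorms; this
is the form needed for continuity in `g`. -/
lemma norm_pow_mul_iteratedFDeriv_tensor_le (f g : 𝓢(V, ℂ)) (k n : ℕ) (z : Phase V) :
    ‖z‖ ^ k * ‖iteratedFDeriv ℝ n (fun z : Phase V => f z.fst * g z.snd) z‖ ≤
      (∑ i ∈ Finset.range (n + 1), (n.choose i : ℝ) * (2 ^ k *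
        (SchwartzMap.seminorm ℂ k i f + SchwartzMap.seminorm ℂ 0 i f))) *
        ((Finset.Iic (k, n)).sup (schwartzSeminormFamily ℂ V ℂ)) g := by
  set p := SchwartzMap.seminorm ℂ (E := V) (F := ℂ)
  set S := ((Finset.Iic (k, n)).sup (schwartzSeminormFamily ℂ V ℂ)) g
  have hS (j i : ℕ) (hj : j ≤ k) : p j (n - i) g ≤ S := Seminorm.le_def.mp
    (Finset.le_sup (f := schwartzSeminormFamily ℂ V ℂ) (b := (j, n - i))
      (Finset.mem_Iic.2 (Prod.mk_le_mk.2 ⟨hj, Nat.sub_le n i⟩))) g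
  have h := norm_iteratedFDeriv_mul_le (N := n)
    ((f.smooth n).comp (WithLp.fstL 2 ℝ V V).contDiff)
    ((g.smooth n).comp (WithLp.sndL 2 ℝ V V).contDiff) z le_rfl
  refine (mul_le_mul_of_nonneg_left h (by positivity)).trans ?_
  rw [Finset.mul_sum, Finset.sum_mul]
  refine Finset.sum_le_sum fun i _ => ?_
  have ha := norm_iteratedFDeriv_comp_le f _ norm_fstL_le z i
  have hb := norm_iteratedFDeriv_comp_le g _ norm_sndL_le z (n - i)
  have a1 := SchwartzMap.le_seminorm ℂ k i f z.fst
  have a0 := SchwartzMap.le_seminorm ℂ 0 i f z.fst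
  have b1 := (SchwartzMap.le_seminorm ℂ k (n - i) g z.snd).trans (hS k i le_rfl)
  have b0 := (SchwartzMap.le_seminorm ℂ 0 (n - i) g z.snd).trans (hS 0 i (Nat.zero_le k))
  rw [pow_zero, one_mul] at a0 b0
  change _ ≤ ‖iteratedFDeriv ℝ i f z.fst‖ at ha
  change _ ≤ ‖iteratedFDeriv ℝ (n - i) g z.snd‖ at hb
  set A := ‖iteratedFDeriv ℝ i f z.fst‖
  set B := ‖iteratedFDeriv ℝ (n - i) g z.snd‖
  have hA : 0 ≤ A := norm_nonneg _
  have hB : 0 ≤ B := norm_nonneg _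
  calc _ ≤ (2 ^ k * (‖z.fst‖ ^ k + ‖z.snd‖ ^ k)) * ((n.choose i : ℝ) * A * B) := by
        gcongr
        exact norm_pow_le z k
    _ = (n.choose i : ℝ) * (2 ^ k * ((‖z.fst‖ ^ k * A) * B + A * (‖z.snd‖ ^ k * B))) := by ring
    _ ≤ (n.choose i : ℝ) * (2 ^ k * (p k i f * S + p 0 i f * S)) := by gcongr
    _ = _ := by ring

/-- `f ↦ g ⊗ f` as a continuous linear map. -/
noncomputable def tensorLeft (g : 𝓢(V, ℂ)) : 𝓢(V, ℂ) →L[ℂ] 𝓢(Phase V, ℂ) :=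
  SchwartzMap.mkCLM (fun f z => tensorS g f z)
    (fun f h z => by simp [mul_add])
    (fun a f z => by simp; ring)
    (fun f => (tensorS g f).smooth ⊤)
    (fun n => ⟨Finset.Iic n, _, by positivity,
      fun f z => norm_pow_mul_iteratedFDeriv_tensor_le g f n.1 n.2 z⟩)

/-- The involution `(x, y) ↦ (y - x, y)`. -/
noncomputable def shear : Phase V ≃L[ℝ] Phase V where
  toFun z := WithLp.toLp 2 (z.snd - z.fst, z.snd)
  invFun z := WithLp.toLp 2 (z.snd - z.fst, z.snd)
  map_add' z w := by refine ext_phase ?_ ?_ <;> simp; module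
  map_smul' c z := by refine ext_phase ?_ ?_ <;> simp; module
  left_inv z := by refine ext_phase ?_ ?_ <;> simp
  right_inv z := by refine ext_phase ?_ ?_ <;> simp
  continuous_toFun := continuous_toPhase (by fun_prop) (by fun_prop)
  continuous_invFun := continuous_toPhase (by fun_prop) (by fun_prop)

lemma norm_le_norm_toLp (z : V × V) : ‖z‖ ≤ ‖(WithLp.toLp 2 z : Phase V)‖ :=
  max_le (norm_toLp_fst_le z.1 z.2) (norm_toLp_snd_le z.1 z.2)

end

section
variable {V : Type} [NormedAddCommGroup V] [InnerProductSpace ℝ V] [FiniteDimensional ℝ V]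
  [MeasurableSpace V] [BorelSpace V]

/-- The function `(x, y) ↦ f y * g (y - x)`. -/
noncomputable def windowed (g : 𝓢(V, ℂ)) : 𝓢(V, ℂ) →L[ℂ] 𝓢(Phase V, ℂ) :=
  (compCLMOfContinuousLinearEquiv ℂ shear) ∘L tensorLeft g

lemma windowed_apply (g f : 𝓢(V, ℂ)) (x y : V) :
    windowed g f (WithLp.toLp 2 (x, y)) = g (y - x) * f y := rfl

/-- The short time Fourier transform with window `g`. -/
noncomputable def stft (g : 𝓢(V, ℂ)) : 𝓢(V, ℂ) →L[ℂ] 𝓢(Phase V, ℂ) :=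
  (partialOsc (2 * π) Real.two_pi_pos.ne') ∘L windowed g

/-- The frequency scale 2π in `stft` is chosen to match the normalization of `𝓕`, so that Fourier
inversion applies for each fixed `x` without constants. -/
lemma stft_apply_eq_fourier (g f : 𝓢(V, ℂ)) (x ξ : V) :
    stft g f (WithLp.toLp 2 (x, ξ)) = 𝓕 (slice (windowed g f) x) ξ := by
  change oscInt (2 * π) (windowed g f) _ = _
  rw [oscInt_eq_fourier, div_self Real.two_pi_pos.ne', one_smul]
  rfl

lemma stft_apply (g f : 𝓢(V, ℂ)) (x ξ : V) :
    stft g f (WithLp.toLp 2 (x, ξ)) =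
      ∫ y : V, Complex.exp (-((2 * π * inner ℝ y ξ : ℝ) : ℂ) * Complex.I) *
        (g (y - x) * f y) := rfl

/-- Rapid decay of Schwartz functions on phase space, in terms of the sup norm. -/
lemma exists_seminorm_decay {E W : Type*} [NormedAddCommGroup E] [NormedSpace ℝ E]
    [NormedAddCommGroup W] (ι : W → E) {c : ℝ} (hc : 0 < c) (hι : ∀ w, c * ‖w‖ ≤ ‖ι w‖) (N : ℕ) :
    ∃ q : Seminorm ℂ 𝓢(E, ℂ), Continuous q ∧
      ∀ (Ψ : 𝓢(E, ℂ)) (w : W), ‖Ψ (ι w)‖ * (1 + ‖w‖) ^ N ≤ q Ψ := by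
  let C : NNReal := ⟨(1 + c⁻¹) ^ N * 2 ^ N, by positivity⟩
  refine ⟨C • (Finset.Iic (N, 0)).sup (schwartzSeminormFamily ℂ E ℂ),
    (Seminorm.continuous_finsetSup fun p _ =>
      continuous_seminorm_schwartz p.1 p.2).const_smul C, fun Ψ w => ?_⟩
  have h := SchwartzMap.one_add_le_sup_seminorm_apply (𝕜 := ℂ) (m := (N, 0)) (k := N) (n := 0)
    le_rfl le_rfl Ψ (ι w)
  change _ ≤ _ * ((Finset.Iic (N, 0)).sup (schwartzSeminormFamily ℂ E ℂ)) Ψ at h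
  rw [norm_iteratedFDeriv_zero] at h
  rw [_root_.smul_apply, NNReal.smul_def, smul_eq_mul]
  have h1 : 1 + ‖w‖ ≤ (1 + c⁻¹) * (1 + ‖ι w‖) := by
    have h2 : ‖w‖ ≤ c⁻¹ * ‖ι w‖ := (le_inv_mul_iff₀ hc).2 (hι w)
    have h3 : 0 < c⁻¹ := inv_pos.2 hc
    nlinarith [norm_nonneg (ι w)]
  change _ ≤ ((1 + c⁻¹) ^ N * 2 ^ N) * _
  calc ‖Ψ (ι w)‖ * (1 + ‖w‖) ^ N ≤ ‖Ψ (ι w)‖ * ((1 + c⁻¹) * (1 + ‖ι w‖)) ^ N := by gcongr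
    _ = (1 + c⁻¹) ^ N * ((1 + ‖ι w‖) ^ N * ‖Ψ (ι w)‖) := by rw [mul_pow]; ring
    _ ≤ (1 + c⁻¹) ^ N * (2 ^ N * _) := by gcongr
    _ = _ := by ring

/-- Integrability of a Schwartz function against a continuous function of polynomial growth. -/
lemma exists_seminorm_integral_le {E W H : Type*} [NormedAddCommGroup E] [NormedSpace ℝ E]
    [NormedAddCommGroup W] [NormedSpace ℝ W] [FiniteDimensional ℝ W] [MeasurableSpace W]
    [BorelSpace W] (μ : Measure W) [μ.IsAddHaarMeasure]
    [NormedAddCommGroup H] [NormedSpace ℂ H] (ι : W → E) (hιc : Continuous ι)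
    {c : ℝ} (hc : 0 < c) (hι : ∀ w, c * ‖w‖ ≤ ‖ι w‖) {b : W → H} (hb : Continuous b) {C : ℝ}
    (hC : 0 ≤ C) {N : ℕ} (hbC : ∀ w, ‖b w‖ ≤ C * (1 + ‖w‖) ^ N) :
    ∃ q : Seminorm ℂ 𝓢(E, ℂ), Continuous q ∧ ∀ Ψ : 𝓢(E, ℂ),
      Integrable (fun w => Ψ (ι w) • b w) μ ∧ ∫ w, ‖Ψ (ι w) • b w‖ ∂μ ≤ q Ψ := by
  set M := μ.integrablePower
  -- `N` powers of decay absorb the growth of `b`, and the other `M` make the remainder integrable.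
  obtain ⟨q, hq, hqb⟩ := exists_seminorm_decay ι hc hι (N + M)
  have hint := Measure.integrable_pow_neg_integrablePower μ
  set K := ∫ w, (1 + ‖w‖) ^ (-(μ.integrablePower : ℝ)) ∂μ
  have hK : 0 ≤ K := integral_nonneg fun w => by positivity
  have hle (Ψ : 𝓢(E, ℂ)) (w : W) :
      ‖Ψ (ι w) • b w‖ ≤ (C * q Ψ) * (1 + ‖w‖) ^ (-(μ.integrablePower : ℝ)) := by
    rw [norm_smul, Real.rpow_neg (by positivity), Real.rpow_natCast, ← div_eq_mul_inv,
      le_div_iff₀ (by positivity)]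
    calc ‖Ψ (ι w)‖ * ‖b w‖ * (1 + ‖w‖) ^ M
        ≤ ‖Ψ (ι w)‖ * (C * (1 + ‖w‖) ^ N) * (1 + ‖w‖) ^ M := by gcongr; exact hbC w
      _ = C * (‖Ψ (ι w)‖ * (1 + ‖w‖) ^ (N + M)) := by rw [pow_add]; ring
      _ ≤ C * q Ψ := by gcongr; exact hqb Ψ w
  have hi (Ψ : 𝓢(E, ℂ)) : Integrable (fun w => Ψ (ι w) • b w) μ :=
    (hint.const_mul (C * q Ψ)).mono' (((Ψ.continuous.comp hιc).smul hb).aestronglyMeasurable)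
      (Filter.Eventually.of_forall (hle Ψ))
  let D : NNReal := ⟨C * K, by positivity⟩
  refine ⟨D • q, hq.const_smul D, fun Ψ => ⟨hi Ψ, ?_⟩⟩
  refine (integral_mono (hi Ψ).norm (hint.const_mul (C * q Ψ)) (hle Ψ)).trans_eq ?_
  rw [integral_const_mul, _root_.smul_apply, NNReal.smul_def, smul_eq_mul]
  change _ = C * K * _
  ring

/-- The short time Fourier transform is a Schwartz function on phase space, and its decay beats the
polynomial growth of the seminorms of the shifts. -/
lemma schwartzIntegrable_stft_smul_tfShift (g h f : 𝓢(V, ℂ)) :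
    SchwartzIntegrable ((volume : Measure V).prod volume)
      (fun z => stft g f (WithLp.toLp 2 z) • tfShift h z) where
  continuous := ((stft g f).continuous.comp
    (WithLp.prodContinuousLinearEquiv 2 ℝ V V).symm.continuous).smul (continuous_tfShift h)
  integrable_seminorm q hq := by
    obtain ⟨N, C, hC, hN⟩ := exists_seminorm_tfShift_le h q hq
    obtain ⟨_, -, h1⟩ := exists_seminorm_integral_le (H := ℂ) ((volume : Measure V).prod volume)
      (fun z => (WithLp.toLp 2 z : Phase V))
      (WithLp.prodContinuousLinearEquiv 2 ℝ V V).symm.continuous one_pos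
      (fun z => by rw [one_mul]; exact norm_le_norm_toLp z)
      (b := fun z => ((q (tfShift h z) : ℝ) : ℂ))
      (Complex.continuous_ofReal.comp (hq.comp (continuous_tfShift h))) hC
      (fun z => by
        rw [Complex.norm_real, Real.norm_of_nonneg (apply_nonneg _ _)]
        exact hN z)
    refine (h1 (stft g f)).1.norm.congr (Filter.Eventually.of_forall fun z => ?_)
    simp only [norm_smul, map_smul_eq_mul, Complex.norm_real]
    rw [Real.norm_of_nonneg (apply_nonneg _ _)]

/-- Integrating in ξ first is Fourier inversion and yields f(y) g(y - x)²; integrating in x then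
uses the normalization of the window. No conjugate falls on the window, so the normalization is
bilinear. -/
lemma eq_integral_stft_mul_tfShift {g : 𝓢(V, ℂ)} (hg : ∫ y, g y * g y = 1) (f : 𝓢(V, ℂ)) (y : V) :
    f y = ∫ z : V × V, (stft g f (WithLp.toLp 2 z) • tfShift g z) y := by
  have hi : Integrable (fun z : V × V => (stft g f (WithLp.toLp 2 z) • tfShift g z) y)
      (volume.prod volume) := by
    exact (schwartzIntegrable_stft_smul_tfShift g g f).integrable_map
      ((BoundedContinuousFunction.evalCLM ℂ y) ∘L (toBoundedContinuousFunctionCLM ℂ V ℂ))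
  rw [Measure.volume_eq_prod, integral_prod _ hi]
  have h1 (x : V) : ∫ ξ, (stft g f (WithLp.toLp 2 (x, ξ)) • tfShift g (x, ξ)) y =
      f y * (g (y - x) * g (y - x)) := by
    have h2 : slice (windowed g f) x y = 𝓕⁻ (𝓕 (slice (windowed g f) x)) y := by
      rw [FourierTransform.fourierInv_fourier_eq]
    rw [fourierInv_coe, Real.fourierInv_eq'] at h2
    have h3 : slice (windowed g f) x y = g (y - x) * f y := windowed_apply g f x y
    have h4 (ξ : V) : (stft g f (WithLp.toLp 2 (x, ξ)) • tfShift g (x, ξ)) y =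
        (Complex.exp (((2 * π * inner ℝ ξ y : ℝ) : ℂ) * Complex.I) •
          𝓕 (slice (windowed g f) x) ξ) * g (y - x) := by
      rw [_root_.smul_apply, stft_apply_eq_fourier, tfShift_apply, smul_eq_mul, smul_eq_mul]
      ring
    simp only [h4]
    rw [integral_mul_const, ← h2, h3]
    ring
  simp only [h1]
  rw [integral_const_mul, integral_sub_left_eq_self (fun t => g t * g t), hg, mul_one]

end

/-! ### The kernel theorem -/

section
variable {V : Type} [NormedAddCommGroup V] [InnerProductSpace ℝ V] [FiniteDimensional ℝ V]
  [MeasurableSpace V] [BorelSpace V]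

/-- The reconstruction formula for the short time Fourier transform, in weak form. -/
theorem map_eq_integral_stft_smul {H : Type*} [NormedAddCommGroup H] [NormedSpace ℂ H]
    [CompleteSpace H] {g : 𝓢(V, ℂ)} (hg : ∫ y, g y * g y = 1) (L : 𝓢(V, ℂ) →L[ℂ] H)
    (f : 𝓢(V, ℂ)) : L f = ∫ z : V × V, stft g f (WithLp.toLp 2 z) • L (tfShift g z) := by
  have h := map_eq_integral_of_forall_eq_integral
    (schwartzIntegrable_stft_smul_tfShift g g f) (eq_integral_stft_mul_tfShift hg f) L
  simp only [map_smul] at h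
  exact h

variable (V) in
lemma exists_window : ∃ g : 𝓢(V, ℂ), ∫ y, g y * g y = 1 := by
  let φ : ContDiffBump (0 : V) := default
  have hφ : HasCompactSupport fun y => ((φ y : ℝ) : ℂ) :=
    φ.hasCompactSupport.comp_left (g := fun r : ℝ => (r : ℂ)) Complex.ofReal_zero
  have hφ' : ContDiff ℝ (⊤ : ℕ∞) fun y => ((φ y : ℝ) : ℂ) :=
    Complex.ofRealCLM.contDiff.comp φ.contDiff
  let h : 𝓢(V, ℂ) := hφ.toSchwartzMap hφ'
  have hh (y : V) : h y = ((φ y : ℝ) : ℂ) := rfl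
  have hc : Continuous fun y => φ y * φ y := φ.continuous.mul φ.continuous
  have hpos : 0 < ∫ y, φ y * φ y := by
    refine hc.integral_pos_of_hasCompactSupport_nonneg_nonzero
      φ.hasCompactSupport.mul_left (fun y => mul_self_nonneg _) (x := 0) ?_
    have : φ 0 = 1 := φ.one_of_mem_closedBall (by simp [φ.rIn_pos.le])
    simp [this]
  set c := ∫ y, φ y * φ y
  refine ⟨(((Real.sqrt c)⁻¹ : ℝ) : ℂ) • h, ?_⟩
  have e (y : V) : ((((Real.sqrt c)⁻¹ : ℝ) : ℂ) • h) y * ((((Real.sqrt c)⁻¹ : ℝ) : ℂ) • h) y =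
      ((c⁻¹ * (φ y * φ y) : ℝ) : ℂ) := by
    rw [_root_.smul_apply, hh, smul_eq_mul, ← Complex.ofReal_mul, ← Complex.ofReal_mul]
    congr 1
    have hs := Real.mul_self_sqrt hpos.le
    have : c⁻¹ = (Real.sqrt c)⁻¹ * (Real.sqrt c)⁻¹ := by rw [← mul_inv, hs]
    rw [this]
    ring
  simp only [e]
  rw [integral_complex_ofReal, integral_const_mul, inv_mul_cancel₀ hpos.ne', Complex.ofReal_one]

lemma integral_phase {H : Type*} [NormedAddCommGroup H] [NormedSpace ℝ H] (F : Phase V → H) :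
    ∫ z, F z = ∫ p : V × V, F (WithLp.toLp 2 p) ∂(volume : Measure V).prod volume :=
  ((WithLp.volume_preserving_toLp (U := V) (V := V)).integral_comp
    (MeasurableEquiv.toLp 2 (V × V)).measurableEmbedding F).symm

lemma integral_phase_mul (F G : V → ℂ) :
    ∫ z : Phase V, F z.fst * G z.snd = (∫ x, F x) * ∫ y, G y := by
  rw [integral_phase]
  exact integral_prod_mul F G

lemma integral_tensor_window {g : 𝓢(V, ℂ)} (hg : ∫ y, g y * g y = 1) :
    ∫ z, tensorS g g z * tensorS g g z = 1 := by
  have e (z : Phase V) : tensorS g g z * tensorS g g z =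
      (g z.fst * g z.fst) * (g z.snd * g z.snd) := by
    simp only [tensorS_apply]; ring
  simp only [e]
  rw [integral_phase_mul (fun x => g x * g x) (fun x => g x * g x), hg, one_mul]

lemma tfShift_tensor (g h : 𝓢(V, ℂ)) (Z : Phase V × Phase V) :
    tfShift (tensorS g h) Z =
      tensorS (tfShift g (Z.1.fst, Z.2.fst)) (tfShift h (Z.1.snd, Z.2.snd)) := by
  ext y
  simp only [tfShift_apply, tensorS_apply, WithLp.sub_fst, WithLp.sub_snd,
    WithLp.prod_inner_apply, WithLp.ofLp_fst, WithLp.ofLp_snd]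
  rw [mul_mul_mul_comm, ← Complex.exp_add]
  congr 2
  push_cast
  ring

/-- The defining integral factors by Fubini. Positions are grouped with positions and frequencies
with frequencies, hence the reordering of the coordinates of `z` and `w`. -/
lemma stft_tensor (g g' f f' : 𝓢(V, ℂ)) (z w : V × V) :
    stft (tensorS g g') (tensorS f f')
      (WithLp.toLp 2 (WithLp.toLp 2 (z.1, w.1), WithLp.toLp 2 (z.2, w.2))) =
      stft g f (WithLp.toLp 2 z) * stft g' f' (WithLp.toLp 2 w) := by
  rw [stft_apply, ← Prod.mk.eta (p := z), ← Prod.mk.eta (p := w), stft_apply, stft_apply,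
    ← integral_phase_mul]
  congr 1
  ext Y
  simp only [tensorS_apply, WithLp.sub_fst, WithLp.sub_snd, WithLp.prod_inner_apply,
    WithLp.ofLp_fst, WithLp.ofLp_snd]
  rw [mul_mul_mul_comm (Complex.exp _), ← Complex.exp_add]
  congr 1
  · congr 1
    push_cast
    ring
  · simp only [WithLp.toLp_fst, WithLp.toLp_snd]
    ring

/-- A continuous linear map on `𝓢(V × V)` is determined by its values on tensor products. -/
theorem ext_tensor {H : Type*} [NormedAddCommGroup H] [NormedSpace ℂ H] [CompleteSpace H]
    {S T : 𝓢(Phase V, ℂ) →L[ℂ] H} (h : ∀ f g, S (tensorS f g) = T (tensorS f g)) : S = T := by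
  obtain ⟨g, hg⟩ := exists_window V
  ext1 Φ
  -- With a tensor product window all time-frequency shifts are tensor products, so the
  -- reconstruction formula only sees the values of `S` and `T` on those.
  rw [map_eq_integral_stft_smul (integral_tensor_window hg) S,
    map_eq_integral_stft_smul (integral_tensor_window hg) T]
  simp only [tfShift_tensor, h]

lemma continuous_of_norm_le_seminorm {E H : Type*} [AddCommGroup E] [Module ℂ E]
    [TopologicalSpace E] [IsTopologicalAddGroup E] [NormedAddCommGroup H] [NormedSpace ℂ H]
    (T : E →ₗ[ℂ] H) {q : Seminorm ℂ E} (hq : Continuous q) (h : ∀ x, ‖T x‖ ≤ q x) :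
    Continuous T := by
  refine continuous_of_continuousAt_zero T ?_
  rw [ContinuousAt, map_zero, tendsto_zero_iff_norm_tendsto_zero]
  refine squeeze_zero (fun x => norm_nonneg _) h ?_
  simpa using hq.tendsto 0

/-- The increment is written as B(x₁ - f, x₂) + B(f, x₂ - g), and the bound is applied to each term.
-/
lemma continuous_bilinear_of_norm_le {E H : Type*} [AddCommGroup E] [Module ℂ E]
    [TopologicalSpace E] [IsTopologicalAddGroup E] [NormedAddCommGroup H] [NormedSpace ℂ H]
    (B : E →ₗ[ℂ] E →ₗ[ℂ] H) {p q : Seminorm ℂ E} (hp : Continuous p)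
    (hq : Continuous q) (hB : ∀ f g, ‖B f g‖ ≤ p f * q g) :
    Continuous fun x : E × E => B x.1 x.2 := by
  rw [continuous_iff_continuousAt]
  rintro ⟨f, g⟩
  rw [ContinuousAt, tendsto_iff_norm_sub_tendsto_zero]
  have hc : Continuous fun x : E × E => p (x.1 - f) * q x.2 + p f * q (x.2 - g) :=
    ((hp.comp (continuous_fst.sub continuous_const)).mul (hq.comp continuous_snd)).add
      (continuous_const.mul (hq.comp (continuous_snd.sub continuous_const)))
  refine squeeze_zero (fun x => norm_nonneg _) (fun x => ?_) (by simpa using hc.tendsto (f, g))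
  have e : B x.1 x.2 - B f g = B (x.1 - f) x.2 + B f (x.2 - g) := by
    simp only [map_sub, LinearMap.sub_apply]
    abel
  rw [e]
  exact (norm_add_le _ _).trans (add_le_add (hB _ _) (hB _ _))

/-- The kernel theorem for jointly continuous bilinear maps on Schwartz space. -/
theorem exists_kernel {H : Type*} [NormedAddCommGroup H] [NormedSpace ℂ H] [CompleteSpace H]
    (B : 𝓢(V, ℂ) →ₗ[ℂ] 𝓢(V, ℂ) →ₗ[ℂ] H) {p q : Seminorm ℂ 𝓢(V, ℂ)} (hp : Continuous p)
    (hq : Continuous q) (hB : ∀ f g, ‖B f g‖ ≤ p f * q g) :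
    ∃ T : 𝓢(Phase V, ℂ) →L[ℂ] H, ∀ f g, T (tensorS f g) = B f g := by
  obtain ⟨g, hg⟩ := exists_window V
  -- Regroups two phase space points (x, ξ), (x', ξ') of `V` into the phase space point ((x, x'),
  -- (ξ, ξ')) of `V × V`.
  let ι : (V × V) × (V × V) → Phase (Phase V) := fun w =>
    WithLp.toLp 2 (WithLp.toLp 2 (w.1.1, w.2.1), WithLp.toLp 2 (w.1.2, w.2.2))
  have hc1 : Continuous fun w : V × V => (WithLp.toLp 2 w : Phase V) :=
    (WithLp.prodContinuousLinearEquiv 2 ℝ V V).symm.continuous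
  have hιc : Continuous ι :=
    (WithLp.prodContinuousLinearEquiv 2 ℝ (Phase V) (Phase V)).symm.continuous.comp
      ((hc1.comp (by fun_prop : Continuous fun w : (V × V) × (V × V) => (w.1.1, w.2.1))).prodMk
        (hc1.comp (by fun_prop : Continuous fun w : (V × V) × (V × V) => (w.1.2, w.2.2))))
  have hι (w : (V × V) × (V × V)) : 1 * ‖w‖ ≤ ‖ι w‖ := by
    have h1 := norm_toLp_fst_le (WithLp.toLp 2 (w.1.1, w.2.1) : Phase V)
      (WithLp.toLp 2 (w.1.2, w.2.2))
    have h2 := norm_toLp_snd_le (WithLp.toLp 2 (w.1.1, w.2.1) : Phase V)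
      (WithLp.toLp 2 (w.1.2, w.2.2))
    rw [one_mul]
    exact max_le (max_le ((norm_toLp_fst_le _ _).trans h1) ((norm_toLp_fst_le _ _).trans h2))
      (max_le ((norm_toLp_snd_le _ _).trans h1) ((norm_toLp_snd_le _ _).trans h2))
  have hBc := continuous_bilinear_of_norm_le B hp hq hB
  have hB_left (f : 𝓢(V, ℂ)) : Continuous (B f) :=
    hBc.comp (continuous_const.prodMk continuous_id)
  have hb : Continuous fun w : (V × V) × (V × V) => B (tfShift g w.1) (tfShift g w.2) :=
    hBc.comp (((continuous_tfShift g).comp continuous_fst).prodMk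
      ((continuous_tfShift g).comp continuous_snd))
  obtain ⟨N₁, C₁, hC₁, h₁⟩ := exists_seminorm_tfShift_le g p hp
  obtain ⟨N₂, C₂, hC₂, h₂⟩ := exists_seminorm_tfShift_le g q hq
  have hbC (w : (V × V) × (V × V)) :
      ‖B (tfShift g w.1) (tfShift g w.2)‖ ≤ (C₁ * C₂) * (1 + ‖w‖) ^ (N₁ + N₂) := by
    have hw1 := norm_fst_le w
    have hw2 := norm_snd_le w
    calc _ ≤ p (tfShift g w.1) * q (tfShift g w.2) := hB _ _
      _ ≤ (C₁ * (1 + ‖w.1‖) ^ N₁) * (C₂ * (1 + ‖w.2‖) ^ N₂) := by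
        gcongr
        exacts [h₁ _, h₂ _]
      _ ≤ (C₁ * (1 + ‖w‖) ^ N₁) * (C₂ * (1 + ‖w‖) ^ N₂) := by gcongr
      _ = _ := by rw [pow_add]; ring
  set μ : Measure ((V × V) × (V × V)) :=
    ((volume : Measure V).prod volume).prod ((volume : Measure V).prod volume)
  have : μ.IsAddHaarMeasure := Measure.prod.instIsAddHaarMeasure _ _
  obtain ⟨r, hr, hrb⟩ := exists_seminorm_integral_le μ ι hιc one_pos hι hb (by positivity) hbC
  let A := stft (tensorS g g)
  -- This formula is forced: it is the weak reconstruction formula for the window `g ⊗ g`, with the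
  -- value of the extension on a tensor product of shifts prescribed by `B`.
  let T₀ : 𝓢(Phase V, ℂ) →ₗ[ℂ] H :=
    { toFun := fun Φ => ∫ w, A Φ (ι w) • B (tfShift g w.1) (tfShift g w.2) ∂μ
      map_add' := fun Φ Ψ => by
        simp only [map_add, _root_.add_apply, add_smul]
        exact integral_add (hrb _).1 (hrb _).1
      map_smul' := fun c Φ => by
        simp only [map_smul, _root_.smul_apply, smul_assoc]
        exact integral_smul c _ }
  have hT₀ : Continuous T₀ := continuous_of_norm_le_seminorm T₀
    (q := r.comp A.toLinearMap) (hr.comp A.continuous) fun Φ =>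
      (norm_integral_le_integral_norm _).trans (hrb (A Φ)).2
  refine ⟨⟨T₀, hT₀⟩, fun f h => ?_⟩
  change ∫ w, A (tensorS f h) (ι w) • B (tfShift g w.1) (tfShift g w.2) ∂μ = _
  have e (z w : V × V) : A (tensorS f h) (ι (z, w)) • B (tfShift g z) (tfShift g w) =
      stft g f (WithLp.toLp 2 z) • stft g h (WithLp.toLp 2 w) • B (tfShift g z) (tfShift g w) := by
    rw [← mul_smul, ← stft_tensor]
  -- After Fubini, the reconstruction formula is applied to the second argument of `B` and then to
  -- the first.
  rw [integral_prod _ (hrb _).1]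
  simp only [e, integral_smul]
  have h3 (z : V × V) : ∫ w : V × V, stft g h (WithLp.toLp 2 w) • B (tfShift g z) (tfShift g w)
      ∂(volume : Measure V).prod volume = B (tfShift g z) h :=
    (map_eq_integral_stft_smul hg ⟨B (tfShift g z), hB_left _⟩ h).symm
  simp only [h3]
  exact (map_eq_integral_stft_smul hg
    ⟨B.flip h, hBc.comp (continuous_id.prodMk continuous_const)⟩ f).symm

end

/-! ### Inversion of the partial Fourier transform and Weyl symbols -/

section
variable {V : Type} [NormedAddCommGroup V] [InnerProductSpace ℝ V] [FiniteDimensional ℝ V]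
  [MeasurableSpace V] [BorelSpace V]

variable (V) in
lemma normConst_mul_self :
    normConst V * normConst V = ((((2 * π) ^ Module.finrank ℝ V)⁻¹ : ℝ) : ℂ) := by
  rw [normConst, ← Complex.ofReal_mul, ← Real.rpow_add Real.two_pi_pos, ← Real.rpow_natCast,
    ← Real.rpow_neg Real.two_pi_pos.le]
  congr 2
  ring

variable (V) in
lemma normConst_ne_zero : normConst V ≠ 0 :=
  Complex.ofReal_ne_zero.2 (Real.rpow_pos_of_pos Real.two_pi_pos _).ne'

variable (V) in
lemma normConst_phase : normConst (Phase V) = normConst V * normConst V := by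
  have h : Module.finrank ℝ (Phase V) = Module.finrank ℝ V + Module.finrank ℝ V := by
    rw [(WithLp.prodContinuousLinearEquiv 2 ℝ V V).toLinearEquiv.finrank_eq, Module.finrank_prod]
  rw [normConst, normConst, ← Complex.ofReal_mul, ← Real.rpow_add Real.two_pi_pos, h]
  congr 2
  push_cast
  ring

/-- Fourier inversion in the second variable after the substitution η = (s / 2π) ξ, whose Jacobian
gives the factor (2π)ᵈ. Allowing both signs of `s` covers both orders of composition of 𝓕₂ and its
inverse. -/
lemma oscInt_neg_partialOsc (s : ℝ) (hs : |s| = 1) (hs0 : s ≠ 0) (Φ : 𝓢(Phase V, ℂ))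
    (z : Phase V) :
    oscInt (-s) (partialOsc s hs0 Φ) z = (((2 * π) ^ Module.finrank ℝ V : ℝ) : ℂ) * Φ z := by
  have h1 (ξ : V) : Complex.exp (-((-s * inner ℝ ξ z.snd : ℝ) : ℂ) * Complex.I) •
      partialOsc s hs0 Φ (WithLp.toLp 2 (z.fst, ξ)) =
      Complex.exp (((2 * π * inner ℝ ((s / (2 * π)) • ξ) z.snd : ℝ) : ℂ) * Complex.I) •
        𝓕 (slice Φ z.fst) ((s / (2 * π)) • ξ) := by
    have h2 : partialOsc s hs0 Φ (WithLp.toLp 2 (z.fst, ξ)) =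
        𝓕 (slice Φ z.fst) ((s / (2 * π)) • ξ) := oscInt_eq_fourier s Φ _
    rw [h2, real_inner_smul_left]
    congr 3
    have : (π : ℂ) ≠ 0 := by exact_mod_cast Real.pi_ne_zero
    push_cast
    field_simp
  unfold oscInt
  simp only [h1]
  rw [Measure.integral_comp_smul volume (fun η : V =>
    Complex.exp (((2 * π * inner ℝ η z.snd : ℝ) : ℂ) * Complex.I) • 𝓕 (slice Φ z.fst) η)]
  have h3 : slice Φ z.fst z.snd = 𝓕⁻ (𝓕 (slice Φ z.fst)) z.snd := by
    rw [FourierTransform.fourierInv_fourier_eq]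
  rw [fourierInv_coe, Real.fourierInv_eq'] at h3
  rw [← h3]
  have h4 : |((s / (2 * π)) ^ Module.finrank ℝ V)⁻¹| = (2 * π) ^ Module.finrank ℝ V := by
    rw [abs_inv, abs_pow, abs_div, hs, abs_of_pos Real.two_pi_pos, one_div, inv_pow, inv_inv]
  rw [h4, Complex.real_smul]
  rfl

theorem fourierInv₂_fourier₂ (Φ : 𝓢(Phase V, ℂ)) : fourierInv₂ (fourier₂ Φ) = Φ := by
  ext z
  have h : fourierInv₂ (fourier₂ Φ) z = normConst V * (normConst V *
      oscInt (-1) (partialOsc 1 one_ne_zero Φ) z) := by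
    simp only [fourier₂, fourierInv₂, _root_.smul_apply, map_smul, smul_eq_mul]
    rfl
  rw [h, oscInt_neg_partialOsc 1 abs_one, ← mul_assoc, normConst_mul_self, ← mul_assoc,
    ← Complex.ofReal_mul, inv_mul_cancel₀ (by positivity), Complex.ofReal_one, one_mul]

theorem fourier₂_fourierInv₂ (Φ : 𝓢(Phase V, ℂ)) : fourier₂ (fourierInv₂ Φ) = Φ := by
  ext z
  have h : fourier₂ (fourierInv₂ Φ) z = normConst V * (normConst V *
      oscInt (- -1) (partialOsc (-1) (neg_ne_zero.2 one_ne_zero) Φ) z) := by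
    simp only [fourier₂, fourierInv₂, _root_.smul_apply, map_smul, smul_eq_mul]
    rw [neg_neg]
    rfl
  rw [h, oscInt_neg_partialOsc (-1) (by simp), ← mul_assoc, normConst_mul_self, ← mul_assoc,
    ← Complex.ofReal_mul, inv_mul_cancel₀ (by positivity), Complex.ofReal_one, one_mul]

lemma conjS_conjS {W : Type} [NormedAddCommGroup W] [InnerProductSpace ℝ W] (f : 𝓢(W, ℂ)) :
    conjS (conjS f) = f := by
  ext x; simp

lemma conjS_tensorS (f g : 𝓢(V, ℂ)) : conjS (tensorS f g) = tensorS (conjS f) (conjS g) := by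
  ext x; simp

/-- The Wigner transform `Φ ↦ 𝓕₂ (Φ ∘ κ)`. -/
noncomputable def wigner : 𝓢(Phase V, ℂ) →L[ℂ] 𝓢(Phase V, ℂ) :=
  fourier₂ ∘L compCLMOfContinuousLinearEquiv ℂ kappa

/-- The inverse of the Wigner transform. -/
noncomputable def wignerInv : 𝓢(Phase V, ℂ) →L[ℂ] 𝓢(Phase V, ℂ) :=
  (compCLMOfContinuousLinearEquiv ℂ kappa.symm) ∘L fourierInv₂

lemma wignerInv_wigner (Φ : 𝓢(Phase V, ℂ)) : wignerInv (wigner Φ) = Φ := by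
  have h : wignerInv (wigner Φ) = compCLMOfContinuousLinearEquiv ℂ kappa.symm
      (fourierInv₂ (fourier₂ (compCLMOfContinuousLinearEquiv ℂ kappa Φ))) := rfl
  rw [h, fourierInv₂_fourier₂]
  ext z
  simp

lemma wigner_wignerInv (Φ : 𝓢(Phase V, ℂ)) : wigner (wignerInv Φ) = Φ := by
  have h : compCLMOfContinuousLinearEquiv ℂ kappa (wignerInv Φ) = fourierInv₂ Φ := by
    ext z
    simp [wignerInv]
  have h' : wigner (wignerInv Φ) =
      fourier₂ (compCLMOfContinuousLinearEquiv ℂ kappa (wignerInv Φ)) := rfl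
  rw [h', h, fourier₂_fourierInv₂]

lemma crossWigner_eq_wigner (g f : 𝓢(V, ℂ)) : crossWigner g f = wigner (tensorS g (conjS f)) := rfl

/-- A tempered distribution as a continuous linear map. -/
noncomputable def toCLM {W : Type} [NormedAddCommGroup W] [InnerProductSpace ℝ W]
    (T : 𝓢'(W, ℂ)) : 𝓢(W, ℂ) →L[ℂ] ℂ :=
  ⟨⟨⟨T, map_add T⟩, map_smul T⟩, map_continuous T⟩

/-- A tempered distribution on `V × V` is determined by its values on Wigner distributions. -/
theorem ext_crossWigner {σ σ' : 𝓢'(Phase V, ℂ)}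
    (h : ∀ f g, pair σ (crossWigner g f) = pair σ' (crossWigner g f)) : σ = σ' := by
  -- `pair` conjugates its test function; conjugating on both sides of the Wigner transform keeps
  -- the map linear and still invertible.
  let A : 𝓢(Phase V, ℂ) →L[ℂ] 𝓢(Phase V, ℂ) := (conjS ∘SL wigner) ∘SL conjS
  have h1 : toCLM σ ∘L A = toCLM σ' ∘L A := by
    refine ext_tensor fun a b => ?_
    have h2 : A (tensorS a b) = conjS (crossWigner (conjS a) b) := by
      rw [crossWigner_eq_wigner, ← conjS_tensorS]
      rfl
    change σ (A (tensorS a b)) = σ' (A (tensorS a b))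
    rw [h2]
    exact h b (conjS a)
  ext Ψ
  have h3 : Ψ = A (conjS (wignerInv (conjS Ψ))) := by
    change Ψ = conjS (wigner (conjS (conjS (wignerInv (conjS Ψ)))))
    rw [conjS_conjS, wigner_wignerInv, conjS_conjS]
  rw [h3]
  exact DFunLike.congr_fun h1 (conjS (wignerInv (conjS Ψ)))

lemma IsWeylSymbol.unique {K : 𝓢(V, ℂ) → 𝓢'(V, ℂ)} {σ σ' : 𝓢'(Phase V, ℂ)}
    (h : IsWeylSymbol K σ) (h' : IsWeylSymbol K σ') : σ = σ' :=
  ext_crossWigner fun _ _ =>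
    mul_left_cancel₀ (normConst_ne_zero V) ((h _ _).symm.trans (h' _ _))

theorem existsUnique_tensorDistribution (S T : 𝓢'(V, ℂ)) : ∃! τ, IsTensorDistribution S T τ := by
  let B : 𝓢(V, ℂ) →ₗ[ℂ] 𝓢(V, ℂ) →ₗ[ℂ] ℂ := LinearMap.mk₂ ℂ (fun f g => S f * T g)
    (fun f f' g => by rw [map_add, add_mul])
    (fun c f g => by rw [map_smul, smul_eq_mul, smul_eq_mul, mul_assoc])
    (fun f g g' => by rw [map_add, mul_add])
    (fun c f g => by rw [map_smul, smul_eq_mul, smul_eq_mul, mul_left_comm])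
  obtain ⟨τ, hτ⟩ := exists_kernel B (p := (normSeminorm ℂ ℂ).comp (toCLM S).toLinearMap)
    (q := (normSeminorm ℂ ℂ).comp (toCLM T).toLinearMap)
    (continuous_norm.comp (toCLM S).continuous) (continuous_norm.comp (toCLM T).continuous)
    (fun f g => (norm_mul _ _).le)
  refine ⟨ContinuousLinearMap.toPointwiseConvergenceCLM _ _ _ _ τ, hτ, fun τ' hτ' => ?_⟩
  have h : toCLM τ' = τ := ext_tensor fun f g => (hτ' f g).trans (hτ f g).symm
  ext Φ
  exact DFunLike.congr_fun h Φ

/-- The covariance form is bounded by a product of continuous seminorms through Cauchy-Schwarz, so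
it has a Schwartz kernel; the symbol is this kernel transported by the inverse Wigner transform.
Being valid for every process, this serves both u and W₀(u). -/
theorem existsUnique_weylSymbol_covOp {Ω : Type*} [MeasurableSpace Ω] {P : Measure Ω}
    (u : TemperedGSP V P) : ∃! σ, IsWeylSymbol (covOp u) σ := by
  let L : 𝓢(V, ℂ) →L[ℂ] Lp ℂ 2 P := u ∘SL (conjS : 𝓢(V, ℂ) →L⋆[ℂ] 𝓢(V, ℂ))
  -- Linear in both slots: in `f` the antilinearity of `u` cancels that of the inner product, and in
  -- `a` the conjugation inside `L` cancels that of `u`.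
  let B : 𝓢(V, ℂ) →ₗ[ℂ] 𝓢(V, ℂ) →ₗ[ℂ] ℂ := LinearMap.mk₂ ℂ (fun a f => inner ℂ (u f) (L a))
    (fun a a' f => by rw [map_add, inner_add_right])
    (fun c a f => by rw [map_smul, inner_smul_right, smul_eq_mul])
    (fun a f f' => by rw [map_add, inner_add_left])
    (fun c a f => by rw [map_smulₛₗ, inner_smul_left, smul_eq_mul, Complex.conj_conj])
  obtain ⟨T, hT⟩ := exists_kernel B (p := (normSeminorm ℂ _).comp L.toLinearMap)
    (q := (normSeminorm ℂ _).comp u.toLinearMap)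
    (continuous_norm.comp L.continuous) (continuous_norm.comp u.continuous)
    (fun a f => (norm_inner_le_norm (u f) (L a)).trans_eq (mul_comm _ _))
  let A : 𝓢(Phase V, ℂ) →L[ℂ] 𝓢(Phase V, ℂ) := (conjS ∘SL wignerInv) ∘SL conjS
  suffices h : ∃ σ, IsWeylSymbol (covOp u) σ from
    h.imp fun σ hσ => ⟨hσ, fun σ' hσ' => hσ'.unique hσ⟩
  refine ⟨ContinuousLinearMap.toPointwiseConvergenceCLM _ _ _ _ ((normConst V)⁻¹ • (T ∘L A)),
    fun f g => ?_⟩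
  have h1 : A (conjS (crossWigner g f)) = tensorS (conjS g) f := by
    change conjS (wignerInv (conjS (conjS (crossWigner g f)))) = _
    rw [conjS_conjS, crossWigner_eq_wigner, wignerInv_wigner, conjS_tensorS, conjS_conjS]
  change inner ℂ (u f) (u (conjS (conjS g))) =
    normConst V * ((normConst V)⁻¹ • T (A (conjS (crossWigner g f))))
  rw [h1, hT, smul_eq_mul, mul_inv_cancel_left₀ (normConst_ne_zero V)]
  rfl

end

/-! ### Fourth moments of symmetric Gaussian processes -/

section Moments

/-- Each derivative of p(t) exp(vt²/2) has the same shape, with p replaced by p' + vtp. Four rounds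
starting from p = 1 leave the constant term 3v². -/
lemma iteratedDeriv_four_exp_sq (v : ℝ) :
    iteratedDeriv 4 (fun t : ℝ => Real.exp (v * t ^ 2 / 2)) 0 = 3 * v ^ 2 := by
  have step (p p' : ℝ → ℝ) (hp : ∀ t, HasDerivAt p (p' t) t) :
      deriv (fun t => p t * Real.exp (v * t ^ 2 / 2)) =
        fun t => (p' t + p t * (v * t)) * Real.exp (v * t ^ 2 / 2) := by
    funext t
    have h1 : HasDerivAt (fun t : ℝ => v * t ^ 2 / 2) (v * t) t := by
      refine (((hasDerivAt_pow 2 t).const_mul v).div_const 2).congr_deriv ?_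
      norm_num
      ring
    have h2 : HasDerivAt (fun t => p t * Real.exp (v * t ^ 2 / 2)) _ t := (hp t).mul h1.exp
    rw [h2.deriv]
    ring
  have h0 : (fun t : ℝ => Real.exp (v * t ^ 2 / 2)) =
      fun t => (fun _ : ℝ => (1 : ℝ)) t * Real.exp (v * t ^ 2 / 2) := by simp
  have h1 := step (fun _ => 1) (fun _ => 0) (fun t => hasDerivAt_const t 1)
  have h2 := step (fun t => v * t) (fun _ => v) (fun t => by
    simpa using (hasDerivAt_id t).const_mul v)
  have h3 := step (fun t => v + v ^ 2 * t ^ 2) (fun t => 2 * v ^ 2 * t) (fun t => by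
    refine (((hasDerivAt_pow 2 t).const_mul (v ^ 2)).const_add v).congr_deriv ?_
    norm_num
    ring)
  have h4 := step (fun t => 3 * v ^ 2 * t + v ^ 3 * t ^ 3)
    (fun t => 3 * v ^ 2 + 3 * v ^ 3 * t ^ 2) (fun t => by
    refine (((hasDerivAt_id t).const_mul (3 * v ^ 2)).add
      ((hasDerivAt_pow 3 t).const_mul (v ^ 3))).congr_deriv ?_
    norm_num
    ring)
  have e1 : (fun t : ℝ => (0 + 1 * (v * t)) * Real.exp (v * t ^ 2 / 2)) =
      fun t => v * t * Real.exp (v * t ^ 2 / 2) := by funext t; ring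
  have e2 : (fun t : ℝ => (v + v * t * (v * t)) * Real.exp (v * t ^ 2 / 2)) =
      fun t => (v + v ^ 2 * t ^ 2) * Real.exp (v * t ^ 2 / 2) := by funext t; ring
  have e3 : (fun t : ℝ => (2 * v ^ 2 * t + (v + v ^ 2 * t ^ 2) * (v * t)) *
      Real.exp (v * t ^ 2 / 2)) =
      fun t => (3 * v ^ 2 * t + v ^ 3 * t ^ 3) * Real.exp (v * t ^ 2 / 2) := by funext t; ring
  simp only [iteratedDeriv_succ, iteratedDeriv_zero]
  rw [h0, h1, e1, h2, e2, h3, e3, h4]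
  simp

lemma integral_pow_four_gaussianReal (v : NNReal) :
    ∫ x, x ^ 4 ∂(gaussianReal 0 v) = 3 * (v : ℝ) ^ 2 := by
  have h := iteratedDeriv_mgf_zero (X := fun x : ℝ => x) (μ := gaussianReal 0 v)
    (by simp) 4
  rw [mgf_fun_id_gaussianReal] at h
  simp only [zero_mul, zero_add] at h
  rw [iteratedDeriv_four_exp_sq] at h
  exact h.symm

variable {Ω : Type*} [MeasurableSpace Ω] {P : Measure Ω} [IsProbabilityMeasure P]

lemma integral_pow_four_of_hasGaussianLaw {X : Ω → ℝ} (h : HasGaussianLaw X P)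
    (h0 : ∫ ω, X ω ∂P = 0) : ∫ ω, X ω ^ 4 ∂P = 3 * (∫ ω, X ω ^ 2 ∂P) ^ 2 := by
  have h1 := h.map_eq_gaussianReal
  rw [h0] at h1
  have h2 := integral_pow_four_gaussianReal Var[X; P].toNNReal
  rw [← h1, integral_map h.aemeasurable (by fun_prop),
    Real.coe_toNNReal _ (variance_nonneg X P), variance_of_integral_eq_zero h.aemeasurable h0] at h2
  exact h2

/-- By symmetry every Re(cZ) with |c| = 1 has the law of Re Z, a centred real Gaussian. It then
suffices to write |z|⁴ and |z|² as combinations of powers of such real parts; no independence of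
real and imaginary parts is used. -/
lemma integral_norm_pow_four_of_symmetric {Z : Ω → ℂ} (h : HasGaussianLaw Z P)
    (hs : ∀ c : ℂ, ‖c‖ = 1 → IdentDistrib (fun ω => c * Z ω) Z P P) :
    ∫ ω, ‖Z ω‖ ^ 4 ∂P = 2 * (∫ ω, ‖Z ω‖ ^ 2 ∂P) ^ 2 := by
  have hre (c : ℂ) (hc : ‖c‖ = 1) : IdentDistrib (fun ω => (c * Z ω).re) (fun ω => (Z ω).re) P P :=
    (hs c hc).comp Complex.measurable_re
  have hX : HasGaussianLaw (fun ω => (Z ω).re) P := h.map_fun Complex.reCLM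
  have h0 : ∫ ω, (Z ω).re ∂P = 0 := by
    have := (hre (-1) (by simp)).integral_eq
    simp only [neg_mul, one_mul, Complex.neg_re, integral_neg] at this
    linarith
  have hm4 (c : ℂ) (hc : ‖c‖ = 1) : ∫ ω, (c * Z ω).re ^ 4 ∂P = ∫ ω, (Z ω).re ^ 4 ∂P :=
    ((hre c hc).comp (measurable_id.pow_const 4)).integral_eq
  have hm2 (c : ℂ) (hc : ‖c‖ = 1) : ∫ ω, (c * Z ω).re ^ 2 ∂P = ∫ ω, (Z ω).re ^ 2 ∂P :=
    ((hre c hc).comp (measurable_id.pow_const 2)).integral_eq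
  have hmem (c : ℂ) : HasGaussianLaw (fun ω => (c * Z ω).re) P :=
    h.map_fun (Complex.reCLM ∘L (ContinuousLinearMap.mul ℝ ℂ c))
  have hi4 (c : ℂ) : Integrable (fun ω => (c * Z ω).re ^ 4) P := by
    have := ((hmem c).memLp (p := 4) (by simp)).integrable_norm_pow (by norm_num)
    refine this.congr (Filter.Eventually.of_forall fun ω => ?_)
    simp only [Real.norm_eq_abs]
    exact Even.pow_abs (by decide) _
  have hi2 (c : ℂ) : Integrable (fun ω => (c * Z ω).re ^ 2) P :=
    ((hmem c).memLp (p := 2) (by simp)).integrable_sq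
  set s : ℝ := (Real.sqrt 2)⁻¹
  have hs2 : s ^ 2 = 1 / 2 := by
    rw [inv_pow, Real.sq_sqrt (by norm_num)]; norm_num
  have hs4 : s ^ 4 = 1 / 4 := by
    rw [show s ^ 4 = (s ^ 2) ^ 2 by ring, hs2]; norm_num
  have hn (a b : ℝ) (hab : a ^ 2 + b ^ 2 = 1) : ‖(⟨a, b⟩ : ℂ)‖ = 1 := by
    rw [← sq_eq_sq₀ (norm_nonneg _) zero_le_one, Complex.sq_norm, Complex.normSq_mk]
    linarith
  set a : ℂ := ⟨s, s⟩
  set b : ℂ := ⟨s, -s⟩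
  have ha : ‖a‖ = 1 := hn _ _ (by rw [hs2]; norm_num)
  have hb : ‖b‖ = 1 := hn _ _ (by rw [neg_sq, hs2]; norm_num)
  have e2 (z : ℂ) : ‖z‖ ^ 2 = (1 * z).re ^ 2 + (Complex.I * z).re ^ 2 := by
    rw [Complex.sq_norm, Complex.normSq_apply]
    simp
    ring
  -- The four directions are equally spaced modulo π, so the sum of the fourth powers of the cosines
  -- is four times their circle average 3/8. This gives 3/2, hence the factor 2/3.
  have e4 (z : ℂ) : ‖z‖ ^ 4 = 2 / 3 * ((1 * z).re ^ 4 + (Complex.I * z).re ^ 4 +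
      (a * z).re ^ 4 + (b * z).re ^ 4) := by
    have h1 : ‖z‖ ^ 4 = (‖z‖ ^ 2) ^ 2 := by ring
    have h2 : (a * z).re = s * (z.re - z.im) := by
      rw [Complex.mul_re]; ring
    have h3 : (b * z).re = s * (z.re + z.im) := by
      rw [Complex.mul_re]; ring
    rw [h1, e2, h2, h3, mul_pow, mul_pow, hs4]
    simp
    ring
  simp only [e2, e4]
  have i2 : Integrable (fun ω => (1 * Z ω).re ^ 4 + (Complex.I * Z ω).re ^ 4) P :=
    (hi4 1).add (hi4 _)
  have i3 : Integrable (fun ω => (1 * Z ω).re ^ 4 + (Complex.I * Z ω).re ^ 4 +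
      (a * Z ω).re ^ 4) P := i2.add (hi4 _)
  rw [integral_const_mul, integral_add i3 (hi4 _), integral_add i2 (hi4 _),
    integral_add (hi4 1) (hi4 _),
    integral_add (hi2 1) (hi2 _), hm4 1 (by simp), hm4 _ Complex.norm_I, hm4 a ha, hm4 b hb,
    hm2 1 (by simp), hm2 _ Complex.norm_I, integral_pow_four_of_hasGaussianLaw hX h0]
  ring

end Moments

/-- Complex polarization: the diagonal values at a + b and a + ib show that S(a, b) + S(b, a) and
S(a, b) - S(b, a) both vanish. -/
lemma eq_zero_of_sesquilinear {E : Type*} [AddCommGroup E] [Module ℂ E] (S : E → E → ℂ)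
    (hadd : ∀ a a' b, S (a + a') b = S a b + S a' b)
    (hsmul : ∀ (c : ℂ) a b, S (c • a) b = conj c * S a b)
    (hadd' : ∀ a b b', S a (b + b') = S a b + S a b')
    (hsmul' : ∀ (c : ℂ) a b, S a (c • b) = c * S a b)
    (h : ∀ a, S a a = 0) (a b : E) : S a b = 0 := by
  have h1 := h (a + b)
  have h2 := h (a + Complex.I • b)
  rw [hadd, hadd', hadd', h, h] at h1
  rw [hadd, hadd', hadd', hsmul, hsmul, hsmul', hsmul', h, h, Complex.conj_I] at h2
  have h3 : Complex.I * (S a b - S b a) = 0 := by linear_combination h2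
  have h4 := (mul_eq_zero.1 h3).resolve_left Complex.I_ne_zero
  linear_combination (h1 + h4) / 2

/-! ### Wick's formula by polarization -/

section FourthMoment

variable {V : Type} [NormedAddCommGroup V] [InnerProductSpace ℝ V]
  {Ω : Type*} [MeasurableSpace Ω] {P : Measure Ω} [IsProbabilityMeasure P]

/-- The covariance form `E (u a) conj (u b)`. -/
noncomputable def covForm (u : TemperedGSP V P) (a b : 𝓢(V, ℂ)) : ℂ := inner ℂ (u b) (u a)

lemma covForm_eq_integral (u : TemperedGSP V P) (a b : 𝓢(V, ℂ)) :
    covForm u a b = ∫ ω, u a ω * conj (u b ω) ∂P := by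
  rw [covForm, L2.inner_def]
  rfl

/-- The fourth moment form `E (u a) conj (u b) (u c) conj (u d)`. -/
noncomputable def quarticForm (u : TemperedGSP V P) (a b c d : 𝓢(V, ℂ)) : ℂ :=
  ∫ ω, u a ω * conj (u b ω) * (u c ω * conj (u d ω)) ∂P

lemma norm_sq_eq_integral (X : Lp ℂ 2 P) : ‖X‖ ^ 2 = ∫ ω, ‖X ω‖ ^ 2 ∂P := by
  have h : ((‖X‖ ^ 2 : ℝ) : ℂ) = inner ℂ X X := by
    rw [inner_self_eq_norm_sq_to_K]; simp
  rw [L2.inner_def] at h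
  have h2 : ∫ ω, inner ℂ (X ω) (X ω) ∂P = ((∫ ω, ‖X ω‖ ^ 2 ∂P : ℝ) : ℂ) := by
    rw [← integral_complex_ofReal]
    congr 1
    ext ω
    rw [inner_self_eq_norm_sq_to_K]
    simp
  rw [h2] at h
  exact_mod_cast h

variable {u : TemperedGSP V P}

lemma IsGaussianGSP.memLp (hG : IsGaussianGSP u) (a : 𝓢(V, ℂ)) (p : ENNReal) (hp : p ≠ ⊤) :
    MemLp (u a) p P :=
  (IsGaussianProcess.hasGaussianLaw_eval hG a).memLp hp

lemma IsSymmetricGSP.identDistrib (hS : IsSymmetricGSP u) (a : 𝓢(V, ℂ)) (c : ℂ) (hc : ‖c‖ = 1) :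
    IdentDistrib (fun ω => c * u a ω) (u a) P P :=
  (hS c hc {a}).comp (u := fun f : ({a} : Finset 𝓢(V, ℂ)) → ℂ => f ⟨a, Finset.mem_singleton_self a⟩)
    (measurable_pi_apply _)

lemma integral_norm_pow_four (hG : IsGaussianGSP u) (hS : IsSymmetricGSP u) (a : 𝓢(V, ℂ)) :
    ∫ ω, ‖u a ω‖ ^ 4 ∂P = 2 * (‖u a‖ ^ 2) ^ 2 := by
  rw [norm_sq_eq_integral]
  exact integral_norm_pow_four_of_symmetric (IsGaussianProcess.hasGaussianLaw_eval hG a)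
    (hS.identDistrib a)

lemma IsGaussianGSP.memLp_mul_conj (hG : IsGaussianGSP u) (a b : 𝓢(V, ℂ)) :
    MemLp (fun ω => u a ω * conj (u b ω)) 2 P := by
  have : ENNReal.HolderTriple 4 4 2 := ⟨by
    rw [← ENNReal.toReal_eq_toReal_iff' (by simp) (by simp), ENNReal.toReal_add (by simp) (by simp)]
    norm_num⟩
  exact MemLp.mul (r := 2) (hG.memLp b 4 (by simp)).star (hG.memLp a 4 (by simp))

lemma IsGaussianGSP.integrable_quartic (hG : IsGaussianGSP u) (a b c d : 𝓢(V, ℂ)) :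
    Integrable (fun ω => u a ω * conj (u b ω) * (u c ω * conj (u d ω))) P :=
  (hG.memLp_mul_conj a b).integrable_mul (hG.memLp_mul_conj c d)

lemma quarticForm_add (hG : IsGaussianGSP u) (a a' b c d : 𝓢(V, ℂ)) :
    quarticForm u (a + a') b c d = quarticForm u a b c d + quarticForm u a' b c d := by
  rw [quarticForm, quarticForm, quarticForm,
    ← integral_add (hG.integrable_quartic _ _ _ _) (hG.integrable_quartic _ _ _ _)]
  refine integral_congr_ae ?_
  rw [map_add]
  filter_upwards [Lp.coeFn_add (u a) (u a')] with ω h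
  rw [h, Pi.add_apply]
  ring

lemma quarticForm_smul (s : ℂ) (a b c d : 𝓢(V, ℂ)) :
    quarticForm u (s • a) b c d = conj s * quarticForm u a b c d := by
  rw [quarticForm, quarticForm, ← integral_const_mul]
  refine integral_congr_ae ?_
  rw [map_smulₛₗ]
  filter_upwards [Lp.coeFn_smul (conj s) (u a)] with ω h
  rw [h, Pi.smul_apply, smul_eq_mul]
  ring

lemma quarticForm_swap (a b c d : 𝓢(V, ℂ)) : quarticForm u a b c d = quarticForm u c d a b := by
  simp only [quarticForm, mul_comm]

lemma conj_quarticForm (a b c d : 𝓢(V, ℂ)) :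
    conj (quarticForm u a b c d) = quarticForm u b a d c := by
  rw [quarticForm, quarticForm, ← integral_conj]
  congr 1
  ext ω
  simp only [map_mul, Complex.conj_conj]
  ring

lemma conj_covForm (a b : 𝓢(V, ℂ)) : conj (covForm u a b) = covForm u b a :=
  inner_conj_symm _ _

/-- Summing over the fourth roots of unity kills every mixed term except |x|²|y|². -/
lemma norm_add_pow_four_add_eq (x y : ℂ) :
    ‖x + y‖ ^ 4 + ‖x - y‖ ^ 4 + (‖x + Complex.I * y‖ ^ 4 + ‖x - Complex.I * y‖ ^ 4) =
      4 * (‖x‖ ^ 4 + ‖y‖ ^ 4) + 16 * (‖x‖ ^ 2 * ‖y‖ ^ 2) := by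
  have h (z : ℂ) : ‖z‖ ^ 4 = (z.re * z.re + z.im * z.im) ^ 2 := by
    rw [← Complex.normSq_apply, ← Complex.sq_norm]; ring
  simp only [h, Complex.sq_norm, Complex.normSq_apply, Complex.add_re, Complex.add_im,
    Complex.sub_re, Complex.sub_im, Complex.mul_re, Complex.mul_im, Complex.I_re, Complex.I_im]
  ring

lemma norm_add_sq_sq_add_eq {H : Type*} [NormedAddCommGroup H] [InnerProductSpace ℂ H] (x y : H) :
    (‖x + y‖ ^ 2) ^ 2 + (‖x - y‖ ^ 2) ^ 2 +
      ((‖x + Complex.I • y‖ ^ 2) ^ 2 + (‖x - Complex.I • y‖ ^ 2) ^ 2) =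
      4 * (‖x‖ ^ 2 + ‖y‖ ^ 2) ^ 2 + 8 * ‖(inner ℂ x y : ℂ)‖ ^ 2 := by
  simp only [norm_add_sq (𝕜 := ℂ), norm_sub_sq (𝕜 := ℂ), inner_smul_right, norm_smul,
    Complex.norm_I, Complex.sq_norm, Complex.normSq_apply, RCLike.re_eq_complex_re, Complex.mul_re,
    Complex.I_re, Complex.I_im]
  ring

/-- The sum of E|X + iᵏY|⁴ over k is computed twice: from the pointwise identity, and from E|Z|⁴ = 2
(E|Z|²)² combined with the corresponding Hilbert space identity. Comparison isolates the mixed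
moment. -/
lemma integral_norm_sq_mul_norm_sq (hG : IsGaussianGSP u) (hS : IsSymmetricGSP u) (a b : 𝓢(V, ℂ)) :
    ∫ ω, ‖u a ω‖ ^ 2 * ‖u b ω‖ ^ 2 ∂P = ‖u a‖ ^ 2 * ‖u b‖ ^ 2 + ‖covForm u a b‖ ^ 2 := by
  have hi (c : 𝓢(V, ℂ)) : Integrable (fun ω => ‖u c ω‖ ^ 4) P :=
    (hG.memLp c 4 (by simp)).integrable_norm_pow (by norm_num)
  have hab : Integrable (fun ω => ‖u a ω‖ ^ 2 * ‖u b ω‖ ^ 2) P := by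
    refine (hG.integrable_quartic a a b b).norm.congr (Filter.Eventually.of_forall fun ω => ?_)
    simp only [norm_mul, RCLike.norm_conj]
    ring
  set c₁ := a + b
  set c₂ := a - b
  -- The sign is opposite to that in `u c₃ = u a + i u b` because `u` is antilinear.
  set c₃ := a - Complex.I • b
  set c₄ := a + Complex.I • b
  have e₁ : u c₁ = u a + u b := map_add _ _ _
  have e₂ : u c₂ = u a - u b := map_sub _ _ _
  have e₃ : u c₃ = u a + Complex.I • u b := by
    rw [map_sub, map_smulₛₗ, Complex.conj_I, neg_smul, sub_neg_eq_add]
  have e₄ : u c₄ = u a - Complex.I • u b := by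
    rw [map_add, map_smulₛₗ, Complex.conj_I, neg_smul, sub_eq_add_neg]
  have hpt : ∀ᵐ ω ∂P, ‖u c₁ ω‖ ^ 4 + ‖u c₂ ω‖ ^ 4 + (‖u c₃ ω‖ ^ 4 + ‖u c₄ ω‖ ^ 4) =
      4 * (‖u a ω‖ ^ 4 + ‖u b ω‖ ^ 4) + 16 * (‖u a ω‖ ^ 2 * ‖u b ω‖ ^ 2) := by
    rw [e₁, e₂, e₃, e₄]
    filter_upwards [Lp.coeFn_add (u a) (u b), Lp.coeFn_sub (u a) (u b),
      Lp.coeFn_add (u a) (Complex.I • u b), Lp.coeFn_sub (u a) (Complex.I • u b),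
      Lp.coeFn_smul Complex.I (u b)] with ω h₁ h₂ h₃ h₄ h₅
    rw [h₁, h₂, h₃, h₄, Pi.add_apply, Pi.sub_apply, Pi.add_apply, Pi.sub_apply, h₅, Pi.smul_apply,
      smul_eq_mul]
    exact norm_add_pow_four_add_eq _ _
  have i₁ : Integrable (fun ω => ‖u c₁ ω‖ ^ 4 + ‖u c₂ ω‖ ^ 4) P := (hi _).add (hi _)
  have i₂ : Integrable (fun ω => ‖u c₃ ω‖ ^ 4 + ‖u c₄ ω‖ ^ 4) P := (hi _).add (hi _)
  have i₃ : Integrable (fun ω => 4 * (‖u a ω‖ ^ 4 + ‖u b ω‖ ^ 4)) P :=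
    ((hi _).add (hi _)).const_mul 4
  have h := integral_congr_ae hpt
  rw [integral_add i₁ i₂, integral_add (hi _) (hi _), integral_add (hi _) (hi _),
    integral_add i₃ (hab.const_mul 16), integral_const_mul, integral_const_mul,
    integral_add (hi _) (hi _)] at h
  simp only [integral_norm_pow_four hG hS] at h
  have h' := norm_add_sq_sq_add_eq (u a) (u b)
  rw [e₁, e₂, e₃, e₄] at h
  have hK : ‖covForm u a b‖ = ‖(inner ℂ (u a) (u b) : ℂ)‖ := norm_inner_symm _ _
  rw [hK]
  linarith

lemma quarticForm_self (hG : IsGaussianGSP u) (hS : IsSymmetricGSP u) (a b : 𝓢(V, ℂ)) :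
    quarticForm u a a b b = covForm u a a * covForm u b b + covForm u a b * covForm u b a := by
  have h1 : quarticForm u a a b b = ((∫ ω, ‖u a ω‖ ^ 2 * ‖u b ω‖ ^ 2 ∂P : ℝ) : ℂ) := by
    rw [quarticForm, ← integral_complex_ofReal]
    congr 1
    ext ω
    simp only [Complex.mul_conj', Complex.ofReal_mul, Complex.ofReal_pow]
  have h2 (c : 𝓢(V, ℂ)) : covForm u c c = ((‖u c‖ ^ 2 : ℝ) : ℂ) := by
    rw [covForm, inner_self_eq_norm_sq_to_K]
    simp
  rw [h1, integral_norm_sq_mul_norm_sq hG hS, h2, h2, ← conj_covForm a b, Complex.mul_conj']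
  push_cast
  rfl

/-- Wick's formula for the fourth moments of a symmetric Gaussian process. -/
theorem quarticForm_eq (hG : IsGaussianGSP u) (hS : IsSymmetricGSP u) (a b c d : 𝓢(V, ℂ)) :
    quarticForm u a b c d =
      covForm u a b * covForm u c d + covForm u a d * covForm u c b := by
  have cadd (a a' b : 𝓢(V, ℂ)) : covForm u (a + a') b = covForm u a b + covForm u a' b := by
    simp only [covForm, map_add, inner_add_right]
  have csmul (s : ℂ) (a b : 𝓢(V, ℂ)) : covForm u (s • a) b = conj s * covForm u a b := by
    simp only [covForm, map_smulₛₗ, inner_smul_right]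
  have cadd' (a b b' : 𝓢(V, ℂ)) : covForm u a (b + b') = covForm u a b + covForm u a b' := by
    simp only [covForm, map_add, inner_add_left]
  have csmul' (s : ℂ) (a b : 𝓢(V, ℂ)) : covForm u a (s • b) = s * covForm u a b := by
    simp only [covForm, map_smulₛₗ, inner_smul_left, Complex.conj_conj]
  have qadd' (a b b' c d : 𝓢(V, ℂ)) :
      quarticForm u a (b + b') c d = quarticForm u a b c d + quarticForm u a b' c d := by
    rw [← conj_quarticForm, quarticForm_add hG, map_add, conj_quarticForm, conj_quarticForm]
  have qsmul' (s : ℂ) (a b c d : 𝓢(V, ℂ)) :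
      quarticForm u a (s • b) c d = s * quarticForm u a b c d := by
    rw [← conj_quarticForm, quarticForm_smul, map_mul, conj_quarticForm, Complex.conj_conj]
  -- Both sides are sesquilinear in (a, b) and in (c, d) and agree when a = b and c = d. One
  -- polarization frees the first pair with c = d, a second one frees the other pair.
  have hdiag (c a b : 𝓢(V, ℂ)) : quarticForm u a b c c -
      (covForm u a b * covForm u c c + covForm u a c * covForm u c b) = 0 :=
    eq_zero_of_sesquilinear (fun a b => quarticForm u a b c c -
      (covForm u a b * covForm u c c + covForm u a c * covForm u c b))
      (fun a a' b => by simp only [quarticForm_add hG, cadd]; ring)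
      (fun s a b => by simp only [quarticForm_smul, csmul]; ring)
      (fun a b b' => by simp only [qadd', cadd']; ring)
      (fun s a b => by simp only [qsmul', csmul']; ring)
      (fun a => by simp only [quarticForm_self hG hS, sub_self]) a b
  have h := eq_zero_of_sesquilinear (fun c d => quarticForm u c d a b -
      (covForm u a b * covForm u c d + covForm u a d * covForm u c b))
      (fun a a' b => by simp only [quarticForm_add hG, cadd]; ring)
      (fun s a b => by simp only [quarticForm_smul, csmul]; ring)
      (fun a b b' => by simp only [qadd', cadd']; ring)
      (fun s a b => by simp only [qsmul', csmul']; ring)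
      (fun c => by
        rw [quarticForm_swap]
        exact hdiag c a b) c d
  rw [quarticForm_swap]
  exact sub_eq_zero.1 h

end FourthMoment

/-! ### Construction of u ⊗ ū -/

section TensorSquare

variable {V : Type} [NormedAddCommGroup V] [InnerProductSpace ℝ V] [FiniteDimensional ℝ V]
  [MeasurableSpace V] [BorelSpace V]
  {Ω : Type*} [MeasurableSpace Ω] {P : Measure Ω} [IsProbabilityMeasure P] {u : TemperedGSP V P}

/-- The product `u(f̄) conj u(h)` as a bilinear map into `L²(Ω)`. -/
noncomputable def gspProd (hG : IsGaussianGSP u) : 𝓢(V, ℂ) →ₗ[ℂ] 𝓢(V, ℂ) →ₗ[ℂ] Lp ℂ 2 P :=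
  LinearMap.mk₂ ℂ (fun f h => (hG.memLp_mul_conj (conjS f) h).toLp)
    (fun f f' h => by
      rw [← MemLp.toLp_add, MemLp.toLp_eq_toLp_iff, map_add, map_add]
      filter_upwards [Lp.coeFn_add (u (conjS f)) (u (conjS f'))] with ω hω
      rw [hω]
      simp only [Pi.add_apply, add_mul])
    (fun c f h => by
      rw [← MemLp.toLp_const_smul, MemLp.toLp_eq_toLp_iff, map_smulₛₗ, map_smulₛₗ,
        Complex.conj_conj]
      filter_upwards [Lp.coeFn_smul c (u (conjS f))] with ω hω
      rw [hω]
      simp only [Pi.smul_apply, smul_eq_mul, mul_assoc])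
    (fun f h h' => by
      rw [← MemLp.toLp_add, MemLp.toLp_eq_toLp_iff, map_add]
      filter_upwards [Lp.coeFn_add (u h) (u h')] with ω hω
      rw [hω]
      simp only [Pi.add_apply, mul_add, map_add])
    (fun c f h => by
      rw [← MemLp.toLp_const_smul, MemLp.toLp_eq_toLp_iff, map_smulₛₗ]
      filter_upwards [Lp.coeFn_smul (conj c) (u h)] with ω hω
      rw [hω]
      simp only [Pi.smul_apply, smul_eq_mul, map_mul, Complex.conj_conj]
      ring)

/-- The mixed fourth moment and Cauchy-Schwarz give the constant √2; 2 is enough. This is the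
product bound that the kernel theorem requires. -/
lemma norm_gspProd_le (hG : IsGaussianGSP u) (hS : IsSymmetricGSP u) (f h : 𝓢(V, ℂ)) :
    ‖gspProd hG f h‖ ≤ (2 * ‖u (conjS f)‖) * ‖u h‖ := by
  have h1 : ‖gspProd hG f h‖ ^ 2 = ‖u (conjS f)‖ ^ 2 * ‖u h‖ ^ 2 + ‖covForm u (conjS f) h‖ ^ 2 := by
    rw [norm_sq_eq_integral, ← integral_norm_sq_mul_norm_sq hG hS]
    refine integral_congr_ae ?_
    filter_upwards [(hG.memLp_mul_conj (conjS f) h).coeFn_toLp] with ω hω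
    have : gspProd hG f h ω = _ := hω
    rw [this, norm_mul, RCLike.norm_conj, mul_pow]
  have h2 : ‖covForm u (conjS f) h‖ ≤ ‖u h‖ * ‖u (conjS f)‖ := norm_inner_le_norm _ _
  refine le_of_sq_le_sq ?_ (by positivity)
  rw [h1]
  nlinarith [norm_nonneg (covForm u (conjS f) h), mul_nonneg (norm_nonneg (u h))
    (norm_nonneg (u (conjS f)))]

theorem existsUnique_tensorSquare (hG : IsGaussianGSP u) (hS : IsSymmetricGSP u) :
    ∃! U, IsTensorSquare u U := by
  let L : 𝓢(V, ℂ) →L[ℂ] Lp ℂ 2 P := (2 : ℂ) • (u ∘SL (conjS : 𝓢(V, ℂ) →L⋆[ℂ] 𝓢(V, ℂ)))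
  have hL (f : 𝓢(V, ℂ)) : ‖L f‖ = 2 * ‖u (conjS f)‖ := by
    change ‖(2 : ℂ) • u (conjS f)‖ = _
    rw [norm_smul, Complex.norm_ofNat]
  obtain ⟨T, hT⟩ := exists_kernel (gspProd hG) (p := (normSeminorm ℂ _).comp L.toLinearMap)
    (q := (normSeminorm ℂ _).comp u.toLinearMap)
    (continuous_norm.comp L.continuous) (continuous_norm.comp u.continuous)
    (fun f h => (norm_gspProd_le hG hS f h).trans_eq (by rw [← hL]; rfl))
  let U : TemperedGSP (Phase V) P := T ∘SL (conjS : 𝓢(Phase V, ℂ) →L⋆[ℂ] 𝓢(Phase V, ℂ))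
  have hU (φ ψ : 𝓢(V, ℂ)) : U (tensorS φ (conjS ψ)) = gspProd hG (conjS φ) ψ := by
    change T (conjS (tensorS φ (conjS ψ))) = _
    rw [conjS_tensorS, conjS_conjS, hT]
  have hU' : IsTensorSquare u U := fun φ ψ => by
    rw [hU]
    have h : gspProd hG (conjS φ) ψ =ᵐ[P] fun ω => u (conjS (conjS φ)) ω * conj (u ψ ω) :=
      (hG.memLp_mul_conj (conjS (conjS φ)) ψ).coeFn_toLp
    rwa [conjS_conjS] at h
  refine ⟨U, hU', fun U' h => ?_⟩
  have hT' : U' ∘SL (conjS : 𝓢(Phase V, ℂ) →L⋆[ℂ] 𝓢(Phase V, ℂ)) = T := by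
    refine ext_tensor fun f g => ?_
    have h1 := (h (conjS f) g).trans (hU' (conjS f) g).symm
    rw [← Lp.ext_iff, hU, conjS_conjS] at h1
    change U' (conjS (tensorS f g)) = _
    rw [conjS_tensorS, h1, hT]
  ext1 Φ
  have h2 := DFunLike.congr_fun hT' (conjS Φ)
  change U' (conjS (conjS Φ)) = _ at h2
  rw [conjS_conjS] at h2
  exact h2

end TensorSquare

/-! ### Linear maps of determinant `±1` -/

lemma abs_det_eq_one_of_pow_eq_one {W : Type*} [AddCommGroup W] [Module ℝ W] {A : W →ₗ[ℝ] W}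
    {n : ℕ} (hn : n ≠ 0) (h : A ^ n = 1) : |LinearMap.det A| = 1 := by
  have h1 : |LinearMap.det A| ^ n = 1 := by
    rw [← abs_pow, ← map_pow, h, map_one, abs_one]
  exact (pow_eq_one_iff_of_nonneg (abs_nonneg _) hn).1 h1

section
variable {V : Type} [NormedAddCommGroup V] [InnerProductSpace ℝ V]

/-- κ is a product of three involutions, each with determinant of modulus one, so no basis is
needed. -/
lemma abs_det_kappa : |LinearMap.det ((kappa : Phase V ≃L[ℝ] Phase V) : Phase V →ₗ[ℝ] Phase V)| =
    1 := by
  let T₁ : Phase V →ₗ[ℝ] Phase V :=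
    { toFun := fun z => WithLp.toLp 2 (z.fst, -z.snd)
      map_add' := fun z w => by refine ext_phase ?_ ?_ <;> simp; module
      map_smul' := fun c z => by refine ext_phase ?_ ?_ <;> simp }
  let T₂ : Phase V →ₗ[ℝ] Phase V :=
    { toFun := fun z => WithLp.toLp 2 (z.fst - (1 / 2 : ℝ) • z.snd, -z.snd)
      map_add' := fun z w => by refine ext_phase ?_ ?_ <;> simp <;> module
      map_smul' := fun c z => by refine ext_phase ?_ ?_ <;> simp; module }
  let T₃ : Phase V →ₗ[ℝ] Phase V :=
    { toFun := fun z => WithLp.toLp 2 (z.fst, z.fst - z.snd)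
      map_add' := fun z w => by refine ext_phase ?_ ?_ <;> simp; module
      map_smul' := fun c z => by refine ext_phase ?_ ?_ <;> simp; module }
  have h₁ : T₁ ^ 2 = 1 := by
    ext1 z
    rw [sq]
    refine ext_phase ?_ ?_ <;> simp [T₁]
  have h₂ : T₂ ^ 2 = 1 := by
    ext1 z
    rw [sq]
    refine ext_phase ?_ ?_ <;> simp [T₂]
  have h₃ : T₃ ^ 2 = 1 := by
    ext1 z
    rw [sq]
    refine ext_phase ?_ ?_ <;> simp [T₃]
  have h : ((kappa : Phase V ≃L[ℝ] Phase V) : Phase V →ₗ[ℝ] Phase V) = T₃ * T₂ * T₁ := by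
    ext1 z
    refine ext_phase ?_ ?_
    · change z.fst + (1 / 2 : ℝ) • z.snd = z.fst - (1 / 2 : ℝ) • -z.snd
      module
    · change z.fst - (1 / 2 : ℝ) • z.snd = z.fst - (1 / 2 : ℝ) • -z.snd - - -z.snd
      module
  rw [h, map_mul, map_mul, abs_mul, abs_mul, abs_det_eq_one_of_pow_eq_one two_ne_zero h₁,
    abs_det_eq_one_of_pow_eq_one two_ne_zero h₂, abs_det_eq_one_of_pow_eq_one two_ne_zero h₃]
  norm_num

/-- -J has fourth power the identity, hence so does the block map. -/
lemma abs_det_idBlock_negEquiv_symplJ :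
    |LinearMap.det ((idBlock (negEquiv (symplJ : Phase V ≃L[ℝ] Phase V)) :
      Phase (Phase V) ≃L[ℝ] Phase (Phase V)) : Phase (Phase V) →ₗ[ℝ] Phase (Phase V))| = 1 := by
  refine abs_det_eq_one_of_pow_eq_one four_ne_zero ?_
  ext1 z
  refine ext_phase rfl (ext_phase ?_ ?_)
  · change - - - - - -z.snd.fst = z.snd.fst
    simp
  · change - - - - - -z.snd.snd = z.snd.snd
    simp

lemma kappa_idBlock_negEquiv_symplJ (x₁ x₂ ξ₁ ξ₂ : V) :
    kappa (idBlock (negEquiv symplJ)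
      (WithLp.toLp 2 (WithLp.toLp 2 (x₁, x₂), WithLp.toLp 2 (ξ₁, ξ₂)))) =
    WithLp.toLp 2 (WithLp.toLp 2 (x₁ - (1 / 2 : ℝ) • ξ₂, x₂ + (1 / 2 : ℝ) • ξ₁),
      WithLp.toLp 2 (x₁ + (1 / 2 : ℝ) • ξ₂, x₂ - (1 / 2 : ℝ) • ξ₁)) := by
  refine ext_phase (ext_phase ?_ ?_) (ext_phase ?_ ?_)
  · change x₁ + (1 / 2 : ℝ) • -ξ₂ = x₁ - (1 / 2 : ℝ) • ξ₂
    module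
  · change x₂ + (1 / 2 : ℝ) • - -ξ₁ = x₂ + (1 / 2 : ℝ) • ξ₁
    module
  · change x₁ - (1 / 2 : ℝ) • -ξ₂ = x₁ + (1 / 2 : ℝ) • ξ₂
    module
  · change x₂ - (1 / 2 : ℝ) • - -ξ₁ = x₂ - (1 / 2 : ℝ) • ξ₁
    module

end

section
variable {V : Type} [NormedAddCommGroup V] [InnerProductSpace ℝ V] [FiniteDimensional ℝ V]
  [MeasurableSpace V] [BorelSpace V]

lemma measurePreserving_kappa : MeasurePreserving (kappa : Phase V ≃L[ℝ] Phase V) := by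
  refine ⟨kappa.continuous.measurable, ?_⟩
  have h1 := abs_det_kappa (V := V)
  have h0 : LinearMap.det ((kappa : Phase V ≃L[ℝ] Phase V) : Phase V →ₗ[ℝ] Phase V) ≠ 0 := by
    intro h
    rw [h, abs_zero] at h1
    exact zero_ne_one h1
  have h2 := Measure.map_linearMap_addHaar_eq_smul_addHaar (volume : Measure (Phase V)) h0
  rw [abs_inv, h1, inv_one, ENNReal.ofReal_one, one_smul] at h2
  exact h2

lemma integral_comp_kappa (F : Phase V → ℂ) : ∫ z, F (kappa z) = ∫ z, F z :=
  measurePreserving_kappa.integral_comp kappa.toHomeomorph.measurableEmbedding F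

/-! ### The Wigner distribution of Fourier transforms -/

lemma fourier_modulate (ξ : V) (f : 𝓢(V, ℂ)) (η : V) : 𝓕 (modulate ξ f) η = 𝓕 f (η - ξ) := by
  rw [modulate, FourierTransform.fourier_fourierInv_eq, coe_translate]

lemma fourier_translate_neg (a : V) (f : 𝓢(V, ℂ)) (η : V) :
    𝓕 (translate a (compCLMOfContinuousLinearEquiv ℂ (ContinuousLinearEquiv.neg ℝ) f)) η =
      Complex.exp (((2 * π * inner ℝ (-a) η : ℝ) : ℂ) * Complex.I) * 𝓕 f (-η) := by
  rw [SchwartzMap.fourier_coe, SchwartzMap.fourier_coe, Real.fourier_eq', Real.fourier_eq',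
    ← integral_const_mul, ← integral_sub_left_eq_self _ _ a]
  congr 1
  ext t
  rw [coe_translate]
  beta_reduce
  have h : (compCLMOfContinuousLinearEquiv ℂ (ContinuousLinearEquiv.neg ℝ) f) (a - t - a) = f t := by
    change f (-(a - t - a)) = f t
    congr 1
    abel
  rw [h, smul_eq_mul, smul_eq_mul, ← mul_assoc, ← Complex.exp_add]
  congr 2
  rw [inner_sub_left, inner_neg_left, inner_neg_right]
  push_cast
  ring

lemma integral_comp_add_half_smul (Q : V → ℂ) (a : V) :
    ∫ x, Q (a + (1 / 2 : ℝ) • x) = |(((1 / 2 : ℝ) ^ Module.finrank ℝ V)⁻¹)| • ∫ x, Q x := by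
  rw [Measure.integral_comp_smul volume (fun x => Q (a + x)), integral_add_left_eq_self]

/-- The Wigner distribution of Fourier transforms is a rotated Wigner distribution. -/
lemma integral_fourier_mul_conj_fourier (h k : 𝓢(V, ℂ)) (α δ : V) :
    ∫ ω, Complex.exp (((2 * π * inner ℝ ω δ : ℝ) : ℂ) * Complex.I) *
        (𝓕 h (α + (1 / 2 : ℝ) • ω) * conj (𝓕 k (α - (1 / 2 : ℝ) • ω))) =
      ∫ s, Complex.exp (-((2 * π * inner ℝ s α : ℝ) : ℂ) * Complex.I) *
        (h (δ + (1 / 2 : ℝ) • s) * conj (k (δ - (1 / 2 : ℝ) • s))) := by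
  -- k'(s) = e^{2πi⟨2α, s⟩} k(2δ - s) is a phase space reflection of k. It turns both Wigner
  -- integrals into plain L² pairings with h, resp. its Fourier transform, with the same phase `E`
  -- and the same Jacobian.
  set k' := modulate ((2 : ℝ) • α) (translate ((2 : ℝ) • δ)
    (compCLMOfContinuousLinearEquiv ℂ (ContinuousLinearEquiv.neg ℝ) k))
  have hk' (s : V) : k' s = Complex.exp (((2 * π * inner ℝ ((2 : ℝ) • α) s : ℝ) : ℂ) * Complex.I) *
      k ((2 : ℝ) • δ - s) := by
    rw [modulate_apply, coe_translate]
    congr 1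
    change k (-(s - (2 : ℝ) • δ)) = _
    rw [neg_sub]
  have hFk' (ω : V) : 𝓕 k' ω = Complex.exp (((2 * π * inner ℝ (-((2 : ℝ) • δ))
      (ω - (2 : ℝ) • α) : ℝ) : ℂ) * Complex.I) * 𝓕 k ((2 : ℝ) • α - ω) := by
    rw [fourier_modulate, fourier_translate_neg, neg_sub]
  have hconj (r : ℝ) : conj (Complex.exp ((r : ℂ) * Complex.I)) =
      Complex.exp (((-r : ℝ) : ℂ) * Complex.I) := by
    rw [← Complex.exp_conj, map_mul, Complex.conj_I, Complex.conj_ofReal]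
    push_cast
    ring_nf
  set E := Complex.exp (((4 * π * inner ℝ δ α : ℝ) : ℂ) * Complex.I)
  have hL (ω : V) : Complex.exp (((2 * π * inner ℝ ω δ : ℝ) : ℂ) * Complex.I) *
      (𝓕 h (α + (1 / 2 : ℝ) • ω) * conj (𝓕 k (α - (1 / 2 : ℝ) • ω))) =
      E * (𝓕 h (α + (1 / 2 : ℝ) • ω) * conj (𝓕 k' (α + (1 / 2 : ℝ) • ω))) := by
    rw [hFk', map_mul, hconj]
    have e1 : (2 : ℝ) • α - (α + (1 / 2 : ℝ) • ω) = α - (1 / 2 : ℝ) • ω := by module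
    rw [e1, mul_left_comm _ (Complex.exp _), ← mul_assoc E, ← Complex.exp_add]
    congr 2
    rw [← add_mul, ← Complex.ofReal_add]
    congr 2
    simp only [inner_neg_left, inner_sub_right, inner_add_right, inner_smul_left, inner_smul_right,
      real_inner_comm δ ω, conj_trivial]
    ring
  have hR (s : V) : Complex.exp (-((2 * π * inner ℝ s α : ℝ) : ℂ) * Complex.I) *
      (h (δ + (1 / 2 : ℝ) • s) * conj (k (δ - (1 / 2 : ℝ) • s))) =
      E * (h (δ + (1 / 2 : ℝ) • s) * conj (k' (δ + (1 / 2 : ℝ) • s))) := by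
    rw [hk', map_mul, hconj]
    have e1 : (2 : ℝ) • δ - (δ + (1 / 2 : ℝ) • s) = δ - (1 / 2 : ℝ) • s := by module
    rw [e1, mul_left_comm _ (Complex.exp _), ← mul_assoc E, ← Complex.exp_add]
    congr 2
    rw [← add_mul, ← Complex.ofReal_add, ← Complex.ofReal_neg]
    congr 2
    simp only [inner_add_right, inner_smul_left, inner_smul_right,
      real_inner_comm δ α, real_inner_comm s α, conj_trivial]
    ring
  simp only [hL, hR]
  rw [integral_const_mul, integral_const_mul,
    integral_comp_add_half_smul (fun ω => 𝓕 h ω * conj (𝓕 k' ω)),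
    integral_comp_add_half_smul (fun s => h s * conj (k' s))]
  -- Plancherel's theorem identifies the two remaining pairings.
  have hP := integral_inner_fourier_fourier k' h
  simp only [RCLike.inner_apply] at hP
  rw [hP]

end

/-! ### The Wigner distribution of Wigner distributions -/

section
variable {V : Type} [NormedAddCommGroup V] [InnerProductSpace ℝ V] [FiniteDimensional ℝ V]
  [MeasurableSpace V] [BorelSpace V]

lemma integral_phase_iterated {F : Phase V → ℂ} (hF : Integrable F) :
    ∫ z, F z = ∫ x, ∫ y, F (WithLp.toLp 2 (x, y)) := by
  rw [integral_phase]
  refine integral_prod (fun p => F (WithLp.toLp 2 p)) ?_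
  exact ((WithLp.volume_preserving_toLp (U := V) (V := V)).integrable_comp_emb
    (MeasurableEquiv.toLp 2 (V × V)).measurableEmbedding).2 hF

lemma integrable_phase_mul {f g : V → ℂ} (hf : Integrable f) (hg : Integrable g) :
    Integrable (fun z : Phase V => f z.fst * g z.snd) :=
  ((WithLp.volume_preserving_toLp (U := V) (V := V)).integrable_comp_emb
    (MeasurableEquiv.toLp 2 (V × V)).measurableEmbedding).1 (hf.mul_prod hg)

lemma fourier₂_apply_eq_fourier (Φ : 𝓢(Phase V, ℂ)) (z : Phase V) :
    fourier₂ Φ z = normConst V * 𝓕 (slice Φ z.fst) ((2 * π)⁻¹ • z.snd) := by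
  change normConst V • oscInt 1 Φ z = _
  rw [oscInt_eq_fourier, one_div, smul_eq_mul]

lemma conj_normConst : conj (normConst V) = normConst V := Complex.conj_ofReal _

lemma normConst_sq_mul : normConst V * normConst V * ((2 * π) ^ Module.finrank ℝ V : ℝ) = 1 := by
  rw [normConst_mul_self, ← Complex.ofReal_mul, inv_mul_cancel₀ (by positivity), Complex.ofReal_one]

/-- The same rotation with kernel e^{-i⟨y, ξ⟩} in place of e^{-2πi⟨y, ξ⟩}; the rescaling ω ↦ 2πω
produces the factor (2π)ᵈ. -/
lemma integral_fourier_mul_conj_fourier_smul (h k : 𝓢(V, ℂ)) (α δ : V) :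
    ∫ ω, Complex.exp ((inner ℝ ω δ : ℝ) * Complex.I) *
        (𝓕 h ((2 * π)⁻¹ • (α + (1 / 2 : ℝ) • ω)) *
          conj (𝓕 k ((2 * π)⁻¹ • (α - (1 / 2 : ℝ) • ω)))) =
      ((2 * π) ^ Module.finrank ℝ V : ℝ) *
      ∫ s, Complex.exp (-(inner ℝ s α : ℝ) * Complex.I) *
        (h (δ + (1 / 2 : ℝ) • s) * conj (k (δ - (1 / 2 : ℝ) • s))) := by
  have h1 := Measure.integral_comp_smul_of_nonneg (volume : Measure V)
    (fun ω => Complex.exp ((inner ℝ ω δ : ℝ) * Complex.I) *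
        (𝓕 h ((2 * π)⁻¹ • (α + (1 / 2 : ℝ) • ω)) *
          conj (𝓕 k ((2 * π)⁻¹ • (α - (1 / 2 : ℝ) • ω))))) (2 * π) (hR := by positivity)
  have h2 := integral_fourier_mul_conj_fourier h k ((2 * π)⁻¹ • α) δ
  have h0 : (2 * π)⁻¹ * (2 * π) = 1 := inv_mul_cancel₀ (by positivity)
  have h3 (ω : V) : (2 * π)⁻¹ • (α + (1 / 2 : ℝ) • (2 * π) • ω) =
      (2 * π)⁻¹ • α + (1 / 2 : ℝ) • ω := by
    rw [smul_add, smul_comm (1 / 2 : ℝ), smul_smul _ (2 * π), h0, one_smul]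
  have h4 (ω : V) : (2 * π)⁻¹ • (α - (1 / 2 : ℝ) • (2 * π) • ω) =
      (2 * π)⁻¹ • α - (1 / 2 : ℝ) • ω := by
    rw [smul_sub, smul_comm (1 / 2 : ℝ), smul_smul _ (2 * π), h0, one_smul]
  have h5 (ω : V) : 2 * π * inner ℝ ω ((2 * π)⁻¹ • α) = inner ℝ ω α := by
    rw [inner_smul_right, ← mul_assoc, mul_comm (2 * π), h0, one_mul]
  simp only [h3, h4, real_inner_smul_left] at h1
  simp only [h5] at h2
  rw [h2] at h1
  rw [h1, Complex.real_smul, ← mul_assoc, ← Complex.ofReal_mul, mul_inv_cancel₀ (by positivity),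
    Complex.ofReal_one, one_mul]

lemma integrable_wigner_integrand (f g : 𝓢(V, ℂ)) (x ξ : V) :
    Integrable (fun y : V => Complex.exp (-(inner ℝ y ξ : ℝ) * Complex.I) *
      (f (x + (1 / 2 : ℝ) • y) * conj (g (x - (1 / 2 : ℝ) • y)))) := by
  have h := integrand_integrable 1 (compCLMOfContinuousLinearEquiv ℂ kappa (tensorS f (conjS g)))
    (WithLp.toLp 2 (x, ξ))
  simp only [one_mul] at h
  exact h

/-- The outer Wigner integral runs over (w, ω). Its ω part is a Wigner integral of Fourier
transforms, which rotates into an integral over a position variable s. All four functions then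
appear unconjugated by Fourier transforms, and the variables p = w + s/2, q = -(w - s/2) separate
the pair φ₁, φ₂ from the pair ψ₁, ψ₂. -/
theorem crossWigner_crossWigner (φ₁ ψ₁ φ₂ ψ₂ : 𝓢(V, ℂ)) (X Y : Phase V) :
    crossWigner (crossWigner φ₁ ψ₁) (crossWigner φ₂ ψ₂)
      (WithLp.toLp 2 ((1 / 2 : ℝ) • X + (1 / 2 : ℝ) • Y, symplJ (X - Y))) =
    crossWigner φ₁ φ₂ X * crossWigner ψ₂ ψ₁ Y := by
  set x := X.fst
  set ξ := X.snd
  set y := Y.fst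
  set η := Y.snd
  have hX : X = WithLp.toLp 2 (x, ξ) := rfl
  have hY : Y = WithLp.toLp 2 (y, η) := rfl
  set a := (1 / 2 : ℝ) • x + (1 / 2 : ℝ) • y
  set α := (1 / 2 : ℝ) • ξ + (1 / 2 : ℝ) • η
  set δ := x - y
  set g := compCLMOfContinuousLinearEquiv ℂ kappa (tensorS φ₁ (conjS ψ₁))
  set f := compCLMOfContinuousLinearEquiv ℂ kappa (tensorS φ₂ (conjS ψ₂))
  set c := normConst V
  have hint := integrable_wigner_integrand (crossWigner φ₁ ψ₁) (crossWigner φ₂ ψ₂)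
    ((1 / 2 : ℝ) • X + (1 / 2 : ℝ) • Y) (symplJ (X - Y))
  set N : ℂ := (((2 * π) ^ Module.finrank ℝ V : ℝ) : ℂ)
  have hN : c * c * N = 1 := normConst_sq_mul
  let f₁ (p : V) : ℂ := Complex.exp (-(inner ℝ p ξ : ℝ) * Complex.I) *
      (φ₁ (x + (1 / 2 : ℝ) • p) * conj (φ₂ (x - (1 / 2 : ℝ) • p)))
  let f₂ (q : V) : ℂ := Complex.exp (-(inner ℝ q η : ℝ) * Complex.I) *
      (ψ₂ (y + (1 / 2 : ℝ) • q) * conj (ψ₁ (y - (1 / 2 : ℝ) • q)))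
  have hf₁ : Integrable f₁ := integrable_wigner_integrand _ _ _ _
  have hf₂ : Integrable f₂ := integrable_wigner_integrand _ _ _ _
  have hinner (w : V) : ∫ ω, Complex.exp (-(inner ℝ (WithLp.toLp 2 (w, ω) : Phase V)
        (symplJ (X - Y)) : ℝ) * Complex.I) *
      (crossWigner φ₁ ψ₁ ((1 / 2 : ℝ) • X + (1 / 2 : ℝ) • Y + (1 / 2 : ℝ) • WithLp.toLp 2 (w, ω)) *
        conj (crossWigner φ₂ ψ₂
          ((1 / 2 : ℝ) • X + (1 / 2 : ℝ) • Y - (1 / 2 : ℝ) • WithLp.toLp 2 (w, ω)))) =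
      ∫ s, f₁ (w + (1 / 2 : ℝ) • s) * f₂ (-(w - (1 / 2 : ℝ) • s)) := by
    have h1 (ω : V) : Complex.exp (-(inner ℝ (WithLp.toLp 2 (w, ω) : Phase V)
          (symplJ (X - Y)) : ℝ) * Complex.I) *
        (crossWigner φ₁ ψ₁ ((1 / 2 : ℝ) • X + (1 / 2 : ℝ) • Y +
          (1 / 2 : ℝ) • WithLp.toLp 2 (w, ω)) * conj (crossWigner φ₂ ψ₂
          ((1 / 2 : ℝ) • X + (1 / 2 : ℝ) • Y - (1 / 2 : ℝ) • WithLp.toLp 2 (w, ω)))) =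
        (c * c * Complex.exp (-(inner ℝ w (ξ - η) : ℝ) * Complex.I)) *
        (Complex.exp ((inner ℝ ω δ : ℝ) * Complex.I) *
          (𝓕 (slice g (a + (1 / 2 : ℝ) • w)) ((2 * π)⁻¹ • (α + (1 / 2 : ℝ) • ω)) *
            conj (𝓕 (slice f (a - (1 / 2 : ℝ) • w)) ((2 * π)⁻¹ • (α - (1 / 2 : ℝ) • ω))))) := by
      have e1 : inner ℝ (WithLp.toLp 2 (w, ω) : Phase V) (symplJ (X - Y)) =
          inner ℝ w (ξ - η) - inner ℝ ω δ := by
        rw [WithLp.prod_inner_apply]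
        change inner ℝ w (ξ - η) + inner ℝ ω (-(x - y)) = _
        rw [inner_neg_right, ← sub_eq_add_neg]
      have e2 : crossWigner φ₁ ψ₁ ((1 / 2 : ℝ) • X + (1 / 2 : ℝ) • Y +
          (1 / 2 : ℝ) • WithLp.toLp 2 (w, ω)) =
          c * 𝓕 (slice g (a + (1 / 2 : ℝ) • w)) ((2 * π)⁻¹ • (α + (1 / 2 : ℝ) • ω)) :=
        fourier₂_apply_eq_fourier _ _
      have e3 : crossWigner φ₂ ψ₂ ((1 / 2 : ℝ) • X + (1 / 2 : ℝ) • Y -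
          (1 / 2 : ℝ) • WithLp.toLp 2 (w, ω)) =
          c * 𝓕 (slice f (a - (1 / 2 : ℝ) • w)) ((2 * π)⁻¹ • (α - (1 / 2 : ℝ) • ω)) :=
        fourier₂_apply_eq_fourier _ _
      have e4 : Complex.exp (-((inner ℝ w (ξ - η) - inner ℝ ω δ : ℝ) : ℂ) * Complex.I) =
          Complex.exp (-(inner ℝ w (ξ - η) : ℝ) * Complex.I) *
            Complex.exp ((inner ℝ ω δ : ℝ) * Complex.I) := by
        rw [← Complex.exp_add]
        congr 1
        push_cast
        ring
      rw [e1, e2, e3, e4, map_mul, conj_normConst]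
      ring
    simp only [h1]
    rw [integral_const_mul, integral_fourier_mul_conj_fourier_smul, ← integral_const_mul,
      ← integral_const_mul]
    congr 1
    ext s
    have k1 : slice g (a + (1 / 2 : ℝ) • w) (δ + (1 / 2 : ℝ) • s) =
        φ₁ (x + (1 / 2 : ℝ) • (w + (1 / 2 : ℝ) • s)) *
          conj (ψ₁ (y - (1 / 2 : ℝ) • -(w - (1 / 2 : ℝ) • s))) := by
      change φ₁ (a + (1 / 2 : ℝ) • w + (1 / 2 : ℝ) • (δ + (1 / 2 : ℝ) • s)) *
        conj (ψ₁ (a + (1 / 2 : ℝ) • w - (1 / 2 : ℝ) • (δ + (1 / 2 : ℝ) • s))) = _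
      have q1 : a + (1 / 2 : ℝ) • w + (1 / 2 : ℝ) • (δ + (1 / 2 : ℝ) • s) =
          x + (1 / 2 : ℝ) • (w + (1 / 2 : ℝ) • s) := by simp only [a, δ]; module
      have q2 : a + (1 / 2 : ℝ) • w - (1 / 2 : ℝ) • (δ + (1 / 2 : ℝ) • s) =
          y - (1 / 2 : ℝ) • -(w - (1 / 2 : ℝ) • s) := by simp only [a, δ]; module
      rw [q1, q2]
    have k2 : slice f (a - (1 / 2 : ℝ) • w) (δ - (1 / 2 : ℝ) • s) =
        φ₂ (x - (1 / 2 : ℝ) • (w + (1 / 2 : ℝ) • s)) *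
          conj (ψ₂ (y + (1 / 2 : ℝ) • -(w - (1 / 2 : ℝ) • s))) := by
      change φ₂ (a - (1 / 2 : ℝ) • w + (1 / 2 : ℝ) • (δ - (1 / 2 : ℝ) • s)) *
        conj (ψ₂ (a - (1 / 2 : ℝ) • w - (1 / 2 : ℝ) • (δ - (1 / 2 : ℝ) • s))) = _
      have q1 : a - (1 / 2 : ℝ) • w + (1 / 2 : ℝ) • (δ - (1 / 2 : ℝ) • s) =
          x - (1 / 2 : ℝ) • (w + (1 / 2 : ℝ) • s) := by simp only [a, δ]; module
      have q2 : a - (1 / 2 : ℝ) • w - (1 / 2 : ℝ) • (δ - (1 / 2 : ℝ) • s) =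
          y + (1 / 2 : ℝ) • -(w - (1 / 2 : ℝ) • s) := by simp only [a, δ]; module
      rw [q1, q2]
    have k3 : Complex.exp (-(inner ℝ w (ξ - η) : ℝ) * Complex.I) *
        Complex.exp (-(inner ℝ s α : ℝ) * Complex.I) =
        Complex.exp (-(inner ℝ (w + (1 / 2 : ℝ) • s) ξ : ℝ) * Complex.I) *
        Complex.exp (-(inner ℝ (-(w - (1 / 2 : ℝ) • s)) η : ℝ) * Complex.I) := by
      rw [← Complex.exp_add, ← Complex.exp_add]
      congr 1
      simp only [α, inner_sub_right, inner_add_right, inner_smul_right, inner_add_left,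
        inner_neg_left, inner_sub_left, real_inner_smul_left]
      push_cast
      ring
    rw [k1, k2]
    simp only [f₁, f₂, map_mul, Complex.conj_conj]
    -- `hN` cancels the two normalizing constants against (2π)ᵈ, and `k3` splits the phase into a
    -- part in p and a part in q.
    linear_combination (Complex.exp (-(inner ℝ w (ξ - η) : ℝ) * Complex.I) *
        Complex.exp (-(inner ℝ s α : ℝ) * Complex.I) *
        (φ₁ (x + (1 / 2 : ℝ) • (w + (1 / 2 : ℝ) • s)) *
          conj (ψ₁ (y - (1 / 2 : ℝ) • -(w - (1 / 2 : ℝ) • s))) *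
          (conj (φ₂ (x - (1 / 2 : ℝ) • (w + (1 / 2 : ℝ) • s))) *
          ψ₂ (y + (1 / 2 : ℝ) • -(w - (1 / 2 : ℝ) • s))))) * hN +
      (φ₁ (x + (1 / 2 : ℝ) • (w + (1 / 2 : ℝ) • s)) *
          conj (ψ₁ (y - (1 / 2 : ℝ) • -(w - (1 / 2 : ℝ) • s))) *
          (conj (φ₂ (x - (1 / 2 : ℝ) • (w + (1 / 2 : ℝ) • s))) *
          ψ₂ (y + (1 / 2 : ℝ) • -(w - (1 / 2 : ℝ) • s)))) * k3
  -- The change of variables (w, s) ↦ (p, -q) is κ itself, which preserves Lebesgue measure.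
  have hH : Integrable (fun z : Phase V => f₁ z.fst * f₂ (-z.snd)) :=
    integrable_phase_mul (g := fun q => f₂ (-q)) hf₁ hf₂.comp_neg
  have hHκ : Integrable (fun z : Phase V => f₁ (kappa z).fst * f₂ (-(kappa z).snd)) :=
    (measurePreserving_kappa.integrable_comp_emb kappa.toHomeomorph.measurableEmbedding).2 hH
  rw [crossWigner_apply, integral_phase_iterated hint]
  simp only [hinner]
  have h2 := integral_phase_iterated hHκ
  rw [integral_comp_kappa (fun z : Phase V => f₁ z.fst * f₂ (-z.snd)),
    integral_phase_mul f₁ (fun q => f₂ (-q)), integral_neg_eq_self f₂] at h2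
  have h3 : ∫ w, ∫ s, f₁ (w + (1 / 2 : ℝ) • s) * f₂ (-(w - (1 / 2 : ℝ) • s)) =
    (∫ p, f₁ p) * ∫ q, f₂ q := h2.symm
  rw [h3, hX, hY, crossWigner_apply, crossWigner_apply, normConst_phase]
  ring

end

/-! ### The Weyl symbol of the zero mean Wigner distribution -/

section
variable {V : Type} [NormedAddCommGroup V] [InnerProductSpace ℝ V] [FiniteDimensional ℝ V]
  [MeasurableSpace V] [BorelSpace V]

lemma conjS_crossWigner (g f : 𝓢(V, ℂ)) : conjS (crossWigner g f) = crossWigner f g := by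
  ext z
  change conj (crossWigner g f (WithLp.toLp 2 (z.fst, z.snd))) =
    crossWigner f g (WithLp.toLp 2 (z.fst, z.snd))
  rw [crossWigner_apply, crossWigner_apply, map_mul, conj_normConst, ← integral_conj,
    ← integral_neg_eq_self]
  congr 2
  ext y
  rw [map_mul, map_mul, Complex.conj_conj, ← Complex.exp_conj, map_mul, Complex.conj_I, map_neg,
    Complex.conj_ofReal, inner_neg_left, smul_neg, sub_neg_eq_add, ← sub_eq_add_neg,
    mul_comm (conj (g _))]
  push_cast
  congr 2
  ring

lemma ext_clm_crossWigner {H : Type*} [NormedAddCommGroup H] [NormedSpace ℂ H] [CompleteSpace H]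
    {S T : 𝓢(Phase V, ℂ) →L[ℂ] H} (h : ∀ φ ψ, S (crossWigner φ ψ) = T (crossWigner φ ψ)) :
    S = T := by
  have h1 : S ∘L wigner = T ∘L wigner := ext_tensor fun a b => by
    have h2 := h a (conjS b)
    rw [crossWigner_eq_wigner, conjS_conjS] at h2
    exact h2
  ext1 Φ
  have h2 := DFunLike.congr_fun h1 (wignerInv Φ)
  change S (wigner (wignerInv Φ)) = T (wigner (wignerInv Φ)) at h2
  rwa [wigner_wignerInv] at h2

/-- Density of Wigner distributions is used three times: for the outer Wigner distribution, and for
each of its two arguments in turn. -/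
lemma ext_crossWigner_crossWigner {σ σ' : 𝓢'(Phase (Phase V), ℂ)}
    (h : ∀ φ₁ ψ₁ φ₂ ψ₂ : 𝓢(V, ℂ),
      pair σ (crossWigner (crossWigner φ₁ ψ₁) (crossWigner φ₂ ψ₂)) =
        pair σ' (crossWigner (crossWigner φ₁ ψ₁) (crossWigner φ₂ ψ₂))) : σ = σ' := by
  have h1 (φ ψ : 𝓢(V, ℂ)) (G : 𝓢(Phase V, ℂ)) :
      pair σ (crossWigner G (crossWigner φ ψ)) = pair σ' (crossWigner G (crossWigner φ ψ)) := by
    have e := ext_clm_crossWigner (S := (toCLM σ ∘L wigner) ∘L tensorLeft (crossWigner φ ψ))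
      (T := (toCLM σ' ∘L wigner) ∘L tensorLeft (crossWigner φ ψ)) fun a b => by
        have h2 := h b a φ ψ
        rw [pair, pair, conjS_crossWigner, crossWigner_eq_wigner _ (crossWigner b a),
          conjS_crossWigner] at h2
        exact h2
    have h2 := DFunLike.congr_fun e (conjS G)
    rw [pair, pair, conjS_crossWigner]
    exact h2
  refine ext_crossWigner fun F G => ?_
  let A : 𝓢(Phase V, ℂ) →L[ℂ] 𝓢(Phase (Phase V), ℂ) :=
    (conjS ∘SL (wigner ∘L tensorLeft G)) ∘SL (conjS : 𝓢(Phase V, ℂ) →L⋆[ℂ] 𝓢(Phase V, ℂ))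
  have e := ext_clm_crossWigner (S := toCLM σ ∘L A) (T := toCLM σ' ∘L A) fun φ ψ => h1 φ ψ G
  exact DFunLike.congr_fun e F

lemma compLinear_apply {W : Type} [NormedAddCommGroup W] [InnerProductSpace ℝ W]
    (T : 𝓢'(W, ℂ)) {A : W ≃L[ℝ] W} (hA : |LinearMap.det (A : W →ₗ[ℝ] W)| = 1) (f : 𝓢(W, ℂ)) :
    compLinear T A f = T (compCLMOfContinuousLinearEquiv ℂ A.symm f) := by
  rw [compLinear, hA, inv_one, Complex.ofReal_one, one_smul]
  rfl

/-- Moving the linear maps to the test function inverts them, and (X, Y) goes to ((X + Y)/2, J(X -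
Y)), exactly the point in `crossWigner_crossWigner`. The test function becomes a tensor product, on
which `τ` factors. -/
lemma pair_compLinear_crossWigner {S : 𝓢'(Phase V, ℂ)} {τ : 𝓢'(Phase (Phase V), ℂ)}
    (hτ : IsTensorDistribution S S τ) (φ₁ ψ₁ φ₂ ψ₂ : 𝓢(V, ℂ)) :
    pair (compLinear (compLinear τ kappa) (idBlock (negEquiv symplJ)))
      (crossWigner (crossWigner φ₁ ψ₁) (crossWigner φ₂ ψ₂)) =
    pair S (crossWigner φ₁ φ₂) * pair S (crossWigner ψ₂ ψ₁) := by
  rw [pair, compLinear_apply _ abs_det_idBlock_negEquiv_symplJ,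
    compLinear_apply _ abs_det_kappa, pair, pair, ← hτ]
  congr 1
  ext Z
  have hM : (idBlock (negEquiv symplJ) : Phase (Phase V) ≃L[ℝ] Phase (Phase V)).symm
      (kappa.symm Z) =
      WithLp.toLp 2 ((1 / 2 : ℝ) • Z.fst + (1 / 2 : ℝ) • Z.snd, symplJ (Z.fst - Z.snd)) := by
    refine ext_phase rfl (ext_phase ?_ rfl)
    exact neg_neg _
  change conj (crossWigner (crossWigner φ₁ ψ₁) (crossWigner φ₂ ψ₂)
    ((idBlock (negEquiv symplJ) : Phase (Phase V) ≃L[ℝ] Phase (Phase V)).symm (kappa.symm Z))) =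
    conj (crossWigner φ₁ φ₂ Z.fst) * conj (crossWigner ψ₂ ψ₁ Z.snd)
  rw [hM, crossWigner_crossWigner, map_mul]

/-! ### Covariance of the zero mean Wigner distribution -/

variable {Ω : Type*} [MeasurableSpace Ω] {P : Measure Ω} [IsProbabilityMeasure P]

lemma isZeroMean_center (U : TemperedGSP V P) : IsZeroMean (center U) := fun φ => by
  rw [integral_congr_ae (center_apply U φ), integral_sub
    (MemLp.integrable one_le_two (Lp.memLp (U φ))) (integrable_const _)]
  simp

lemma isZeroMean_zeroMeanWigner (U : TemperedGSP (Phase V) P) : IsZeroMean (zeroMeanWigner U) :=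
  fun Φ => isZeroMean_center U (wignerInv Φ)

lemma pair_covOp_center (U : TemperedGSP V P) (ψ φ : 𝓢(V, ℂ)) :
    pair (covOp (center U) ψ) φ =
      ∫ ω, U φ ω * conj (U ψ ω) ∂P - (∫ ω, U φ ω ∂P) * conj (∫ ω, U ψ ω ∂P) := by
  have iφ : Integrable (U φ) P := MemLp.integrable one_le_two (Lp.memLp (U φ))
  have iψ : Integrable (fun ω => conj (U ψ ω)) P :=
    MemLp.integrable one_le_two (Lp.memLp (U ψ)).star
  have i₁ : Integrable (fun ω => U φ ω * conj (U ψ ω)) P :=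
    (Lp.memLp (U φ)).integrable_mul (Lp.memLp (U ψ)).star
  set x := ∫ ω, U φ ω ∂P with hx
  set y := ∫ ω, U ψ ω ∂P with hy
  have hy' : ∫ ω, conj (U ψ ω) ∂P = conj y := integral_conj
  rw [pair_covOp]
  have h : ∀ᵐ ω ∂P, center U φ ω * conj (center U ψ ω) =
      U φ ω * conj (U ψ ω) - conj y * U φ ω - (x * conj (U ψ ω) - x * conj y) := by
    filter_upwards [center_apply U φ, center_apply U ψ] with ω h₁ h₂
    rw [h₁, h₂, map_sub]
    ring
  have i₂ : Integrable (fun ω => U φ ω * conj (U ψ ω) - conj y * U φ ω) P :=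
    i₁.sub (iφ.const_mul _)
  have i₃ : Integrable (fun ω => x * conj (U ψ ω) - x * conj y) P :=
    (iψ.const_mul _).sub (integrable_const _)
  rw [integral_congr_ae h, integral_sub i₂ i₃, integral_sub i₁ (iφ.const_mul _),
    integral_sub (iψ.const_mul _) (integrable_const _), integral_const_mul, integral_const_mul, hy',
    ← hx]
  simp
  ring

lemma pair_covOp_eq_covForm (u : TemperedGSP V P) (ψ φ : 𝓢(V, ℂ)) :
    pair (covOp u ψ) φ = covForm u φ ψ := by
  rw [pair_covOp, covForm_eq_integral]

/-- Wick's formula gives K(φ₁, ψ₁) K(ψ₂, φ₂) + K(φ₁, φ₂) K(ψ₂, ψ₁), and the first term is the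
product of means subtracted by centring. -/
lemma pair_covOp_zeroMeanWigner {u : TemperedGSP V P} (hG : IsGaussianGSP u)
    (hS : IsSymmetricGSP u) {U : TemperedGSP (Phase V) P} (hU : IsTensorSquare u U)
    (φ₁ ψ₁ φ₂ ψ₂ : 𝓢(V, ℂ)) :
    pair (covOp (zeroMeanWigner U) (crossWigner φ₂ ψ₂)) (crossWigner φ₁ ψ₁) =
      covForm u φ₁ φ₂ * covForm u ψ₂ ψ₁ := by
  have hz (φ ψ : 𝓢(V, ℂ)) : zeroMeanWigner U (crossWigner φ ψ) =
      center U (tensorS φ (conjS ψ)) := by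
    change center U (wignerInv (crossWigner φ ψ)) = _
    rw [crossWigner_eq_wigner, wignerInv_wigner]
  have h1 : pair (covOp (zeroMeanWigner U) (crossWigner φ₂ ψ₂)) (crossWigner φ₁ ψ₁) =
      pair (covOp (center U) (tensorS φ₂ (conjS ψ₂))) (tensorS φ₁ (conjS ψ₁)) := by
    rw [pair_covOp, pair_covOp, hz, hz]
  have h2 (φ ψ : 𝓢(V, ℂ)) : ∫ ω, U (tensorS φ (conjS ψ)) ω ∂P = covForm u φ ψ := by
    rw [integral_congr_ae (hU φ ψ), covForm_eq_integral]
  have h3 : ∫ ω, U (tensorS φ₁ (conjS ψ₁)) ω * conj (U (tensorS φ₂ (conjS ψ₂)) ω) ∂P =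
      quarticForm u φ₁ ψ₁ ψ₂ φ₂ := by
    refine integral_congr_ae ?_
    filter_upwards [hU φ₁ ψ₁, hU φ₂ ψ₂] with ω e₁ e₂
    rw [e₁, e₂, map_mul, Complex.conj_conj, mul_comm (conj (u φ₂ ω))]
  rw [h1, pair_covOp_center, h2, h2, h3, quarticForm_eq hG hS, conj_covForm]
  ring

/-- The Weyl symbol of the zero mean Wigner distribution of a symmetric Gaussian process. -/
theorem weylSymbol_zeroMeanWigner {u : TemperedGSP V P} (hG : IsGaussianGSP u)
    (hS : IsSymmetricGSP u) {σ : 𝓢'(Phase V, ℂ)} (hσ : IsWeylSymbol (covOp u) σ)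
    {U : TemperedGSP (Phase V) P} (hU : IsTensorSquare u U) {σW τ : 𝓢'(Phase (Phase V), ℂ)}
    (hσW : IsWeylSymbol (covOp (zeroMeanWigner U)) σW) (hτ : IsTensorDistribution σ σ τ) :
    σW = compLinear (compLinear τ kappa) (idBlock (negEquiv symplJ)) := by
  refine ext_crossWigner_crossWigner fun φ₁ ψ₁ φ₂ ψ₂ => ?_
  refine mul_left_cancel₀ (normConst_ne_zero (Phase V)) ?_
  -- The constant for `Phase V` is the square of the one for `V`, matching the two factors
  -- contributed by `hσ`.
  rw [← hσW, pair_covOp_zeroMeanWigner hG hS hU, pair_compLinear_crossWigner hτ, normConst_phase,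
    ← pair_covOp_eq_covForm, ← pair_covOp_eq_covForm, hσ, hσ]
  ring

end

end WignerGSP

open WignerGSP
-- Distributions have no pointwise values, so the coordinate form of the symbol is expressed through
-- the value of the linear map κ₂ ∘ (I ⊗ (-J)) at a point.
theorem theorem5p4 (d : ℕ) {Ω : Type*} [MeasurableSpace Ω] (P : Measure Ω)
    [IsProbabilityMeasure P] (u : TemperedGSP (EuclideanSpace ℝ (Fin d)) P)
    (hG : IsGaussianGSP u) (hS : IsSymmetricGSP u) :
    (∃! σ_u, IsWeylSymbol (covOp u) σ_u) ∧
    (∃! U, IsTensorSquare u U) ∧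
    ∀ σ_u U, IsWeylSymbol (covOp u) σ_u → IsTensorSquare u U →
      IsZeroMean (zeroMeanWigner U) ∧
      (∃! σ_W, IsWeylSymbol (covOp (zeroMeanWigner U)) σ_W) ∧
      (∃! τ, IsTensorDistribution σ_u σ_u τ) ∧
      ∀ σ_W τ, IsWeylSymbol (covOp (zeroMeanWigner U)) σ_W → IsTensorDistribution σ_u σ_u τ →
        σ_W = compLinear (compLinear τ kappa) (idBlock (negEquiv symplJ)) ∧
        ∀ x₁ x₂ ξ₁ ξ₂ : EuclideanSpace ℝ (Fin d),
          kappa (idBlock (negEquiv symplJ)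
              (WithLp.toLp 2 (WithLp.toLp 2 (x₁, x₂), WithLp.toLp 2 (ξ₁, ξ₂)))) =
            WithLp.toLp 2
              (WithLp.toLp 2 (x₁ - (1 / 2 : ℝ) • ξ₂, x₂ + (1 / 2 : ℝ) • ξ₁),
                WithLp.toLp 2 (x₁ + (1 / 2 : ℝ) • ξ₂, x₂ - (1 / 2 : ℝ) • ξ₁)) :=
  ⟨existsUnique_weylSymbol_covOp u, existsUnique_tensorSquare hG hS, fun σ_u U hσ hU =>
    ⟨isZeroMean_zeroMeanWigner U, existsUnique_weylSymbol_covOp _,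
      existsUnique_tensorDistribution σ_u σ_u, fun _ _ hσW hτ =>
        ⟨weylSymbol_zeroMeanWigner hG hS hσ hU hσW hτ, kappa_idBlock_negEquiv_symplJ⟩⟩⟩
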